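/- **Setting.** A branching random walk (BRW) on $\mathbb{R}$ starts from one particle at $0$ (generation $0$); independently of all others, each particle produces a point process of children (finitely or infinitely many) around its position, these point processes being identically distributed. For a particle $u$, write $S_u$ for its position and $|u|$ for its generation. Assume that the BRW is supercritical, $\mathbb{E}[\#\{u:|u|=1\}]>1$, and non-degenerate: for every $x\in\mathbb{R}$, $\mathbb{P}(\exists u:\ |u|=1,\ S_u\neq x)>0$. For $t\in\mathbb{R}$ let $$\kappa(t)=\log \mathbb{E}\Big[\sum_{|u|=1}e^{tS_u}\Big]\in(-\infty,\infty],$$ and, when $\kappa(t)<\infty$, let $$\kappa'(t)=\mathbb{E}\Big[\sum_{|u|=1}S_ue^{tS_u-\kappa(t)}\Big],\qquad W_n(t)=\sum_{|u|=n}e^{tS_u-n\kappa(t)}.$$ The process $(W_n(t))_{n\ge 0}$ is a non-negative martingale; $W_\infty(t)$ denotes its almost sure limit. Given a probability measure $\nu$ on $\mathbb{R}$, let $(Y_u)$ be i.i.d. with law $\nu$, indexed by the particles and independent of the BRW, and put $\mathcal{E}_n=\sum_{|u|=n}\delta_{S_u+Y_u}$. Write $\tau_x$ for the shift of a measure by $x$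 (an atom at $y$ is moved to $y+x$). The set of point measures on $\mathbb{R}$ (locally finite measures with values in $\{0,1,2,\dots,\infty\}$) carries the topology of vague convergence. A function $L:\mathbb{R}\to\mathbb{R}$ is regularly varying at $\infty$ of index $\alpha\in\mathbb{R}$ if $\lim_{x\to\infty}L(\lambda x)/L(x)=\lambda^\alpha$ for all $\lambda>0$. For a Radon measure $\mu$ on $\mathbb{R}$ and a non-negative random variable $Q$, $\mathrm{PPP}(Q\mu)$ denotes a Cox process which, conditionally on $Q$, is a Poisson point process with intensity $Q\mu$. **Theorem 1.2.** Let $\theta>0$ be such that $\kappa(\theta)<\infty$. Assume that there is $\delta>0$ with $\kappa(\theta+\delta)+\kappa(\theta-\delta)<\infty$, and that $$\theta\kappa'(\theta)-\kappa(\theta)<0\qquad\text{and}\qquad \mathbb{E}\big[W_1(\theta)\log_+W_1(\theta)\big]<\infty,$$ where $\log_+x=\log\max(x,1)$. Let $\nu$ be a probability measure on $\mathbb{R}$ such that $$\nu([x,\infty))\sim L(x)e^{-\theta x}\quad\text{as }x\to\infty$$ for a function $L$ that is regularly varying at $\infty$ of index $\alpha\in\mathbb{R}$. Put $$m_n=n\,\frac{\kappa(\theta)}{\theta}+\frac1\theta\log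 L(n)\quad\text{and}\quad c_1=\Big(\frac{\kappa(\theta)}{\theta}-\kappa'(\theta)\Big)^{\alpha}.$$ Then $\tau_{-m_n}\mathcal{E}_n$ is almost surely a point measure for every $n$ (with $\log L(n)$ replaced by an arbitrary real number for the finitely many $n$ with $L(n)\le 0$), and, as $n\to\infty$, $\tau_{-m_n}\mathcal{E}_n$ converges in law, for the topology of vague convergence, to a $\mathrm{PPP}\big(c_1\,\theta\,W_\infty(\theta)\,e^{-\theta x}\,dx\big)$. -/

import Mathlib

open MeasureTheory ProbabilityTheory Filter Topology Asymptotics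
open scoped NNReal ENNReal CompactlySupported

/-! ### Point measures on the line and the vague topology -/

/-- A point measure on `ℝ`: a locally finite (i.e. Radon) measure that takes only the
values `0, 1, 2, …, ∞` on Borel sets. -/
def IsPointMeasure (μ : Measure ℝ) : Prop :=
  (∀ K : Set ℝ, IsCompact K → μ K < ∞) ∧
    ∀ B : Set ℝ, MeasurableSet B → ∃ n : ℕ∞, μ B = (n : ℝ≥0∞)

/-- The space of point measures on `ℝ`. -/
def PointMeasure : Type := {μ : Measure ℝ // IsPointMeasure μ}

/-- The zero measure is a point measure. -/
theorem isPointMeasure_zero : IsPointMeasure 0 :=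
  ⟨fun _ _ => by simp, fun _ _ => ⟨0, by simp⟩⟩

namespace PointMeasure

/-- The vague topology: the coarsest topology for which `μ ↦ ∫ φ dμ` is continuous for every
continuous compactly supported `φ : ℝ → ℝ`. -/
noncomputable instance instTopologicalSpace : TopologicalSpace PointMeasure :=
  TopologicalSpace.induced (fun (μ : PointMeasure) (φ : C_c(ℝ, ℝ)) => ∫ x, φ x ∂μ.1) inferInstance

/-- The Borel σ-algebra of the vague topology. -/
noncomputable instance instMeasurableSpace : MeasurableSpace PointMeasure := borel PointMeasure

instance instBorelSpace : BorelSpace PointMeasure := ⟨rfl⟩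

open Classical in
/-- A measure on `ℝ` seen as an element of the space of point measures
(the zero measure if it is not a point measure). -/
noncomputable def ofMeasure (μ : Measure ℝ) : PointMeasure :=
  if h : IsPointMeasure μ then ⟨μ, h⟩ else ⟨0, isPointMeasure_zero⟩

end PointMeasure

/-- The shift `τ_x μ` of a measure on `ℝ`: every atom `y` is moved to `y + x`. -/
noncomputable def shiftMeasure (x : ℝ) (μ : Measure ℝ) : Measure ℝ := μ.map (fun y => y + x)

/-- `Z` is a Cox process `PPP(Q μ)`, driven by the non-negative random variable `Q`:
conditionally on `Q`, the numbers of points of `Z` in disjoint bounded Borel sets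
`B 1, …, B k` are independent Poisson variables with parameters `Q μ(B 1), …, Q μ(B k)`.
The conditional statement is tested on the events `{Q ∈ A}`. -/
structure IsCoxProcess {Ω : Type*} [MeasurableSpace Ω] (P : Measure Ω)
    (Q : Ω → ℝ≥0) (μ : Measure ℝ) (Z : Ω → PointMeasure) : Prop where
  measurable_intensity : Measurable Q
  measurable_process : Measurable Z
  poisson : ∀ (k : ℕ) (B : Fin k → Set ℝ), (∀ i, MeasurableSet (B i)) →
    (∀ i, Bornology.IsBounded (B i)) → Pairwise (fun i j => Disjoint (B i) (B j)) →
    ∀ (n : Fin k → ℕ) (A : Set ℝ≥0), MeasurableSet A →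
      P {ω | Q ω ∈ A ∧ ∀ i, (Z ω).1 (B i) = (n i : ℝ≥0∞)} =
        ∫⁻ ω in Q ⁻¹' A, ∏ i, poissonMeasure (Q ω * (μ (B i)).toNNReal) {n i} ∂P

/-! ### Regular variation -/

/-- `L` is regularly varying at `∞` with index `α`. -/
def IsRegularlyVarying (L : ℝ → ℝ) (α : ℝ) : Prop :=
  ∀ l : ℝ, 0 < l → Tendsto (fun x => L (l * x) / L x) atTop (𝓝 (l ^ α))

/-! ### Reproduction laws -/

/-- One realisation of the point process of children: the number (possibly `0` or `∞`) of
children, and the sequence of their displacements. The children are those with index `i`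
smaller than the number of children; the other entries of the sequence are irrelevant. -/
abbrev Offspring : Type := ℕ∞ × (ℕ → ℝ)

open Classical in
/-- `E[∑_{|u|=1} exp(θ S_u)]` for the reproduction law `η`. -/
noncomputable def laplaceTransform (η : Measure Offspring) (θ : ℝ) : ℝ≥0∞ :=
  ∫⁻ p, ∑' i : ℕ, (if (i : ℕ∞) < p.1 then ENNReal.ofReal (Real.exp (θ * p.2 i)) else 0) ∂η

/-- The log-Laplace transform `κ(θ)`, with values in the extended reals. -/
noncomputable def kappa (η : Measure Offspring) (θ : ℝ) : EReal :=
  ENNReal.log (laplaceTransform η θ)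

/-- The real number `κ(θ)`, for `θ` such that `κ(θ)` is finite. -/
noncomputable def kappaReal (η : Measure Offspring) (θ : ℝ) : ℝ := (kappa η θ).toReal

open Classical in
/-- `κ'(θ) = E[∑_{|u|=1} S_u exp(θ S_u - κ(θ))]`. -/
noncomputable def kappaDeriv (η : Measure Offspring) (θ : ℝ) : ℝ :=
  ∫ p, ∑' i : ℕ,
    (if (i : ℕ∞) < p.1 then p.2 i * Real.exp (θ * p.2 i - kappaReal η θ) else 0) ∂η

/-- The mean number of children is larger than one. -/
def IsSupercritical (η : Measure Offspring) : Prop := 1 < ∫⁻ p, (p.1 : ℝ≥0∞) ∂η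

/-- For every `x`, with positive probability some child has a displacement different from `x`. -/
def IsNondegenerate (η : Measure Offspring) : Prop :=
  ∀ x : ℝ, 0 < η {p | ∃ i : ℕ, (i : ℕ∞) < p.1 ∧ p.2 i ≠ x}

/-! ### The branching random walk and its last progeny modification

Individuals are labelled by finite words of natural numbers: the root is `[]`, and `i :: u` is
the `i`-th (potential) child of `u`. The individual `u` has `N u` children, and the
displacement of its `i`-th child is `X u i`. -/

section BranchingRandomWalk

variable {Ω : Type*}

/-- The individual `u` is realised: each of its ancestors has enough children. -/
def IsAlive (N : List ℕ → Ω → ℕ∞) : List ℕ → Ω → Prop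
  | [], _ => True
  | i :: u, ω => IsAlive N u ω ∧ (i : ℕ∞) < N u ω

/-- The position `S_u`; the root is at `0`. -/
def position (X : List ℕ → Ω → ℕ → ℝ) : List ℕ → Ω → ℝ
  | [], _ => 0
  | i :: u, ω => position X u ω + X u ω i

/-- The particles alive at generation `n`. -/
def Gen (N : List ℕ → Ω → ℕ∞) (n : ℕ) (ω : Ω) : Type :=
  {u : List ℕ // u.length = n ∧ IsAlive N u ω}

/-- The branching random walk with reproduction law `η`: the offspring `(N u, X u)` of the
individuals are i.i.d. with law `η`. -/
structure IsBranchingRandomWalk [MeasurableSpace Ω] (P : Measure Ω) (η : Measure Offspring)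
    (N : List ℕ → Ω → ℕ∞) (X : List ℕ → Ω → ℕ → ℝ) : Prop where
  hasLaw : ∀ u, HasLaw (fun ω => ((N u ω, X u ω) : Offspring)) η P
  indep : iIndepFun (fun u ω => ((N u ω, X u ω) : Offspring)) P

/-- The perturbations `Y u` are i.i.d. with law `ν` and independent of the branching random
walk. -/
structure IsPerturbation [MeasurableSpace Ω] (P : Measure Ω) (ν : Measure ℝ)
    (N : List ℕ → Ω → ℕ∞) (X : List ℕ → Ω → ℕ → ℝ) (Y : List ℕ → Ω → ℝ) : Prop where
  hasLaw : ∀ u, HasLaw (Y u) ν P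
  indep : iIndepFun Y P
  indep_walk : IndepFun (fun ω u => ((N u ω, X u ω) : Offspring)) (fun ω u => Y u ω) P

/-- The additive martingale `W_n(θ) = ∑_{|u|=n} exp(θ S_u - n κ(θ))`. -/
noncomputable def additiveMartingale (η : Measure Offspring) (N : List ℕ → Ω → ℕ∞)
    (X : List ℕ → Ω → ℕ → ℝ) (θ : ℝ) (n : ℕ) (ω : Ω) : ℝ :=
  ∑' u : Gen N n ω, Real.exp (θ * position X u.1 ω - n * kappaReal η θ)

/-- The limit `W_∞(θ)` of the additive martingale. -/
noncomputable def additiveLimit (η : Measure Offspring) (N : List ℕ → Ω → ℕ∞)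
    (X : List ℕ → Ω → ℕ → ℝ) (θ : ℝ) (ω : Ω) : ℝ :=
  limUnder atTop (fun n : ℕ => additiveMartingale η N X θ n ω)

/-- The last progeny modified branching random walk `ℰ_n = ∑_{|u|=n} δ_{S_u + Y_u}`. -/
noncomputable def modifiedProcess (N : List ℕ → Ω → ℕ∞) (X : List ℕ → Ω → ℕ → ℝ)
    (Y : List ℕ → Ω → ℝ) (n : ℕ) (ω : Ω) : Measure ℝ :=
  Measure.sum (fun u : Gen N n ω => Measure.dirac (position X u.1 ω + Y u.1 ω))

end BranchingRandomWalk

/-- The centring `m_n = n κ(θ)/θ + (1/θ) log L(n)`. -/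
noncomputable def centring (η : Measure Offspring) (θ : ℝ) (L : ℝ → ℝ) (n : ℕ) : ℝ :=
  n * (kappaReal η θ / θ) + 1 / θ * Real.log (L n)

/-- The constant `c_1 = (κ(θ)/θ - κ'(θ)) ^ α`. -/
noncomputable def limitConstant (η : Measure Offspring) (θ α : ℝ) : ℝ :=
  (kappaReal η θ / θ - kappaDeriv η θ) ^ α

/-- The measure `c θ exp(-θ x) dx` on `ℝ`. -/
noncomputable def exponentialIntensity (c θ : ℝ) : Measure ℝ :=
  volume.withDensity (fun x => ENNReal.ofReal (c * θ * Real.exp (-θ * x)))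

/-! ### The vague topology is second countable -/

namespace PointMeasure

theorem coe_ofMeasure {μ : Measure ℝ} (h : IsPointMeasure μ) : (ofMeasure μ).1 = μ :=
  congrArg Subtype.val (dif_pos h)

theorem coe_ofMeasure_of_not {μ : Measure ℝ} (h : ¬ IsPointMeasure μ) : (ofMeasure μ).1 = 0 :=
  congrArg Subtype.val (dif_neg h)

instance (μ : PointMeasure) : IsFiniteMeasureOnCompacts μ.1 := ⟨fun K hK => μ.2.1 K hK⟩

theorem integrable (μ : PointMeasure) (φ : C_c(ℝ, ℝ)) : Integrable φ μ.1 :=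
  φ.continuous.integrable_of_hasCompactSupport φ.hasCompactSupport

theorem continuous_integral (φ : C_c(ℝ, ℝ)) :
    Continuous fun μ : PointMeasure => ∫ x, φ x ∂μ.1 :=
  (continuous_apply φ).comp (continuous_induced_dom (f := fun (μ : PointMeasure)
    (φ : C_c(ℝ, ℝ)) => ∫ x, φ x ∂μ.1))

/-- A continuous cutoff, equal to `1` on `[-k, k]` and supported in `[-(k + 1), k + 1]`. -/
noncomputable def cutoff (k : ℕ) : C_c(ℝ, ℝ) where
  toFun x := max 0 (min 1 (k + 1 - |x|))
  continuous_toFun := by fun_prop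
  hasCompactSupport' := by
    refine HasCompactSupport.intro (isCompact_Icc (a := -((k : ℝ) + 1)) (b := k + 1)) fun x hx => ?_
    have : (k : ℝ) + 1 < |x| := by
      by_contra! h
      exact hx (abs_le.mp h)
    exact max_eq_left (min_le_of_right_le (by linarith))

theorem cutoff_apply (k : ℕ) (x : ℝ) : cutoff k x = max 0 (min 1 (k + 1 - |x|)) := rfl

theorem cutoff_nonneg (k : ℕ) (x : ℝ) : 0 ≤ cutoff k x := le_max_left _ _

theorem cutoff_eq_one {k : ℕ} {x : ℝ} (h : |x| ≤ k) : cutoff k x = 1 := by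
  rw [cutoff_apply, min_eq_left (by linarith), max_eq_right zero_le_one]

theorem cutoff_eq_zero {k : ℕ} {x : ℝ} (h : (k : ℝ) + 1 ≤ |x|) : cutoff k x = 0 :=
  max_eq_left (min_le_of_right_le (by linarith))

/-- A countable family of test functions: cutoffs, and cutoffs of a dense sequence. -/
noncomputable def testFun : ℕ ⊕ ℕ × ℕ → C_c(ℝ, ℝ)
  | .inl k => cutoff k
  | .inr (k, j) =>
    { toFun := fun x => TopologicalSpace.denseSeq C(ℝ, ℝ) j x * cutoff k x
      continuous_toFun := by fun_prop
      hasCompactSupport' := (cutoff k).hasCompactSupport.mul_left }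

theorem exists_testFun_near (φ : C_c(ℝ, ℝ)) :
    ∃ k, ∀ ε > 0, ∃ j, ∀ x, |φ x - testFun (.inr (k, j)) x| ≤ ε * cutoff k x := by
  obtain ⟨r, hr⟩ := φ.hasCompactSupport.isCompact.isBounded.subset_closedBall 0
  obtain ⟨k, hk⟩ := exists_nat_ge r
  refine ⟨k, fun ε hε => ?_⟩
  have hopen : IsOpen {f : C(ℝ, ℝ) | Set.MapsTo (f - φ.toContinuousMap)
      (Set.Icc (-((k : ℝ) + 1)) (k + 1)) (Set.Ioo (-ε) ε)} :=
    (ContinuousMap.isOpen_setOfPred_mapsTo isCompact_Icc isOpen_Ioo).preimage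
      (by fun_prop : Continuous fun f : C(ℝ, ℝ) => f - φ.toContinuousMap)
  obtain ⟨j, hj⟩ := (TopologicalSpace.denseRange_denseSeq C(ℝ, ℝ)).exists_mem_open hopen
    ⟨φ.toContinuousMap, fun x _ => by simp [hε]⟩
  refine ⟨j, fun x => ?_⟩
  have hφ : φ x = φ x * cutoff k x := by
    by_cases hx : |x| ≤ k
    · rw [cutoff_eq_one hx, mul_one]
    · have : φ x = 0 := by
        by_contra h
        have := hr (subset_tsupport _ h)
        rw [mem_closedBall_zero_iff, Real.norm_eq_abs] at this
        exact hx (this.trans hk)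
      rw [this, zero_mul]
  have htest : testFun (.inr (k, j)) x = TopologicalSpace.denseSeq C(ℝ, ℝ) j x * cutoff k x := rfl
  rw [htest]
  by_cases hx : |x| ≤ k + 1
  · have h2 := hj (abs_le.mp hx)
    have h3 : |φ x - TopologicalSpace.denseSeq C(ℝ, ℝ) j x| ≤ ε := by
      rw [abs_sub_comm]
      exact (abs_lt.mpr h2).le
    calc _ = |φ x - TopologicalSpace.denseSeq C(ℝ, ℝ) j x| * cutoff k x := by
          rw [← abs_of_nonneg (cutoff_nonneg k x), ← abs_mul, abs_of_nonneg (cutoff_nonneg k x),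
            sub_mul, ← hφ]
      _ ≤ _ := mul_le_mul_of_nonneg_right h3 (cutoff_nonneg k x)
  · have : cutoff k x = 0 := cutoff_eq_zero (not_le.mp hx).le
    rw [hφ, this]
    simp

theorem isInducing_testFun :
    IsInducing fun (μ : PointMeasure) i => ∫ x, testFun i x ∂μ.1 := by
  refine ⟨le_antisymm (continuous_iff_le_induced.mp
    (continuous_pi fun i => continuous_integral (testFun i))) ?_⟩
  let T : TopologicalSpace PointMeasure :=
    TopologicalSpace.induced (fun μ i => ∫ x, testFun i x ∂μ.1) inferInstance
  have hT (i) : @Continuous _ _ T _ fun μ : PointMeasure => ∫ x, testFun i x ∂μ.1 :=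
    (continuous_apply i).comp (continuous_induced_dom (f := fun (μ : PointMeasure) i =>
      ∫ x, testFun i x ∂μ.1))
  refine continuous_iff_le_induced.mp (@continuous_pi _ _ _ T _ _ fun φ => ?_)
  obtain ⟨k, hk⟩ := exists_testFun_near φ
  refine (@continuous_iff_continuousAt _ _ T _ _).mpr fun μ => ?_
  refine Metric.tendsto_nhds.mpr fun ε hε => ?_
  set C := ∫ x, cutoff k x ∂μ.1 with hC
  have hC0 : 0 ≤ C := integral_nonneg (cutoff_nonneg k)
  obtain ⟨j, hj⟩ := hk (ε / (4 * (C + 1))) (by positivity)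
  have key (ν : PointMeasure) : |∫ x, φ x ∂ν.1 - ∫ x, testFun (.inr (k, j)) x ∂ν.1| ≤
      ε / (4 * (C + 1)) * ∫ x, cutoff k x ∂ν.1 := by
    rw [← integral_sub (integrable ν _) (integrable ν _), ← integral_const_mul]
    refine (abs_integral_le_integral_abs).trans (integral_mono ?_ ?_ hj)
    · exact ((integrable ν _).sub (integrable ν _)).abs
    · exact (integrable ν _).const_mul _
  have h1 := Metric.tendsto_nhds.mp
    ((@continuous_iff_continuousAt _ _ T _ _).mp (hT (.inl k)) μ) 1 one_pos
  have h2 := Metric.tendsto_nhds.mp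
    ((@continuous_iff_continuousAt _ _ T _ _).mp (hT (.inr (k, j))) μ) (ε / 4) (by positivity)
  filter_upwards [h1, h2] with ν h1 h2
  have h1' : ∫ x, cutoff k x ∂ν.1 ≤ C + 1 := by
    have := (abs_lt.mp h1).2
    change ∫ x, cutoff k x ∂ν.1 - ∫ x, cutoff k x ∂μ.1 < 1 at this
    linarith
  have e1 : ε / (4 * (C + 1)) * ∫ x, cutoff k x ∂ν.1 ≤ ε / 4 := by
    calc _ ≤ ε / (4 * (C + 1)) * (C + 1) := by gcongr
      _ = ε / 4 := by field_simp
  have e2 : ε / (4 * (C + 1)) * ∫ x, cutoff k x ∂μ.1 ≤ ε / 4 := by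
    calc _ ≤ ε / (4 * (C + 1)) * (C + 1) := by gcongr; linarith
      _ = ε / 4 := by field_simp
  have k1 := abs_le.mp ((key ν).trans e1)
  have k2 := abs_le.mp ((key μ).trans e2)
  rw [Real.dist_eq, abs_lt] at h2 ⊢
  constructor <;> linarith [h2.1, h2.2, k1.1, k1.2, k2.1, k2.2]

/-- Measurability for the Borel σ-algebra of the vague topology is tested on integrals. -/
theorem measurable_of_integral {Ω : Type*} [MeasurableSpace Ω] {F : Ω → PointMeasure}
    (h : ∀ φ : C_c(ℝ, ℝ), Measurable fun ω => ∫ x, φ x ∂(F ω).1) : Measurable F := by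
  have hb : instMeasurableSpace = MeasurableSpace.comap
      (fun (μ : PointMeasure) i => ∫ x, testFun i x ∂μ.1) inferInstance := by
    refine Eq.trans ?_ (congrArg _ (BorelSpace.measurable_eq (α := ℕ ⊕ ℕ × ℕ → ℝ)).symm)
    refine Eq.trans ?_ (borel_comap (f := fun (μ : PointMeasure) i => ∫ x, testFun i x ∂μ.1))
    exact congrArg (fun T => @borel PointMeasure T) isInducing_testFun.eq_induced
  rw [hb]
  exact measurable_comap_iff.mpr (measurable_pi_lambda _ fun i => h _)

/-! ### Convergence in law from characteristic functionals -/

/-- Evaluation of a point measure on the first `k` functions of a sequence. -/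
noncomputable def evalVec (d : ℕ → C_c(ℝ, ℝ)) (k : ℕ) (μ : PointMeasure) :
    EuclideanSpace ℝ (Fin k) :=
  WithLp.toLp 2 fun i => ∫ x, d i x ∂μ.1

theorem continuous_evalVec (d : ℕ → C_c(ℝ, ℝ)) (k : ℕ) : Continuous (evalVec d k) := by
  unfold evalVec
  exact (PiLp.continuous_toLp 2 _).comp (continuous_pi fun i => continuous_integral _)

theorem charFun_map_evalVec (d : ℕ → C_c(ℝ, ℝ)) (k : ℕ) (P : Measure PointMeasure)
    (t : EuclideanSpace ℝ (Fin k)) :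
    charFun (P.map (evalVec d k)) t =
      ∫ μ, Complex.exp ((∫ x, (∑ i, t i • d (i : ℕ)) x ∂μ.1 : ℝ) * Complex.I) ∂P := by
  rw [charFun_apply, integral_map (continuous_evalVec d k).measurable.aemeasurable (by fun_prop)]
  congr with μ
  congr 3
  rw [PiLp.inner_apply]
  simp only [CompactlySupportedContinuousMap.coe_sum, Finset.sum_apply,
    CompactlySupportedContinuousMap.smul_apply, smul_eq_mul]
  refine Eq.trans ?_ (integral_finsetSum Finset.univ fun (i : Fin k) _ =>
    (integrable μ (d i)).const_mul (t i)).symm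
  refine Finset.sum_congr rfl fun i _ => ?_
  rw [integral_const_mul]
  simp [evalVec]

/-- The largest open set of `ℝᵏ` whose cylinder is contained in `U`. -/
def cylinderCore (U : Set (ℕ → ℝ)) (k : ℕ) : Set (EuclideanSpace ℝ (Fin k)) :=
  interior {x | ∀ y : ℕ → ℝ, (∀ i : Fin k, y i = x i) → y ∈ U}

theorem iUnion_preimage_cylinderCore (d : ℕ → C_c(ℝ, ℝ)) {U : Set (ℕ → ℝ)} (hU : IsOpen U) :
    ⋃ k, evalVec d k ⁻¹' cylinderCore U k = (fun μ i => ∫ x, d i x ∂μ.1) ⁻¹' U := by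
  ext μ
  simp only [Set.mem_iUnion, Set.mem_preimage]
  constructor
  · rintro ⟨k, hk⟩
    exact interior_subset hk _ fun i => rfl
  · intro h
    obtain ⟨I, u, hu, hI⟩ := isOpen_pi_iff.mp hU _ h
    refine ⟨I.sup id + 1, mem_interior.mpr ⟨{x | ∀ i : Fin (I.sup id + 1), (i : ℕ) ∈ I → x i ∈ u i},
      ?_, ?_, ?_⟩⟩
    · intro x hx y hy
      refine hI fun i hi => ?_
      have hlt : i < I.sup id + 1 := Nat.lt_succ_of_le (Finset.le_sup (f := id) hi)
      have := hy ⟨i, hlt⟩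
      simp only at this
      rw [this]
      exact hx ⟨i, hlt⟩ hi
    · simp only [Set.ofPred_forall]
      refine isOpen_iInter_of_finite fun i => isOpen_iInter_of_finite fun hi => ?_
      exact (hu i hi).1.preimage (by fun_prop : Continuous fun x : EuclideanSpace ℝ (Fin _) => x i)
    · exact fun i hi => (hu i hi).2

theorem monotone_preimage_cylinderCore (d : ℕ → C_c(ℝ, ℝ)) (U : Set (ℕ → ℝ)) :
    Monotone fun k => evalVec d k ⁻¹' cylinderCore U k := by
  intro k l hkl μ hμ
  let r : EuclideanSpace ℝ (Fin l) → EuclideanSpace ℝ (Fin k) :=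
    fun x => WithLp.toLp 2 fun i => x (Fin.castLE hkl i)
  have hr : Continuous r := (PiLp.continuous_toLp 2 _).comp (by fun_prop)
  refine mem_interior.mpr ⟨r ⁻¹' cylinderCore U k, ?_, isOpen_interior.preimage hr, hμ⟩
  intro x hx y hy
  exact interior_subset hx y fun i => hy (Fin.castLE hkl i)

/-- Convergence of characteristic functionals implies convergence in law for the vague
topology. -/
theorem tendsto_of_charFunctional {Ps : ℕ → ProbabilityMeasure PointMeasure}
    {P : ProbabilityMeasure PointMeasure}
    (h : ∀ φ : C_c(ℝ, ℝ), Tendsto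
      (fun n => ∫ μ, Complex.exp ((∫ x, φ x ∂μ.1 : ℝ) * Complex.I) ∂(Ps n : Measure PointMeasure))
      atTop (𝓝 (∫ μ, Complex.exp ((∫ x, φ x ∂μ.1 : ℝ) * Complex.I) ∂(P : Measure PointMeasure)))) :
    Tendsto Ps atTop (𝓝 P) := by
  obtain ⟨e⟩ : Nonempty (ℕ ≃ ℕ ⊕ ℕ × ℕ) := ⟨(nonempty_denumerable _).some.eqv.symm⟩
  let d : ℕ → C_c(ℝ, ℝ) := testFun ∘ e
  have hd : IsInducing fun (μ : PointMeasure) i => ∫ x, d i x ∂μ.1 :=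
    (Homeomorph.piCongrLeft (Y := fun _ => ℝ) e).symm.isInducing.comp isInducing_testFun
  refine tendsto_of_forall_isOpen_le_liminf_nat' fun G hG => ?_
  obtain ⟨U, hU, rfl⟩ := hd.isOpen_iff.mp hG
  rw [← iUnion_preimage_cylinderCore d hU,
    (monotone_preimage_cylinderCore d U).measure_iUnion]
  refine iSup_le fun k => ?_
  have hm : Measurable (evalVec d k) := (continuous_evalVec d k).measurable
  have hlim : Tendsto (fun n => (Ps n).map hm.aemeasurable) atTop (𝓝 (P.map hm.aemeasurable)) := by
    refine ProbabilityMeasure.tendsto_of_tendsto_charFun fun t => ?_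
    simp only [ProbabilityMeasure.toMeasure_map, charFun_map_evalVec]
    exact h _
  have := ProbabilityMeasure.le_liminf_measure_open_of_tendsto hlim
    (isOpen_interior : IsOpen (cylinderCore U k))
  simp only [ProbabilityMeasure.toMeasure_map, Measure.map_apply hm
    (isOpen_interior : IsOpen (cylinderCore U k)).measurableSet] at this
  refine this.trans (liminf_le_liminf (Eventually.of_forall fun n => measure_mono ?_))
  exact Set.subset_iUnion (fun k => evalVec d k ⁻¹' cylinderCore U k) k

end PointMeasure

/-! ### Measures with countably many unit atoms -/

open Classical in
/-- The measure `∑ i ∈ a, δ_{x i}`. -/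
noncomputable def atomSum {ι : Type*} (a : Set ι) (x : ι → ℝ) : Measure ℝ :=
  Measure.sum fun i => if i ∈ a then Measure.dirac (x i) else 0

section atomSum

variable {ι : Type*} {a : Set ι} {x : ι → ℝ}

open Classical in
theorem atomSum_apply {B : Set ℝ} (hB : MeasurableSet B) :
    atomSum a x B = ∑' i, if i ∈ a ∧ x i ∈ B then 1 else 0 := by
  rw [atomSum, Measure.sum_apply _ hB]
  refine tsum_congr fun i => ?_
  by_cases hi : i ∈ a <;> simp [hi, Measure.dirac_apply' _ hB, Set.indicator]

theorem atomSum_apply_eq_encard {B : Set ℝ} (hB : MeasurableSet B) :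
    atomSum a x B = ({i | i ∈ a ∧ x i ∈ B}.encard : ℝ≥0∞) := by
  classical
  rw [atomSum_apply hB, ← ENNReal.tsum_set_one, tsum_subtype _ (fun _ => (1 : ℝ≥0∞))]
  exact tsum_congr fun i => by simp [Set.indicator]

theorem isPointMeasure_atomSum_iff :
    IsPointMeasure (atomSum a x) ↔ ∀ k : ℕ, atomSum a x (Set.Icc (-k : ℝ) k) < ∞ := by
  refine ⟨fun h k => h.1 _ isCompact_Icc, fun h => ⟨fun K hK => ?_, fun B hB =>
    ⟨_, atomSum_apply_eq_encard hB⟩⟩⟩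
  obtain ⟨r, hr⟩ := hK.isBounded.subset_closedBall 0
  obtain ⟨k, hk⟩ := exists_nat_ge r
  refine (measure_mono fun y hy => ?_).trans_lt (h k)
  have := hr hy
  rw [mem_closedBall_zero_iff, Real.norm_eq_abs] at this
  exact abs_le.mp (this.trans hk)

theorem map_atomSum [Countable ι] {f : ℝ → ℝ} (hf : Measurable f) :
    (atomSum a x).map f = atomSum a fun i => f (x i) := by
  ext B hB
  rw [Measure.map_apply hf hB, atomSum_apply (hf hB), atomSum_apply hB]
  rfl

open Classical in
theorem hasSum_integral_atomSum {f : ℝ → ℝ} (hf : Integrable f (atomSum a x)) :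
    HasSum (fun i => if i ∈ a then f (x i) else 0) (∫ y, f y ∂atomSum a x) := by
  convert! hasSum_integral_measure hf using 2 with i
  by_cases hi : i ∈ a <;> simp [hi]

theorem measurable_atomSum {Ω : Type*} [MeasurableSpace Ω] [Countable ι] {a : Ω → Set ι}
    {x : Ω → ι → ℝ} (ha : ∀ i, MeasurableSet {ω | i ∈ a ω}) (hx : ∀ i, Measurable fun ω => x ω i) :
    Measurable fun ω => atomSum (a ω) (x ω) := by
  classical
  refine Measure.measurable_of_measurable_coe _ fun B hB => ?_
  simp only [atomSum_apply hB]
  refine Measurable.tsum fun i => Measurable.ite ?_ measurable_const measurable_const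
  exact (ha i).inter (hx i hB)

theorem measurableSet_isPointMeasure_atomSum {Ω : Type*} [MeasurableSpace Ω] [Countable ι]
    {a : Ω → Set ι} {x : Ω → ι → ℝ} (ha : ∀ i, MeasurableSet {ω | i ∈ a ω})
    (hx : ∀ i, Measurable fun ω => x ω i) :
    MeasurableSet {ω | IsPointMeasure (atomSum (a ω) (x ω))} := by
  simp only [isPointMeasure_atomSum_iff, Set.ofPred_forall]
  refine MeasurableSet.iInter fun k => measurableSet_lt ?_ measurable_const
  exact (Measure.measurable_coe measurableSet_Icc).comp (measurable_atomSum ha hx)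

theorem PointMeasure.measurable_ofMeasure_atomSum {Ω : Type*} [MeasurableSpace Ω] [Countable ι]
    {a : Ω → Set ι} {x : Ω → ι → ℝ} (ha : ∀ i, MeasurableSet {ω | i ∈ a ω})
    (hx : ∀ i, Measurable fun ω => x ω i) :
    Measurable fun ω => PointMeasure.ofMeasure (atomSum (a ω) (x ω)) := by
  classical
  refine PointMeasure.measurable_of_integral fun φ => ?_
  have hM := measurable_atomSum ha hx
  have : (fun ω => ∫ y, φ y ∂(PointMeasure.ofMeasure (atomSum (a ω) (x ω))).1) = fun ω =>
      if IsPointMeasure (atomSum (a ω) (x ω)) then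
        (∫⁻ y, ENNReal.ofReal (φ y) ∂atomSum (a ω) (x ω)).toReal -
          (∫⁻ y, ENNReal.ofReal (-φ y) ∂atomSum (a ω) (x ω)).toReal else 0 := by
    ext ω
    by_cases h : IsPointMeasure (atomSum (a ω) (x ω))
    · have hi := PointMeasure.integrable ⟨_, h⟩ φ
      rw [if_pos h, PointMeasure.coe_ofMeasure h]
      exact integral_eq_lintegral_pos_part_sub_lintegral_neg_part hi
    · rw [if_neg h, PointMeasure.coe_ofMeasure_of_not h, integral_zero_measure]
  rw [this]
  refine Measurable.ite (measurableSet_isPointMeasure_atomSum ha hx) ?_ measurable_const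
  refine Measurable.sub ?_ ?_
  · exact ((Measure.measurable_lintegral
      (by fun_prop : Measurable fun y => ENNReal.ofReal (φ y))).comp hM).ennreal_toReal
  · exact ((Measure.measurable_lintegral
      (by fun_prop : Measurable fun y => ENNReal.ofReal (-φ y))).comp hM).ennreal_toReal

end atomSum

/-! ### Poisson processes -/

theorem integral_finset_prod_of_iIndepFun {Ω ι : Type*} [MeasurableSpace Ω] {P : Measure Ω}
    {E : ι → Type*} [∀ i, MeasurableSpace (E i)] {X : ∀ i, Ω → E i} {f : ∀ i, E i → ℂ}
    (hX : iIndepFun X P) (mX : ∀ i, Measurable (X i)) (hf : ∀ i, Measurable (f i))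
    (s : Finset ι) :
    ∫ ω, ∏ i ∈ s, f i (X i ω) ∂P = ∏ i ∈ s, ∫ ω, f i (X i ω) ∂P := by
  have h := (hX.precomp (g := fun i : s => (i : ι)) Subtype.val_injective).integral_fun_prod_comp
    (f := fun i : s => f i) (fun i => (mX i).aemeasurable)
    (fun i => (hf i).aestronglyMeasurable)
  simp only [Finset.prod_coe_sort s (fun i => ∫ ω, f i (X i ω) ∂P)] at h
  rw [← h]
  congr with ω
  exact (Finset.prod_coe_sort s (fun i => f i (X i ω))).symm

open Classical in
theorem integral_atomSum {ι : Type*} [Countable ι] (a : Set ι) (x : ι → ℝ) (f : ℝ → ℝ) :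
    ∫ y, f y ∂atomSum a x = ∑' i, if i ∈ a then f (x i) else 0 := by
  have : atomSum a x = Measure.sum fun i => (if i ∈ a then (1 : ℝ≥0∞) else 0) •
      Measure.dirac (x i) := by
    unfold atomSum
    congr with i
    by_cases hi : i ∈ a <;> simp [hi]
  rw [this, integral_sum_dirac fun i => by split_ifs <;> simp]
  refine tsum_congr fun i => ?_
  by_cases hi : i ∈ a <;> simp [hi]

theorem integral_pow_poissonMeasure (r : ℝ≥0) (z : ℂ) :
    ∫ n, z ^ n ∂poissonMeasure r = Complex.exp (r * (z - 1)) := by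
  rw [integral_poissonMeasure r]
  calc _ = ∑' a : ℕ, (Real.exp (-r) : ℂ) * ((r * z) ^ a / a.factorial) := by
        congr with a
        rw [Complex.real_smul]
        push_cast
        rw [mul_pow]
        ring
    _ = Real.exp (-r) * Complex.exp (r * z) := by
        rw [tsum_mul_left, (NormedSpace.expSeries_div_hasSum_exp (r * z)).tsum_eq,
          Complex.exp_eq_exp_ℂ]
    _ = _ := by
        rw [Complex.ofReal_exp, ← Complex.exp_add]
        push_cast
        ring_nf

/-- The restriction of a locally finite measure to a bounded set is a multiple of a probability
measure carried by this set. -/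
theorem exists_isProbabilityMeasure_restrict (μ : Measure ℝ) [IsFiniteMeasureOnCompacts μ]
    (j : ℤ) : ∃ ρ : Measure ℝ, IsProbabilityMeasure ρ ∧ (∀ᵐ x ∂ρ, x ∈ Set.Ico (j : ℝ) (j + 1)) ∧
      μ.restrict (Set.Ico (j : ℝ) (j + 1)) = (μ (Set.Ico (j : ℝ) (j + 1))).toNNReal • ρ := by
  set S := Set.Ico (j : ℝ) (j + 1)
  have hfin : μ S ≠ ∞ :=
    ((measure_mono Set.Ico_subset_Icc_self).trans_lt isCompact_Icc.measure_lt_top).ne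
  by_cases h0 : μ S = 0
  · refine ⟨Measure.dirac j, inferInstance, ?_, ?_⟩
    · refine (ae_dirac_iff (p := (· ∈ S)) measurableSet_Ico).mpr ?_
      simp [S]
    · rw [h0, Measure.restrict_eq_zero.mpr h0]
      simp
  · refine ⟨μ[|S], cond_isProbabilityMeasure_of_finite h0 hfin, ?_, ?_⟩
    · exact ae_cond_mem measurableSet_Ico
    · rw [ProbabilityTheory.cond, show ∀ c : ℝ≥0, ∀ m : Measure ℝ, c • m = (c : ℝ≥0∞) • m from
        fun _ _ => rfl, ENNReal.coe_toNNReal hfin, smul_smul,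
        ENNReal.mul_inv_cancel h0 hfin, one_smul]

/-- Configuration space of a Poisson process built cell by cell. -/
abbrev CellConfig : Type := ℤ → ℕ × (ℕ → ℝ)

namespace CellConfig

/-- The labels of the points: cell and rank in the cell. -/
def labels (w : CellConfig) : Set (ℤ × ℕ) := {p | p.2 < (w p.1).1}

/-- The position of the point with a given label. -/
def point (w : CellConfig) (p : ℤ × ℕ) : ℝ := (w p.1).2 p.2

theorem measurableSet_mem_labels (p : ℤ × ℕ) : MeasurableSet {w : CellConfig | p ∈ labels w} := by
  have : Measurable fun w : CellConfig => (w p.1).1 := by fun_prop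
  exact this (measurableSet_Ioi (a := p.2))

theorem measurable_point (p : ℤ × ℕ) : Measurable fun w : CellConfig => point w p := by
  unfold point
  fun_prop

theorem isPointMeasure_atomSum {w : CellConfig}
    (hw : ∀ p, point w p ∈ Set.Ico (p.1 : ℝ) (p.1 + 1)) :
    IsPointMeasure (atomSum (labels w) (point w)) := by
  refine isPointMeasure_atomSum_iff.mpr fun k => ?_
  rw [atomSum_apply_eq_encard measurableSet_Icc]
  have hfin : {p : ℤ × ℕ | p ∈ labels w ∧ point w p ∈ Set.Icc (-k : ℝ) k}.Finite := by
    refine ((Finset.Icc (-(k + 1) : ℤ) k).sigma fun j => Finset.range (w j).1).finite_toSet.image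
      (fun p => (p.1, p.2)) |>.subset ?_
    rintro ⟨j, i⟩ ⟨h1, h2⟩
    refine ⟨⟨j, i⟩, ?_, rfl⟩
    have := hw (j, i)
    simp only [Set.mem_Ico, Set.mem_Icc] at this h2
    have a1 : (-(k + 1) : ℤ) < j + 1 := by
      have : (-(k + 1) : ℝ) < j + 1 := by linarith
      exact_mod_cast this
    have a2 : j ≤ k := by
      have : (j : ℝ) ≤ k := by linarith
      exact_mod_cast this
    simp only [Finset.coe_sigma, Set.mem_sigma_iff, Finset.coe_Icc, Set.mem_Icc, Finset.coe_range,
      Set.mem_Iio]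
    exact ⟨⟨by omega, a2⟩, h1⟩
  rw [← Set.encard_lt_top_iff] at hfin
  exact_mod_cast hfin

theorem integral_atomSum_eq_sum {w : CellConfig}
    (hw : ∀ p, point w p ∈ Set.Ico (p.1 : ℝ) (p.1 + 1)) {ψ : ℝ → ℝ} {k : ℕ}
    (hψ : ∀ x, (k : ℝ) < |x| → ψ x = 0) :
    ∫ y, ψ y ∂atomSum (labels w) (point w) =
      ∑ j ∈ Finset.Icc (-(k + 1) : ℤ) k, ∑ i ∈ Finset.range (w j).1, ψ ((w j).2 i) := by
  classical
  rw [integral_atomSum, tsum_eq_sum (s := (Finset.Icc (-(k + 1) : ℤ) k).biUnion fun j =>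
    (Finset.range (w j).1).map ⟨fun i => (j, i), Prod.mk_right_injective j⟩)]
  · rw [Finset.sum_biUnion]
    · refine Finset.sum_congr rfl fun j _ => ?_
      rw [Finset.sum_map]
      refine Finset.sum_congr rfl fun i hi => ?_
      exact if_pos (Finset.mem_range.mp hi)
    · intro j _ j' _ hjj'
      simp only [Function.onFun, Finset.disjoint_left, Finset.mem_map, Finset.mem_range,
        Function.Embedding.coeFn_mk]
      rintro _ ⟨i, _, rfl⟩ ⟨i', _, h⟩
      exact hjj' (Prod.mk.inj h).1.symm
  · rintro ⟨j, i⟩ h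
    split_ifs with h1
    · refine hψ _ ?_
      by_contra! h2
      refine h (Finset.mem_biUnion.mpr ⟨j, ?_, Finset.mem_map.mpr ⟨i, Finset.mem_range.mpr h1,
        rfl⟩⟩)
      have := hw (j, i)
      rw [abs_le] at h2
      simp only [Set.mem_Ico] at this
      have a1 : (-(k + 1) : ℤ) < j + 1 := by
        have : (-(k + 1) : ℝ) < j + 1 := by linarith
        exact_mod_cast this
      have a2 : j ≤ k := by
        have : (j : ℝ) ≤ k := by linarith
        exact_mod_cast this
      exact Finset.mem_Icc.mpr ⟨by omega, a2⟩
    · rfl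

end CellConfig

theorem integral_exp_sum_cell (r : ℝ≥0) (ρ : Measure ℝ) [IsProbabilityMeasure ρ] {ψ : ℝ → ℝ}
    (hψ : Measurable ψ) :
    ∫ p, Complex.exp ((∑ i ∈ Finset.range p.1, ψ (p.2 i) : ℝ) * Complex.I)
      ∂(poissonMeasure r).prod (Measure.infinitePi fun _ : ℕ => ρ) =
      Complex.exp (r * ∫ x, (Complex.exp (ψ x * Complex.I) - 1) ∂ρ) := by
  have hm : Measurable fun p : ℕ × (ℕ → ℝ) =>
      Complex.exp ((∑ i ∈ Finset.range p.1, ψ (p.2 i) : ℝ) * Complex.I) := by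
    refine measurable_from_prod_countable_right fun n => ?_
    dsimp only
    fun_prop
  have hint : Integrable (fun x => Complex.exp (ψ x * Complex.I)) ρ :=
    Integrable.of_bound (by fun_prop) 1 (ae_of_all _ fun x => by simp)
  rw [integral_prod]
  · have (n : ℕ) : ∫ u : ℕ → ℝ, Complex.exp ((∑ i ∈ Finset.range n, ψ (u i) : ℝ) * Complex.I)
        ∂(Measure.infinitePi fun _ : ℕ => ρ) = (∫ x, Complex.exp (ψ x * Complex.I) ∂ρ) ^ n := by
      have hind := iIndepFun_infinitePi (P := fun _ : ℕ => ρ) (X := fun _ => id)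
        fun _ => measurable_id
      have := integral_finset_prod_of_iIndepFun hind (fun i => measurable_pi_apply i)
        (f := fun _ x => Complex.exp (ψ x * Complex.I)) (fun i => by fun_prop) (Finset.range n)
      simp only [Complex.ofReal_sum, Finset.sum_mul, Complex.exp_sum]
      refine this.trans ?_
      rw [← Finset.card_range n, ← Finset.prod_const, Finset.card_range]
      refine Finset.prod_congr rfl fun i _ => ?_
      conv_rhs => rw [← Measure.infinitePi_map_eval (fun _ : ℕ => ρ) i]
      rw [integral_map (measurable_pi_apply i).aemeasurable (by fun_prop)]
      rfl
    simp only [this]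
    rw [integral_pow_poissonMeasure, integral_sub hint (integrable_const _)]
    simp
  · refine Integrable.of_bound hm.aestronglyMeasurable 1 (ae_of_all _ fun p => ?_)
    rw [Complex.norm_exp_ofReal_mul_I]

/-- Existence of a Poisson process with a given locally finite intensity, as a sum of atoms with
the characteristic functional `exp (∫ (exp (i ψ) - 1) dμ)`. -/
theorem exists_poissonProcess (μ : Measure ℝ) [IsFiniteMeasureOnCompacts μ] :
    ∃ P : Measure CellConfig, IsProbabilityMeasure P ∧
      (∀ᵐ w ∂P, IsPointMeasure (atomSum w.labels w.point)) ∧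
      ∀ ψ : ℝ → ℝ, Measurable ψ → (∃ k : ℕ, ∀ x, (k : ℝ) < |x| → ψ x = 0) →
        ∫ w, Complex.exp ((∫ y, ψ y ∂atomSum w.labels w.point : ℝ) * Complex.I) ∂P =
          Complex.exp (∫ x, (Complex.exp (ψ x * Complex.I) - 1) ∂μ) := by
  choose ρ hρ hsupp hres using exists_isProbabilityMeasure_restrict μ
  let r (j : ℤ) : ℝ≥0 := (μ (Set.Ico (j : ℝ) (j + 1))).toNNReal
  let Q (j : ℤ) : Measure (ℕ × (ℕ → ℝ)) :=
    (poissonMeasure (r j)).prod (Measure.infinitePi fun _ : ℕ => ρ j)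
  have hcell : ∀ᵐ w ∂Measure.infinitePi Q, ∀ p, CellConfig.point w p ∈
      Set.Ico (p.1 : ℝ) (p.1 + 1) := by
    refine ae_all_iff.mpr fun p => ?_
    have h1 : (Measure.infinitePi Q).map (fun w => CellConfig.point w p) = ρ p.1 := by
      have e1 := Measure.infinitePi_map_eval Q p.1
      have e2 : (Q p.1).map Prod.snd = Measure.infinitePi fun _ : ℕ => ρ p.1 := by
        simp [Q, Measure.map_snd_prod]
      have e3 := Measure.infinitePi_map_eval (fun _ : ℕ => ρ p.1) p.2
      rw [← e3, ← e2, ← e1, Measure.map_map (by fun_prop) (by fun_prop),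
        Measure.map_map (by fun_prop) (by fun_prop)]
      rfl
    refine ae_of_ae_map (CellConfig.measurable_point p).aemeasurable ?_
    rw [h1]
    exact hsupp p.1
  refine ⟨Measure.infinitePi Q, inferInstance, ?_, fun ψ hψ ⟨k, hk⟩ => ?_⟩
  · filter_upwards [hcell] with w hw using CellConfig.isPointMeasure_atomSum hw
  · have hind := iIndepFun_infinitePi (P := Q) (X := fun _ => id) fun _ => measurable_id
    have hm : Measurable fun p : ℕ × (ℕ → ℝ) =>
        Complex.exp ((∑ i ∈ Finset.range p.1, ψ (p.2 i) : ℝ) * Complex.I) := by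
      refine measurable_from_prod_countable_right fun n => ?_
      dsimp only
      fun_prop
    have hprod := integral_finset_prod_of_iIndepFun hind (fun j => measurable_pi_apply j)
      (fun _ => hm) (Finset.Icc (-(k + 1) : ℤ) k)
    have hfun : ∀ᵐ w ∂Measure.infinitePi Q,
        Complex.exp ((∫ y, ψ y ∂atomSum (CellConfig.labels w) (CellConfig.point w) : ℝ) *
          Complex.I) = ∏ j ∈ Finset.Icc (-(k + 1) : ℤ) k,
          Complex.exp ((∑ i ∈ Finset.range (w j).1, ψ ((w j).2 i) : ℝ) * Complex.I) := by
      filter_upwards [hcell] with w hw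
      rw [CellConfig.integral_atomSum_eq_sum hw hk, Complex.ofReal_sum, Finset.sum_mul,
        Complex.exp_sum]
    rw [integral_congr_ae hfun]
    refine hprod.trans ?_
    have hone (j : ℤ) : ∫ w : CellConfig, Complex.exp ((∑ i ∈ Finset.range (w j).1,
        ψ ((w j).2 i) : ℝ) * Complex.I) ∂Measure.infinitePi Q =
        Complex.exp (∫ x in Set.Ico (j : ℝ) (j + 1), (Complex.exp (ψ x * Complex.I) - 1) ∂μ) := by
      rw [hres j, integral_smul_nnreal_measure, NNReal.smul_def, Complex.real_smul,
        ← integral_exp_sum_cell _ _ hψ]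
      change _ = ∫ p, _ ∂(Q j)
      conv_rhs => rw [← Measure.infinitePi_map_eval Q j]
      rw [integral_map (measurable_pi_apply j).aemeasurable hm.aestronglyMeasurable]
    refine (Finset.prod_congr rfl fun j _ => hone j).trans ?_
    rw [← Complex.exp_sum, ← integral_biUnion_finset _ (fun _ _ => measurableSet_Ico)]
    · congr 1
      refine setIntegral_eq_integral_of_forall_compl_eq_zero fun x hx => ?_
      rw [hk x, Complex.ofReal_zero, zero_mul, Complex.exp_zero, sub_self]
      by_contra! h
      rw [abs_le] at h
      refine hx (Set.mem_biUnion (x := ⌊x⌋) ?_ ⟨Int.floor_le x, Int.lt_floor_add_one x⟩)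
      simp only [Finset.coe_Icc, Set.mem_Icc]
      have h1 : (-(k + 1) : ℤ) ≤ ⌊x⌋ := Int.le_floor.mpr (by push_cast; linarith)
      have h2 : ⌊x⌋ ≤ k := by
        have : (⌊x⌋ : ℝ) ≤ k := (Int.floor_le x).trans h.2
        exact_mod_cast this
      exact ⟨h1, h2⟩
    · intro i _ j _ hij
      exact by
        simpa using Set.pairwise_disjoint_Ico_intCast ℝ hij
    · intro j _
      refine Measure.integrableOn_of_bounded (M := 2) ?_ (by fun_prop) (ae_of_all _ fun x => ?_)
      · exact ((measure_mono Set.Ico_subset_Icc_self).trans_lt isCompact_Icc.measure_lt_top).ne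
      · refine (norm_sub_le _ _).trans ?_
        rw [Complex.norm_exp_ofReal_mul_I, norm_one]
        norm_num

/-- The counting variables of a point process with the characteristic functional of a Poisson
process are independent Poisson variables. -/
theorem measure_counts_eq_prod_poissonMeasure {Ω : Type*} [MeasurableSpace Ω] {P : Measure Ω}
    [IsProbabilityMeasure P] {Z : Ω → Measure ℝ} (hZ : Measurable Z) {μ : Measure ℝ}
    [IsFiniteMeasureOnCompacts μ] (hpt : ∀ᵐ ω ∂P, IsPointMeasure (Z ω))
    (hchar : ∀ ψ : ℝ → ℝ, Measurable ψ → (∃ k : ℕ, ∀ x, (k : ℝ) < |x| → ψ x = 0) →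
        ∫ ω, Complex.exp ((∫ y, ψ y ∂Z ω : ℝ) * Complex.I) ∂P =
          Complex.exp (∫ x, (Complex.exp (ψ x * Complex.I) - 1) ∂μ))
    {k : ℕ} {B : Fin k → Set ℝ} (hB : ∀ i, MeasurableSet (B i))
    (hbdd : ∀ i, Bornology.IsBounded (B i)) (hdisj : Pairwise fun i j => Disjoint (B i) (B j))
    (n : Fin k → ℕ) :
    P {ω | ∀ i, Z ω (B i) = (n i : ℝ≥0∞)} =
      ∏ i, poissonMeasure (μ (B i)).toNNReal {n i} := by
  have hbig : ∃ K : ℕ, ∀ i, B i ⊆ Set.Icc (-K : ℝ) K := by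
    have : Bornology.IsBounded (⋃ i, B i) := Bornology.isBounded_iUnion.mpr hbdd
    obtain ⟨r, hr⟩ := this.subset_closedBall 0
    obtain ⟨K, hK⟩ := exists_nat_ge r
    refine ⟨K, fun i x hx => ?_⟩
    have := hr (Set.mem_iUnion_of_mem i hx)
    rw [mem_closedBall_zero_iff, Real.norm_eq_abs] at this
    exact abs_le.mp (this.trans hK)
  obtain ⟨K, hK⟩ := hbig
  have hfinite {m : Measure ℝ} [IsFiniteMeasureOnCompacts m] (i) : m (B i) < ∞ :=
    (measure_mono (hK i)).trans_lt isCompact_Icc.measure_lt_top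
  let V (ω : Ω) : EuclideanSpace ℝ (Fin k) := WithLp.toLp 2 fun i => (Z ω).real (B i)
  have hV0 : Measurable fun ω i => (Z ω).real (B i) := measurable_pi_lambda _ fun i =>
    ((Measure.measurable_coe (hB i)).comp hZ).ennreal_toReal
  have hV : Measurable V := (WithLp.measurable_toLp 2 _).comp hV0
  let ν : Measure (EuclideanSpace ℝ (Fin k)) := (Measure.pi fun i =>
    (poissonMeasure (μ (B i)).toNNReal).map (fun n : ℕ => (n : ℝ))).map (WithLp.toLp 2)
  have hprobν (i : Fin k) : IsProbabilityMeasure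
      ((poissonMeasure (μ (B i)).toNNReal).map (fun n : ℕ => (n : ℝ))) :=
    Measure.isProbabilityMeasure_map (by fun_prop)
  have hlaw : P.map V = ν := by
    have : IsProbabilityMeasure (P.map V) := Measure.isProbabilityMeasure_map hV.aemeasurable
    have : IsProbabilityMeasure ν := Measure.isProbabilityMeasure_map (by fun_prop)
    refine Measure.ext_of_charFun ?_
    ext t
    rw [charFun_pi]
    simp_rw [charFun_map_cast_poissonMeasure]
    rw [charFun_apply, integral_map hV.aemeasurable (by fun_prop), ← Complex.exp_sum]
    let ψ (x : ℝ) : ℝ := ∑ i, (B i).indicator (fun _ => t i) x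
    have hψm : Measurable ψ :=
      Finset.measurable_sum _ fun i _ => measurable_const.indicator (hB i)
    have hψ := hchar ψ hψm ⟨K, fun x hx => Finset.sum_eq_zero fun i _ =>
      Set.indicator_of_notMem (fun h => hx.not_ge (abs_le.mpr (hK i h))) _⟩
    have hinner : ∀ᵐ ω ∂P, Complex.exp ((inner ℝ (V ω) t : ℝ) * Complex.I) =
        Complex.exp ((∫ y, ψ y ∂Z ω : ℝ) * Complex.I) := by
      filter_upwards [hpt] with ω hω
      have : IsFiniteMeasureOnCompacts (Z ω) := ⟨fun _ hK => hω.1 _ hK⟩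
      congr 3
      simp only [ψ]
      rw [integral_finsetSum _ fun i _ => (integrable_indicator_iff (hB i)).mpr
        (integrableOn_const (hfinite _).ne)]
      simp only [integral_indicator_const _ (hB _), PiLp.inner_apply, V]
      refine Finset.sum_congr rfl fun i _ => ?_
      simp [mul_comm]
    rw [integral_congr_ae hinner, hψ]
    congr 1
    have hexp (x : ℝ) : Complex.exp (ψ x * Complex.I) - 1 =
        ∑ i, (B i).indicator (fun _ => Complex.exp (t i * Complex.I) - 1) x := by
      by_cases hx : ∃ i, x ∈ B i
      · obtain ⟨i, hi⟩ := hx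
        have hne (j : Fin k) (hj : j ≠ i) : x ∉ B j := fun h =>
          Set.disjoint_left.mp (hdisj hj) h hi
        have h1 : ψ x = t i := by
          simp only [ψ]
          rw [Finset.sum_eq_single i (fun j _ hj => Set.indicator_of_notMem (hne j hj) _) (by simp),
            Set.indicator_of_mem hi]
        rw [h1, Finset.sum_eq_single i (fun j _ hj => Set.indicator_of_notMem (hne j hj) _)
          (by simp), Set.indicator_of_mem hi]
      · push Not at hx
        simp [ψ, hx]
    simp only [hexp]
    rw [integral_finsetSum _ fun i _ => (integrable_indicator_iff (hB i)).mpr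
      (integrableOn_const (hfinite _).ne)]
    refine Finset.sum_congr rfl fun i _ => ?_
    rw [integral_indicator_const _ (hB i), Complex.real_smul]
    rfl
  have hmeas : MeasurableSet {x : EuclideanSpace ℝ (Fin k) | ∀ i, x i = n i} := by
    simp only [Set.ofPred_forall]
    exact MeasurableSet.iInter fun i => measurableSet_eq_fun (by fun_prop) measurable_const
  have hset : {ω | ∀ i, Z ω (B i) = (n i : ℝ≥0∞)} =ᵐ[P] V ⁻¹' {x | ∀ i, x i = n i} := by
    filter_upwards [hpt] with ω hω
    have : IsFiniteMeasureOnCompacts (Z ω) := ⟨fun _ hK => hω.1 _ hK⟩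
    refine propext (forall_congr' fun i => ?_)
    have hne : Z ω (B i) ≠ ∞ := (hfinite _).ne
    change _ ↔ (Z ω (B i)).toReal = n i
    rw [← ENNReal.toReal_natCast, ENNReal.toReal_eq_toReal_iff' hne (by simp)]
  rw [measure_congr hset, ← Measure.map_apply hV hmeas, hlaw,
    Measure.map_apply (WithLp.measurable_toLp 2 _) hmeas]
  have hpre : WithLp.toLp 2 ⁻¹' {x : EuclideanSpace ℝ (Fin k) | ∀ i, x i = n i} =
      Set.univ.pi fun i => {(n i : ℝ)} := by
    ext x
    simp
  rw [hpre, Measure.pi_pi]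
  refine Finset.prod_congr rfl fun i _ => ?_
  rw [Measure.map_apply (by fun_prop) (measurableSet_singleton _)]
  congr 1
  ext m
  simp

/-! ### Cox processes with exponential intensity -/

theorem exponentialIntensity_apply (c θ : ℝ) {B : Set ℝ} (hB : MeasurableSet B) :
    exponentialIntensity c θ B = ∫⁻ x in B, ENNReal.ofReal (c * θ * Real.exp (-θ * x)) :=
  withDensity_apply _ hB

instance (c θ : ℝ) : IsFiniteMeasureOnCompacts (exponentialIntensity c θ) := by
  have : IsLocallyFiniteMeasure (exponentialIntensity c θ) :=
    IsLocallyFiniteMeasure.withDensity_ofReal (by fun_prop)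
  infer_instance

/-- Translating the exponential intensity multiplies it by a constant. -/
theorem map_add_exponentialIntensity {c θ : ℝ} (hθ : θ ≠ 0) {q : ℝ} (hq : 0 < q) :
    (exponentialIntensity c θ).map (fun x => x + Real.log q / θ) =
      ENNReal.ofReal q • exponentialIntensity c θ := by
  ext B hB
  have hm : Measurable fun x : ℝ => x + Real.log q / θ := by fun_prop
  rw [Measure.map_apply hm hB, exponentialIntensity_apply _ _ (hm hB), Measure.smul_apply,
    exponentialIntensity_apply _ _ hB, smul_eq_mul, ← lintegral_const_mul _ (by fun_prop),
    ← (measurePreserving_add_right volume (Real.log q / θ)).setLIntegral_comp_preimage hB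
      (by fun_prop)]
  refine lintegral_congr fun x => ?_
  rw [← ENNReal.ofReal_mul hq.le]
  congr 1
  have : Real.exp (-θ * (x + Real.log q / θ)) = Real.exp (-θ * x) / q := by
    rw [mul_add, Real.exp_add, show -θ * (Real.log q / θ) = -Real.log q by field_simp,
      Real.exp_neg, Real.exp_log hq, div_eq_mul_inv]
  rw [this]
  field_simp

/-- Existence of the Cox process `PPP(Q c θ e^{-θ x} dx)`, together with its characteristic
functional. -/
theorem exists_coxProcess (ρ : Measure ℝ≥0) [IsProbabilityMeasure ρ] (c : ℝ) {θ : ℝ} (hθ : θ ≠ 0) :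
    ∃ (P : Measure (ℝ≥0 × CellConfig)) (_ : IsProbabilityMeasure P)
      (Z : ℝ≥0 × CellConfig → PointMeasure), P.map Prod.fst = ρ ∧
      IsCoxProcess P Prod.fst (exponentialIntensity c θ) Z ∧
      ∀ φ : C_c(ℝ, ℝ), ∫ ω, Complex.exp ((∫ x, φ x ∂(Z ω).1 : ℝ) * Complex.I) ∂P =
        ∫ q, Complex.exp (q * ∫ x, (Complex.exp (φ x * Complex.I) - 1)
          ∂exponentialIntensity c θ) ∂ρ := by
  classical
  set μ := exponentialIntensity c θ with hμ
  obtain ⟨P₀, hP₀, hpt, hchar⟩ := exists_poissonProcess μ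
  let a (ω : ℝ≥0 × CellConfig) : Set (ℤ × ℕ) := {p | ω.1 ≠ 0 ∧ p ∈ ω.2.labels}
  let x (ω : ℝ≥0 × CellConfig) (p : ℤ × ℕ) : ℝ := ω.2.point p + Real.log ω.1 / θ
  have ha (p) : MeasurableSet {ω | p ∈ a ω} := by
    refine MeasurableSet.inter ?_ ?_
    · exact measurable_fst (measurableSet_singleton (0 : ℝ≥0)).compl
    · exact measurable_snd (CellConfig.measurableSet_mem_labels p)
  have hx (p) : Measurable fun ω => x ω p :=
    ((CellConfig.measurable_point p).comp measurable_snd).add (by fun_prop)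
  have hadd (q : ℝ≥0) : Measurable fun y : ℝ => y + Real.log q / θ := by fun_prop
  have hzero (w : CellConfig) : atomSum (a (0, w)) (x (0, w)) = 0 := by
    ext B hB
    simp [atomSum_apply hB, a]
  have hshift {q : ℝ≥0} (hq : q ≠ 0) (w : CellConfig) : atomSum (a (q, w)) (x (q, w)) =
      (atomSum w.labels w.point).map fun y => y + Real.log q / θ := by
    rw [map_atomSum (hadd q)]
    simp [a, x, hq]
  have hpm (q : ℝ≥0) : ∀ᵐ w ∂P₀, IsPointMeasure (atomSum (a (q, w)) (x (q, w))) := by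
    filter_upwards [hpt] with w hw
    by_cases hq : q = 0
    · rw [hq, hzero]
      exact isPointMeasure_zero
    · rw [hshift hq]
      refine ⟨fun K hK => ?_, fun B hB => ?_⟩
      · rw [Measure.map_apply (hadd q) hK.measurableSet]
        exact hw.1 _ ((Homeomorph.addRight _).isCompact_preimage.mpr hK)
      · rw [Measure.map_apply (hadd q) hB]
        exact hw.2 _ (hadd q hB)
  have hchar' (q : ℝ≥0) (ψ : ℝ → ℝ) (hψ : Measurable ψ)
      (hk : ∃ k : ℕ, ∀ x, (k : ℝ) < |x| → ψ x = 0) :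
      ∫ w, Complex.exp ((∫ y, ψ y ∂atomSum (a (q, w)) (x (q, w)) : ℝ) * Complex.I) ∂P₀ =
        Complex.exp (∫ x, (Complex.exp (ψ x * Complex.I) - 1) ∂(q • μ)) := by
    by_cases hq : q = 0
    · subst hq
      simp [hzero]
    · have h1 (w) : ∫ y, ψ y ∂atomSum (a (q, w)) (x (q, w)) =
          ∫ y, ψ (y + Real.log q / θ) ∂atomSum w.labels w.point := by
        rw [hshift hq, integral_map (hadd q).aemeasurable hψ.aestronglyMeasurable]
      simp only [h1]
      rw [hchar (fun y => ψ (y + Real.log q / θ)) (hψ.comp (hadd q))]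
      · congr 1
        have hq' : (0 : ℝ) < q := by positivity
        have := map_add_exponentialIntensity (c := c) hθ hq'
        rw [ENNReal.ofReal_coe_nnreal] at this
        change _ = ∫ x, _ ∂((q : ℝ≥0∞) • μ)
        rw [← this, integral_map (hadd q).aemeasurable (by fun_prop)]
      · obtain ⟨k, hk⟩ := hk
        obtain ⟨l, hl⟩ := exists_nat_ge (|Real.log q / θ|)
        refine ⟨k + l, fun y hy => hk _ ?_⟩
        have := abs_sub_abs_le_abs_sub y (-(Real.log q / θ))
        rw [abs_neg, sub_neg_eq_add] at this
        push_cast at hy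
        linarith
  let Z (ω : ℝ≥0 × CellConfig) : PointMeasure := PointMeasure.ofMeasure (atomSum (a ω) (x ω))
  have hZ : Measurable Z := PointMeasure.measurable_ofMeasure_atomSum ha hx
  have hM := measurable_atomSum ha hx
  have hae : ∀ᵐ ω ∂ρ.prod P₀, (Z ω).1 = atomSum (a ω) (x ω) := by
    have : ∀ᵐ ω ∂ρ.prod P₀, IsPointMeasure (atomSum (a ω) (x ω)) :=
      (Measure.ae_prod_iff_ae_ae (measurableSet_isPointMeasure_atomSum ha hx)).mpr
        (ae_of_all _ hpm)
    filter_upwards [this] with ω hω using PointMeasure.coe_ofMeasure hω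
  refine ⟨ρ.prod P₀, inferInstance, Z, by simp [Measure.map_fst_prod],
    ⟨measurable_fst, hZ, fun k B hB hbdd hdisj n A hA => ?_⟩, fun φ => ?_⟩
  · have hBm : MeasurableSet {ω : ℝ≥0 × CellConfig |
        ω.1 ∈ A ∧ ∀ i, atomSum (a ω) (x ω) (B i) = (n i : ℝ≥0∞)} := by
      have : MeasurableSet (⋂ i, {ω | atomSum (a ω) (x ω) (B i) = (n i : ℝ≥0∞)}) :=
        MeasurableSet.iInter fun i =>
          ((Measure.measurable_coe (hB i)).comp hM) (measurableSet_singleton _)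
      convert! (measurable_fst hA).inter this using 1
      ext ω
      simp
    have heq : {ω | ω.1 ∈ A ∧ ∀ i, (Z ω).1 (B i) = (n i : ℝ≥0∞)} =ᵐ[ρ.prod P₀]
        {ω | ω.1 ∈ A ∧ ∀ i, atomSum (a ω) (x ω) (B i) = (n i : ℝ≥0∞)} := by
      filter_upwards [hae] with ω hω
      refine propext ?_
      change (_ ∧ _) ↔ (_ ∧ _)
      rw [hω]
    rw [measure_congr heq, Measure.prod_apply hBm]
    have hslice (q : ℝ≥0) : P₀ (Prod.mk q ⁻¹' {ω | ω.1 ∈ A ∧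
        ∀ i, atomSum (a ω) (x ω) (B i) = (n i : ℝ≥0∞)}) =
        A.indicator (fun q => ∏ i, poissonMeasure (q * (μ (B i)).toNNReal) {n i}) q := by
      by_cases hq : q ∈ A
      · rw [Set.indicator_of_mem hq]
        have := measure_counts_eq_prod_poissonMeasure (hM.comp measurable_prodMk_left) (hpm q)
          (hchar' q) hB hbdd hdisj n
        have e (i : Fin k) : ((q • μ) (B i)).toNNReal = q * (μ (B i)).toNNReal := by
          rw [Measure.smul_apply, ENNReal.smul_def, smul_eq_mul, ENNReal.toNNReal_mul,
            ENNReal.toNNReal_coe]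
        simp only [e] at this
        rw [← this]
        congr 1
        ext w
        simp [hq]
      · rw [Set.indicator_of_notMem hq]
        simp [hq]
    simp only [hslice]
    rw [lintegral_indicator hA]
    have hpre : Prod.fst ⁻¹' A = A ×ˢ (Set.univ : Set CellConfig) := by
      ext; simp
    rw [hpre, ← Measure.prod_restrict, Measure.restrict_univ,
      lintegral_prod _ (by
        refine Measurable.aemeasurable ?_
        simp only [poissonMeasure_singleton]
        fun_prop)]
    simp
  · have h1 : ∀ᵐ ω ∂ρ.prod P₀, Complex.exp ((∫ x, φ x ∂(Z ω).1 : ℝ) * Complex.I) =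
        Complex.exp ((∫ y, φ y ∂atomSum (a ω) (x ω) : ℝ) * Complex.I) := by
      filter_upwards [hae] with ω hω
      rw [hω]
    have hmeas : AEStronglyMeasurable (fun ω => Complex.exp
        ((∫ y, φ y ∂atomSum (a ω) (x ω) : ℝ) * Complex.I)) (ρ.prod P₀) := by
      refine AEStronglyMeasurable.congr ?_ h1
      have : Measurable fun ω => ∫ x, φ x ∂(Z ω).1 :=
        (PointMeasure.continuous_integral φ).measurable.comp hZ
      exact Measurable.aestronglyMeasurable (by fun_prop)
    rw [integral_congr_ae h1, integral_prod _ (Integrable.of_bound hmeas 1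
      (ae_of_all _ fun ω => by rw [Complex.norm_exp_ofReal_mul_I]))]
    congr with q
    rw [hchar' q φ φ.continuous.measurable, integral_smul_nnreal_measure, NNReal.smul_def,
      Complex.real_smul]
    obtain ⟨r, hr⟩ := φ.hasCompactSupport.isCompact.isBounded.subset_closedBall 0
    obtain ⟨k, hk⟩ := exists_nat_ge r
    refine ⟨k, fun y hy => ?_⟩
    by_contra h
    have := hr (subset_tsupport _ h)
    rw [mem_closedBall_zero_iff, Real.norm_eq_abs] at this
    linarith

/-! ### Regular variation: uniform convergence and growth -/

/-- The uniform convergence theorem for slowly varying functions, in additive form. -/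
theorem exists_forall_abs_sub_le_of_slowly_varying {h : ℝ → ℝ} (hm : Measurable h)
    (h0 : ∀ t, Tendsto (fun x => h (x + t) - h x) atTop (𝓝 0)) {ε : ℝ} (hε : 0 < ε) :
    ∃ X, ∀ x ≥ X, ∀ t ∈ Set.Icc (0 : ℝ) 1, |h (x + t) - h x| ≤ ε := by
  by_contra! hcon
  choose x hx t ht hbig using fun n : ℕ => hcon n
  have hxt : Tendsto x atTop atTop := tendsto_atTop_mono hx tendsto_natCast_atTop_atTop
  have hyt : Tendsto (fun n => x n + t n) atTop atTop :=
    tendsto_atTop_mono (fun n => by linarith [(ht n).1]) hxt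
  set μ : Measure ℝ := volume.restrict (Set.Icc 0 2)
  have meas (y : ℕ → ℝ) (hy : Tendsto y atTop atTop) :
      Tendsto (fun n => μ {s | ENNReal.ofReal (ε / 2) ≤ edist (h (y n + s) - h (y n)) 0})
        atTop (𝓝 0) := by
    have := tendstoInMeasure_of_tendsto_ae (μ := μ) (f := fun n s => h (y n + s) - h (y n))
      (g := fun _ => 0) (fun n => Measurable.aestronglyMeasurable (by fun_prop))
      (ae_of_all _ fun s => (h0 s).comp hy)
    exact this _ (by simpa using hε)
  have e1 := (meas x hxt).eventually (gt_mem_nhds (show (0 : ℝ≥0∞) < 1 / 4 by simp))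
  have e2 := (meas _ hyt).eventually (gt_mem_nhds (show (0 : ℝ≥0∞) < 1 / 4 by simp))
  obtain ⟨n, hn1, hn2⟩ := (e1.and e2).exists
  set V := {s | ENNReal.ofReal (ε / 2) ≤ edist (h (x n + s) - h (x n)) 0}
  set W := {s | ENNReal.ofReal (ε / 2) ≤ edist (h (x n + t n + s) - h (x n + t n)) 0}
  have hVm : MeasurableSet V := measurableSet_le measurable_const (by fun_prop)
  have hWm : MeasurableSet W := measurableSet_le measurable_const (by fun_prop)
  have hcover : Set.Icc (t n) 2 ⊆ (V ∩ Set.Icc 0 2) ∪ (fun s => s - t n) ⁻¹' (W ∩ Set.Icc 0 2) := by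
    intro s hs
    have hs0 : s ∈ Set.Icc (0 : ℝ) 2 := ⟨(ht n).1.trans hs.1, hs.2⟩
    have hs1 : s - t n ∈ Set.Icc (0 : ℝ) 2 := ⟨by linarith [hs.1], by linarith [hs.2, (ht n).1]⟩
    by_contra hnot
    simp only [Set.mem_union, Set.mem_inter_iff, hs0, and_true, Set.mem_preimage, hs1, not_or]
      at hnot
    obtain ⟨a1, a2⟩ := hnot
    simp only [V, W, Set.mem_ofPred_eq, not_le, edist_dist, Real.dist_eq, sub_zero,
      ENNReal.ofReal_lt_ofReal_iff (half_pos hε)] at a1 a2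
    rw [show x n + t n + (s - t n) = x n + s by ring] at a2
    rw [abs_lt] at a1 a2
    have := hbig n
    rw [lt_abs] at this
    rcases this with h | h <;> linarith [a1.1, a1.2, a2.1, a2.2]
  have hle : (1 : ℝ≥0∞) ≤ 1 / 4 + 1 / 4 := by
    calc (1 : ℝ≥0∞) ≤ volume (Set.Icc (t n) 2) := by
          rw [Real.volume_Icc, ENNReal.one_le_ofReal]
          linarith [(ht n).2]
      _ ≤ volume (V ∩ Set.Icc 0 2) + volume ((fun s => s - t n) ⁻¹' (W ∩ Set.Icc 0 2)) :=
          (measure_mono hcover).trans (measure_union_le _ _)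
      _ ≤ 1 / 4 + 1 / 4 := by
          rw [(measurePreserving_sub_right volume (t n)).measure_preimage
            (hWm.inter measurableSet_Icc).nullMeasurableSet, ← Measure.restrict_apply hVm,
            ← Measure.restrict_apply hWm]
          exact add_le_add hn1.le hn2.le
  have : (1 / 4 + 1 / 4 : ℝ≥0∞) < 1 := by
    rw [← ENNReal.toReal_lt_toReal (by simp) (by simp), ENNReal.toReal_add (by simp) (by simp)]
    norm_num
  exact absurd hle (not_le.mpr this)

theorem tendsto_sub_of_slowly_varying {h : ℝ → ℝ} (hm : Measurable h)
    (h0 : ∀ t, Tendsto (fun x => h (x + t) - h x) atTop (𝓝 0)) (t₀ : ℝ) :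
    Tendsto (fun p : ℝ × ℝ => h (p.1 + p.2) - h p.1) (atTop ×ˢ 𝓝 t₀) (𝓝 0) := by
  have h1 : Tendsto (fun p : ℝ × ℝ => h (p.1 + (t₀ - 1 / 2)) - h p.1) (atTop ×ˢ 𝓝 t₀) (𝓝 0) :=
    (h0 (t₀ - 1 / 2)).comp tendsto_fst
  have h2 : Tendsto (fun p : ℝ × ℝ => h (p.1 + p.2) - h (p.1 + (t₀ - 1 / 2)))
      (atTop ×ˢ 𝓝 t₀) (𝓝 0) := by
    refine Metric.tendsto_nhds.mpr fun ε hε => ?_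
    obtain ⟨X, hX⟩ := exists_forall_abs_sub_le_of_slowly_varying hm h0 (half_pos hε)
    filter_upwards [(eventually_ge_atTop (X - (t₀ - 1 / 2))).prod_mk
      (Icc_mem_nhds (show t₀ - 1 / 2 < t₀ by linarith) (show t₀ < t₀ + 1 / 2 by linarith))]
      with p hp
    have := hX (p.1 + (t₀ - 1 / 2)) (by linarith [hp.1]) (p.2 - (t₀ - 1 / 2))
      ⟨by linarith [hp.2.1], by linarith [hp.2.2]⟩
    rw [show p.1 + (t₀ - 1 / 2) + (p.2 - (t₀ - 1 / 2)) = p.1 + p.2 by ring] at this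
    rw [Real.dist_eq, sub_zero]
    linarith
  simpa using h2.add h1

theorem exists_abs_le_of_slowly_varying {h : ℝ → ℝ} (hm : Measurable h)
    (h0 : ∀ t, Tendsto (fun x => h (x + t) - h x) atTop (𝓝 0)) :
    ∃ X C, ∀ x ≥ X, |h x| ≤ C + x := by
  obtain ⟨X, hX⟩ := exists_forall_abs_sub_le_of_slowly_varying hm h0 one_pos
  have key (n : ℕ) : ∀ t ∈ Set.Icc (0 : ℝ) 1, |h (X + n + t)| ≤ |h X| + n + 1 := by
    induction n with
    | zero =>
      intro t ht
      have := hX X le_rfl t ht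
      have h2 := abs_sub_abs_le_abs_sub (h (X + t)) (h X)
      simp only [Nat.cast_zero, add_zero]
      linarith
    | succ n ih =>
      intro t ht
      have := hX (X + (n + 1 : ℕ)) (by linarith [Nat.cast_nonneg (α := ℝ) (n + 1)]) t ht
      have h2 := abs_sub_abs_le_abs_sub (h (X + (n + 1 : ℕ) + t)) (h (X + (n + 1 : ℕ)))
      have h3 := ih 1 (by simp)
      push_cast at *
      rw [show X + n + 1 = X + (n + 1) by ring] at h3
      linarith
  refine ⟨X, |h X| + 1 - X, fun x hx => ?_⟩
  have hx' : 0 ≤ x - X := by linarith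
  have := key ⌊x - X⌋₊ (x - X - ⌊x - X⌋₊) ⟨by linarith [Nat.floor_le hx'],
    by linarith [Nat.lt_floor_add_one (x - X)]⟩
  rw [show X + (⌊x - X⌋₊ : ℝ) + (x - X - ⌊x - X⌋₊) = x by ring] at this
  linarith [Nat.floor_le hx']

namespace IsRegularlyVarying

variable {l : ℝ → ℝ} {α : ℝ}

theorem eventually_ne_zero (hl : IsRegularlyVarying l α) : ∀ᶠ x in atTop, l x ≠ 0 := by
  have := (hl 2 two_pos).eventually (lt_mem_nhds (Real.rpow_pos_of_pos two_pos α))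
  filter_upwards [this] with x hx h
  simp [h] at hx

theorem congr_isEquivalent {l' : ℝ → ℝ} (hl : IsRegularlyVarying l α) (h : l' ~[atTop] l) :
    IsRegularlyVarying l' α := by
  intro c hc
  have h1 : Tendsto (l' / l) atTop (𝓝 1) :=
    (isEquivalent_iff_tendsto_one hl.eventually_ne_zero).mp h
  have hct : Tendsto (fun x => c * x) atTop atTop := tendsto_id.const_mul_atTop hc
  have h2 : Tendsto (fun x => l' (c * x) / l (c * x)) atTop (𝓝 1) := h1.comp hct
  have h3 : Tendsto (fun x => (l' x / l x)⁻¹) atTop (𝓝 1) := by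
    simpa using h1.inv₀ one_ne_zero
  have := (h2.mul (hl c hc)).mul h3
  rw [one_mul, mul_one] at this
  refine this.congr' ?_
  filter_upwards [hl.eventually_ne_zero, hct.eventually hl.eventually_ne_zero] with x hx hcx
  by_cases h0 : l' x = 0
  · simp [h0]
  · field_simp

theorem tendsto_log_sub (hl : IsRegularlyVarying l α) (hpos : ∀ x, 0 < l x) (t : ℝ) :
    Tendsto (fun x => (Real.log (l (Real.exp (x + t))) - α * (x + t)) -
      (Real.log (l (Real.exp x)) - α * x)) atTop (𝓝 0) := by
  have h1 := (hl (Real.exp t) (Real.exp_pos t)).comp Real.tendsto_exp_atTop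
  have h2 := (Real.continuousAt_log (Real.rpow_pos_of_pos (Real.exp_pos t) α).ne').tendsto.comp h1
  rw [Real.log_rpow (Real.exp_pos t), Real.log_exp] at h2
  have h3 := h2.sub_const (α * t)
  rw [sub_self] at h3
  refine h3.congr fun x => ?_
  simp only [Function.comp_apply]
  rw [Real.log_div (hpos _).ne' (hpos _).ne', ← Real.exp_add, add_comm t x]
  ring

/-- The uniform convergence theorem for regularly varying functions. -/
theorem tendsto_div_prod (hl : IsRegularlyVarying l α) (hm : Measurable l)
    (hpos : ∀ x, 0 < l x) {b : ℝ} (hb : 0 < b) :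
    Tendsto (fun p : ℝ × ℝ => l (p.2 * p.1) / l p.1) (atTop ×ˢ 𝓝 b) (𝓝 (b ^ α)) := by
  have h1 := tendsto_sub_of_slowly_varying (h := fun x => Real.log (l (Real.exp x)) - α * x)
    (by fun_prop) (hl.tendsto_log_sub hpos) (Real.log b)
  have hlog : Tendsto (fun p : ℝ × ℝ => (Real.log p.1, Real.log p.2)) (atTop ×ˢ 𝓝 b)
      (atTop ×ˢ 𝓝 (Real.log b)) :=
    Real.tendsto_log_atTop.prodMap (Real.continuousAt_log hb.ne').tendsto
  have h2 := (h1.comp hlog).add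
    (((Real.continuousAt_log hb.ne').tendsto.comp tendsto_snd).const_mul α :
      Tendsto (fun p : ℝ × ℝ => α * Real.log p.2) (atTop ×ˢ 𝓝 b) _)
  have h3 := (Real.continuous_exp.tendsto _).comp h2
  rw [zero_add, mul_comm α, ← Real.rpow_def_of_pos hb] at h3
  refine h3.congr' ?_
  filter_upwards [(eventually_gt_atTop 0).prod_mk (lt_mem_nhds hb)] with p hp
  simp only [Function.comp_apply]
  rw [show Real.log (l (Real.exp (Real.log p.1 + Real.log p.2))) -
      α * (Real.log p.1 + Real.log p.2) - (Real.log (l (Real.exp (Real.log p.1))) -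
      α * Real.log p.1) + α * Real.log p.2 =
      Real.log (l (Real.exp (Real.log p.1 + Real.log p.2))) -
      Real.log (l (Real.exp (Real.log p.1))) by ring, Real.exp_sub, Real.exp_log (hpos _),
    Real.exp_log (hpos _), Real.exp_add, Real.exp_log hp.1, Real.exp_log hp.2, mul_comm]

/-- Regularly varying functions grow and decay slower than any exponential. -/
theorem tendsto_log_div (hl : IsRegularlyVarying l α) (hm : Measurable l)
    (hpos : ∀ x, 0 < l x) : Tendsto (fun x => Real.log (l x) / x) atTop (𝓝 0) := by
  obtain ⟨X, C, hC⟩ := exists_abs_le_of_slowly_varying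
    (h := fun x => Real.log (l (Real.exp x)) - α * x)
    (by fun_prop) (hl.tendsto_log_sub hpos)
  have hlogx : Tendsto (fun x : ℝ => Real.log x / x) atTop (𝓝 0) :=
    Real.isLittleO_log_id_atTop.tendsto_div_nhds_zero
  have hbound : Tendsto (fun x : ℝ => C / x + (1 + |α|) * (Real.log x / x)) atTop (𝓝 0) := by
    simpa using (tendsto_id.const_div_atTop C).add (hlogx.const_mul (1 + |α|))
  refine squeeze_zero_norm' ?_ hbound
  filter_upwards [eventually_gt_atTop 1, Real.tendsto_log_atTop.eventually_ge_atTop X] with x hx hX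
  have h1 := hC _ hX
  simp only [Real.exp_log (show 0 < x by linarith)] at h1
  have h2 := abs_sub_abs_le_abs_sub (Real.log (l x)) (α * Real.log x)
  have h3 : 0 < Real.log x := Real.log_pos hx
  rw [abs_mul, abs_of_pos h3] at h2
  rw [norm_div, Real.norm_eq_abs, Real.norm_eq_abs, abs_of_pos (show 0 < x by linarith),
    ← mul_div_assoc, ← add_div]
  gcongr
  linarith

end IsRegularlyVarying

/-! ### Vague convergence from convergence on half-open intervals -/

/-- A compactly supported continuous function is uniformly approximated by step functions on a
regular grid. -/
theorem exists_step_approx {f : ℝ → ℂ} (hf : Continuous f) (hc : HasCompactSupport f) :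
    ∃ K : ℕ, ∀ ε > 0, ∃ (s : Finset ℤ) (δ : ℝ), 0 < δ ∧ ∀ x, ‖f x -
      ∑ j ∈ s, (Set.Ico (j * δ) ((j + 1) * δ)).indicator (fun _ => f (j * δ)) x‖ ≤
      (Set.Ico (-K : ℝ) K).indicator (fun _ => ε) x := by
  obtain ⟨r, hr⟩ := hc.isCompact.isBounded.subset_closedBall 0
  obtain ⟨k, hk⟩ := exists_nat_ge r
  have hzero (x : ℝ) (hx : (k : ℝ) < |x|) : f x = 0 := by
    by_contra h
    have := hr (subset_tsupport _ h)
    rw [mem_closedBall_zero_iff, Real.norm_eq_abs] at this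
    linarith
  refine ⟨k + 2, fun ε hε => ?_⟩
  obtain ⟨η, hη, huc⟩ := Metric.uniformContinuous_iff.mp
    (hc.uniformContinuous_of_continuous hf) ε hε
  set δ := min (η / 2) 1
  have hδ : 0 < δ := lt_min (half_pos hη) one_pos
  have hδη : δ < η := (min_le_left _ _).trans_lt (half_lt_self hη)
  have hδ1 : δ ≤ 1 := min_le_right _ _
  obtain ⟨N, hN⟩ := exists_nat_ge ((k + 2) / δ)
  have hN' : (k : ℝ) + 2 ≤ N * δ := (div_le_iff₀ hδ).mp hN
  refine ⟨Finset.Icc (-(N + 1) : ℤ) N, δ, hδ, fun x => ?_⟩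
  have hmem (j : ℤ) : x ∈ Set.Ico (j * δ) ((j + 1) * δ) ↔ j = ⌊x / δ⌋ := by
    rw [Set.mem_Ico, eq_comm, Int.floor_eq_iff, le_div_iff₀ hδ, div_lt_iff₀ hδ]
  set j := ⌊x / δ⌋ with hj
  have hxj := (hmem j).mpr rfl
  have hsum : ∑ j ∈ Finset.Icc (-(N + 1) : ℤ) N,
      (Set.Ico (j * δ) ((j + 1) * δ)).indicator (fun _ => f (j * δ)) x =
      if j ∈ Finset.Icc (-(N + 1) : ℤ) N then f (j * δ) else 0 := by
    rw [← Finset.sum_ite_eq' (Finset.Icc (-(N + 1) : ℤ) N) j fun j => f (j * δ)]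
    refine Finset.sum_congr rfl fun i _ => ?_
    simp only [Set.indicator, hmem]
  rw [hsum]
  by_cases hx : x ∈ Set.Ico (-(k + 2 : ℕ) : ℝ) (k + 2 : ℕ)
  · rw [Set.indicator_of_mem hx, if_pos]
    · rw [← dist_eq_norm]
      refine (huc ?_).le
      rw [Real.dist_eq, abs_lt]
      constructor <;> nlinarith [hxj.1, hxj.2]
    · push_cast at hx
      rw [Finset.mem_Icc]
      constructor
      · have : (-(N + 1) : ℝ) < j + 1 := by
          have h2 : -(N + 1) * δ < (j + 1) * δ := by nlinarith [hx.1, hxj.2]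
          exact lt_of_mul_lt_mul_right h2 hδ.le
        have : (-(N + 1) : ℤ) < j + 1 := by exact_mod_cast this
        omega
      · have : (j : ℝ) < N := by
          have h2 : j * δ < N * δ := by linarith [hx.2, hxj.1]
          exact lt_of_mul_lt_mul_right h2 hδ.le
        have : j < N := by exact_mod_cast this
        omega
  · rw [Set.indicator_of_notMem hx]
    have hxk : (k : ℝ) + 2 ≤ |x| := by
      by_contra! h
      rw [abs_lt] at h
      push_cast at hx
      exact hx ⟨by linarith, by linarith⟩
    rw [hzero x (by linarith), hzero (j * δ), ite_self, sub_zero, norm_zero]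
    have h1 : |x - j * δ| ≤ 1 := by
      rw [abs_le]
      constructor <;> nlinarith [hxj.1, hxj.2]
    have := abs_sub_abs_le_abs_sub x (j * δ)
    linarith

theorem tendsto_integral_of_tendsto_Ico {ι : Type*} {l : Filter ι} {m : ι → Measure ℝ}
    {μ : Measure ℝ} [∀ i, IsFiniteMeasureOnCompacts (m i)] [IsFiniteMeasureOnCompacts μ]
    (h : ∀ a b : ℝ, a ≤ b →
      Tendsto (fun i => (m i).real (Set.Ico a b)) l (𝓝 (μ.real (Set.Ico a b))))
    {f : ℝ → ℂ} (hf : Continuous f) (hc : HasCompactSupport f) :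
    Tendsto (fun i => ∫ x, f x ∂m i) l (𝓝 (∫ x, f x ∂μ)) := by
  obtain ⟨K, hK⟩ := exists_step_approx hf hc
  refine Metric.tendsto_nhds.mpr fun ε hε => ?_
  set I := Set.Ico (-K : ℝ) K
  have hfin (p : Measure ℝ) [IsFiniteMeasureOnCompacts p] (a b : ℝ) : p (Set.Ico a b) ≠ ∞ :=
    ((measure_mono Set.Ico_subset_Icc_self).trans_lt isCompact_Icc.measure_lt_top).ne
  have hKK : (-K : ℝ) ≤ K := by linarith [Nat.cast_nonneg (α := ℝ) K]
  set T := μ.real I + 1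
  have hT : 0 < T := by positivity
  obtain ⟨s, δ, hδ, happ⟩ := hK (ε / (4 * T)) (by positivity)
  set F : ℝ → ℂ := fun x =>
    ∑ j ∈ s, (Set.Ico (j * δ) ((j + 1) * δ)).indicator (fun _ => f (j * δ)) x
  have hFint (p : Measure ℝ) [IsFiniteMeasureOnCompacts p] (j : ℤ) : Integrable
      ((Set.Ico (j * δ) ((j + 1) * δ)).indicator (fun _ => f (j * δ))) p :=
    (integrable_indicator_iff measurableSet_Ico).mpr (integrableOn_const (hfin p _ _))
  have hFval (p : Measure ℝ) [IsFiniteMeasureOnCompacts p] : ∫ x, F x ∂p =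
      ∑ j ∈ s, p.real (Set.Ico (j * δ) ((j + 1) * δ)) • f (j * δ) := by
    simp only [F]
    rw [integral_finsetSum _ fun j _ => hFint p j]
    exact Finset.sum_congr rfl fun j _ => integral_indicator_const _ measurableSet_Ico
  have herr (p : Measure ℝ) [IsFiniteMeasureOnCompacts p] :
      ‖∫ x, f x ∂p - ∫ x, F x ∂p‖ ≤ p.real I * (ε / (4 * T)) := by
    rw [← integral_sub (hf.integrable_of_hasCompactSupport hc)
      (integrable_finsetSum _ fun j _ => hFint p j)]
    refine (norm_integral_le_of_norm_le ?_ (ae_of_all _ happ)).trans ?_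
    · exact (integrable_indicator_iff measurableSet_Ico).mpr (integrableOn_const (hfin p _ _))
    · rw [integral_indicator_const _ measurableSet_Ico, smul_eq_mul]
  have hFlim : Tendsto (fun i => ∫ x, F x ∂m i) l (𝓝 (∫ x, F x ∂μ)) := by
    simp only [hFval]
    exact tendsto_finsetSum _ fun j _ => (h _ _ (by nlinarith)).smul_const _
  filter_upwards [Metric.tendsto_nhds.mp hFlim (ε / 4) (by positivity),
    (h _ _ hKK).eventually (gt_mem_nhds (show μ.real I < T by simp [T]))] with i h1 h2
  have e1 : (m i).real I * (ε / (4 * T)) ≤ ε / 4 := by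
    calc _ ≤ T * (ε / (4 * T)) := by gcongr
      _ = ε / 4 := by field_simp
  have e2 : μ.real I * (ε / (4 * T)) ≤ ε / 4 := by
    calc _ ≤ T * (ε / (4 * T)) := by gcongr; simp [T]
      _ = ε / 4 := by field_simp
  have k1 := (herr (m i)).trans e1
  have k2 := (herr μ).trans e2
  rw [dist_eq_norm] at h1 ⊢
  calc ‖∫ x, f x ∂m i - ∫ x, f x ∂μ‖
      = ‖(∫ x, f x ∂m i - ∫ x, F x ∂m i) + (∫ x, F x ∂m i - ∫ x, F x ∂μ) -
        (∫ x, f x ∂μ - ∫ x, F x ∂μ)‖ := by congr 1; ring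
    _ ≤ ‖∫ x, f x ∂m i - ∫ x, F x ∂m i‖ + ‖∫ x, F x ∂m i - ∫ x, F x ∂μ‖ +
        ‖∫ x, f x ∂μ - ∫ x, F x ∂μ‖ := (norm_sub_le _ _).trans (by gcongr; exact norm_add_le _ _)
    _ < ε := by linarith

theorem exponentialIntensity_real_Ico {θ : ℝ} (hθ : 0 < θ) {a b : ℝ} (hab : a ≤ b) :
    (exponentialIntensity 1 θ).real (Set.Ico a b) = Real.exp (-θ * a) - Real.exp (-θ * b) := by
  have hint : ∫ x in a..b, 1 * θ * Real.exp (-θ * x) = Real.exp (-θ * a) - Real.exp (-θ * b) := by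
    rw [intervalIntegral.integral_eq_sub_of_hasDerivAt (f := fun x => -Real.exp (-θ * x))]
    · ring
    · intro x _
      have := (((hasDerivAt_id x).const_mul (-θ)).exp).neg
      convert! this using 1
      simp
      ring
    · exact Continuous.intervalIntegrable (by fun_prop) _ _
  rw [measureReal_def, exponentialIntensity_apply _ _ measurableSet_Ico,
    restrict_Ico_eq_restrict_Ioc, ← hint, intervalIntegral.integral_of_le hab,
    integral_eq_lintegral_of_nonneg_ae (ae_of_all _ fun x => by positivity)
      (by fun_prop)]

theorem exponentialIntensity_eq_smul {c : ℝ} (hc : 0 ≤ c) (θ : ℝ) :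
    exponentialIntensity c θ = ENNReal.ofReal c • exponentialIntensity 1 θ := by
  ext B hB
  rw [Measure.smul_apply, exponentialIntensity_apply _ _ hB, exponentialIntensity_apply _ _ hB,
    smul_eq_mul, ← lintegral_const_mul _ (by fun_prop)]
  refine lintegral_congr fun x => ?_
  rw [← ENNReal.ofReal_mul hc]
  ring_nf

/-! ### Exponential tails with a regularly varying prefactor -/

/-- The function `x ↦ e^{θ x} ν[x, ∞)`. -/
noncomputable def expTail (ν : Measure ℝ) (θ x : ℝ) : ℝ := ν.real (Set.Ici x) * Real.exp (θ * x)

theorem antitone_real_Ici (ν : Measure ℝ) [IsFiniteMeasure ν] :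
    Antitone fun x => ν.real (Set.Ici x) :=
  fun _ _ h => measureReal_mono (Set.Ici_subset_Ici.mpr h)

theorem measurable_expTail (ν : Measure ℝ) [IsFiniteMeasure ν] (θ : ℝ) :
    Measurable (expTail ν θ) :=
  (antitone_real_Ici ν).measurable.mul (by fun_prop)

theorem real_Ici_eq (ν : Measure ℝ) (θ x : ℝ) :
    ν.real (Set.Ici x) = expTail ν θ x * Real.exp (-θ * x) := by
  rw [expTail, mul_assoc, ← Real.exp_add]
  simp

theorem expTail_isEquivalent {ν : Measure ℝ} {θ : ℝ} {L : ℝ → ℝ}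
    (hν : (fun x : ℝ => (ν (Set.Ici x)).toReal) ~[atTop] fun x => L x * Real.exp (-θ * x)) :
    expTail ν θ ~[atTop] L := by
  have h := hν.mul (IsEquivalent.refl (u := fun x : ℝ => Real.exp (θ * x)))
  refine h.congr_right (Eventually.of_forall fun x => ?_)
  simp only [Pi.mul_apply]
  rw [mul_assoc, ← Real.exp_add]
  simp

section RegularTail

variable {ν : Measure ℝ} [IsProbabilityMeasure ν] {θ α : ℝ}

theorem real_Ici_pos (h : IsRegularlyVarying (expTail ν θ) α) (x : ℝ) :
    0 < ν.real (Set.Ici x) := by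
  obtain ⟨y, hy, hxy⟩ := (h.eventually_ne_zero.and (eventually_ge_atTop x)).exists
  have h0 : 0 < ν.real (Set.Ici y) :=
    lt_of_le_of_ne measureReal_nonneg fun h0 => hy (by rw [expTail, ← h0, zero_mul])
  exact h0.trans_le (antitone_real_Ici ν hxy)

theorem expTail_pos (h : IsRegularlyVarying (expTail ν θ) α) (x : ℝ) : 0 < expTail ν θ x :=
  mul_pos (real_Ici_pos h x) (Real.exp_pos _)

theorem tendsto_real_Ici_add_div (h : IsRegularlyVarying (expTail ν θ) α) (x : ℝ) :
    Tendsto (fun y => ν.real (Set.Ici (y + x)) / ν.real (Set.Ici y)) atTop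
      (𝓝 (Real.exp (-θ * x))) := by
  have h1 := h.tendsto_div_prod (measurable_expTail ν θ) (expTail_pos h) one_pos
  rw [Real.one_rpow] at h1
  have h2 : Tendsto (fun y : ℝ => 1 + x / y) atTop (𝓝 1) := by
    simpa using (tendsto_id.const_div_atTop x).const_add 1
  have h3 := (h1.comp (tendsto_id.prodMk h2)).mul_const (Real.exp (-θ * x))
  rw [one_mul] at h3
  refine h3.congr' ?_
  filter_upwards [eventually_gt_atTop 0] with y hy
  simp only [Function.comp_apply, id]
  rw [show (1 + x / y) * y = y + x by field_simp, real_Ici_eq ν θ (y + x), real_Ici_eq ν θ y]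
  have := (expTail_pos h y).ne'
  rw [mul_add, Real.exp_add]
  field_simp

theorem tendsto_integral_shift_div (h : IsRegularlyVarying (expTail ν θ) α) (hθ : 0 < θ)
    {f : ℝ → ℂ} (hf : Continuous f) (hc : HasCompactSupport f) :
    Tendsto (fun y => (∫ z, f (z - y) ∂ν) / (ν.real (Set.Ici y) : ℂ)) atTop
      (𝓝 (∫ x, f x ∂exponentialIntensity 1 θ)) := by
  let m (y : ℝ) : Measure ℝ := (ν.real (Set.Ici y)).toNNReal⁻¹ • ν.map (fun z => z - y)
  have hp (y : ℝ) : IsProbabilityMeasure (ν.map fun z => z - y) :=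
    Measure.isProbabilityMeasure_map (by fun_prop)
  have hm (a b : ℝ) (hab : a ≤ b) : Tendsto (fun y => (m y).real (Set.Ico a b)) atTop
      (𝓝 ((exponentialIntensity 1 θ).real (Set.Ico a b))) := by
    rw [exponentialIntensity_real_Ico hθ hab]
    refine ((tendsto_real_Ici_add_div h a).sub (tendsto_real_Ici_add_div h b)).congr fun y => ?_
    have e : (fun z => z - y) ⁻¹' Set.Ico a b = Set.Ici (y + a) \ Set.Ici (y + b) := by
      ext z
      simp only [Set.mem_preimage, Set.mem_Ico, Set.mem_sdiff, Set.mem_Ici, not_le]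
      constructor <;> rintro ⟨h1, h2⟩ <;> constructor <;> linarith
    simp only [m]
    rw [measureReal_nnreal_smul_apply, map_measureReal_apply (by fun_prop) measurableSet_Ico, e,
      measureReal_sdiff (Set.Ici_subset_Ici.mpr (by linarith)) measurableSet_Ici]
    rw [NNReal.coe_inv, Real.coe_toNNReal _ measureReal_nonneg]
    ring
  refine (tendsto_integral_of_tendsto_Ico hm hf hc).congr fun y => ?_
  simp only [m]
  rw [integral_smul_nnreal_measure, integral_map (by fun_prop) (by fun_prop), NNReal.smul_def,
    NNReal.coe_inv, Real.coe_toNNReal _ measureReal_nonneg, Complex.real_smul, Complex.ofReal_inv,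
    div_eq_inv_mul]

theorem tendsto_real_Ici : Tendsto (fun x => ν.real (Set.Ici x)) atTop (𝓝 0) := by
  have h := tendsto_measure_iInter_atTop (μ := ν) (s := fun x : ℝ => Set.Ici x)
    (fun x => measurableSet_Ici.nullMeasurableSet) (fun _ _ h => Set.Ici_subset_Ici.mpr h)
    ⟨0, measure_ne_top _ _⟩
  have he : ⋂ x : ℝ, Set.Ici x = ∅ := by
    ext y
    simp only [Set.mem_iInter, Set.mem_Ici, Set.mem_empty_iff_false, iff_false, not_forall, not_le]
    exact ⟨y + 1, by linarith⟩
  rw [he, measure_empty] at h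
  exact (ENNReal.tendsto_toReal ENNReal.zero_ne_top).comp h

theorem exists_real_Ici_le (h : IsRegularlyVarying (expTail ν θ) α) (hθ : 0 < θ) {ε : ℝ}
    (hε : 0 < ε) :
    ∃ C, 0 < C ∧ ∀ x, ν.real (Set.Ici x) ≤ C * Real.exp (-θ * x + ε * |x|) := by
  have h1 := h.tendsto_log_div (measurable_expTail ν θ) (expTail_pos h)
  obtain ⟨X, hX⟩ := eventually_atTop.mp (h1.eventually (gt_mem_nhds hε))
  refine ⟨Real.exp (θ * max X 1), Real.exp_pos _, fun x => ?_⟩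
  have hM : (0 : ℝ) < max X 1 := lt_of_lt_of_le one_pos (le_max_right _ _)
  rcases le_total x (max X 1) with hx | hx
  · refine measureReal_le_one.trans ?_
    rw [← Real.exp_add, Real.one_le_exp_iff]
    nlinarith [mul_nonneg hε.le (abs_nonneg x), mul_le_mul_of_nonneg_left hx hθ.le]
  · have hx0 : 0 < x := hM.trans_le hx
    have h2 := (hX x ((le_max_left _ _).trans hx)).le
    rw [div_le_iff₀ hx0] at h2
    have h3 : expTail ν θ x ≤ Real.exp (ε * x) := by
      rw [← Real.exp_log (expTail_pos h x)]
      exact Real.exp_le_exp.mpr h2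
    rw [real_Ici_eq ν θ, abs_of_pos hx0, Real.exp_add]
    have h4 : 1 ≤ Real.exp (θ * max X 1) := Real.one_le_exp (by positivity)
    calc expTail ν θ x * Real.exp (-θ * x) ≤ Real.exp (ε * x) * Real.exp (-θ * x) := by gcongr
      _ = 1 * (Real.exp (-θ * x) * Real.exp (ε * x)) := by ring
      _ ≤ _ := by gcongr

end RegularTail

/-! ### Contribution of one particle -/

/-- Mean of `f` at the position `s + Y - m` of a particle located at `s`, with `Y` of law `ν`. -/
noncomputable def particleMean (ν : Measure ℝ) (f : ℝ → ℂ) (m s : ℝ) : ℂ := ∫ y, f (s + y - m) ∂ν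

/-- The deviation of `particleMean` from its limit, with its square. -/
noncomputable def particleError (ν : Measure ℝ) (f : ℝ → ℂ) (m : ℝ) (w : ℝ) (I : ℂ) (s : ℝ) : ℝ :=
  2 * ‖particleMean ν f m s‖ ^ 2 + ‖particleMean ν f m s - w * I‖

section RegularTail

variable {ν : Measure ℝ} [IsProbabilityMeasure ν] {θ α κ κ' : ℝ} {L : ℝ → ℝ}

theorem eventually_pos_of_tail (hL : IsRegularlyVarying L α)
    (hν : (fun x : ℝ => (ν (Set.Ici x)).toReal) ~[atTop] fun x => L x * Real.exp (-θ * x)) :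
    ∀ᶠ x in atTop, 0 < L x := by
  have hl := hL.congr_isEquivalent (expTail_isEquivalent hν)
  have h1 : Tendsto (expTail ν θ / L) atTop (𝓝 1) :=
    (isEquivalent_iff_tendsto_one hL.eventually_ne_zero).mp (expTail_isEquivalent hν)
  filter_upwards [h1.eventually (lt_mem_nhds one_pos)] with x hx
  rw [Pi.div_apply, div_pos_iff] at hx
  rcases hx with hx | hx
  · exact hx.2
  · exact absurd hx.1 (expTail_pos hl x).not_gt

theorem tendsto_log_div_of_tail (hL : IsRegularlyVarying L α)
    (hν : (fun x : ℝ => (ν (Set.Ici x)).toReal) ~[atTop] fun x => L x * Real.exp (-θ * x)) :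
    Tendsto (fun x => Real.log (L x) / x) atTop (𝓝 0) := by
  have hl := hL.congr_isEquivalent (expTail_isEquivalent hν)
  have h1 : Tendsto (expTail ν θ / L) atTop (𝓝 1) :=
    (isEquivalent_iff_tendsto_one hL.eventually_ne_zero).mp (expTail_isEquivalent hν)
  have h2 := (Real.continuousAt_log one_ne_zero).tendsto.comp h1
  have h3 := (hl.tendsto_log_div (measurable_expTail ν θ) (expTail_pos hl)).sub
    (h2.div_atTop tendsto_id)
  rw [sub_zero] at h3
  refine h3.congr' ?_
  filter_upwards [eventually_pos_of_tail hL hν] with x hx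
  simp only [Function.comp_apply, Pi.div_apply, id]
  rw [Real.log_div (expTail_pos hl x).ne' hx.ne']
  ring

theorem eventually_particleError_le_of_near (hL : IsRegularlyVarying L α)
    (hν : (fun x : ℝ => (ν (Set.Ici x)).toReal) ~[atTop] fun x => L x * Real.exp (-θ * x))
    (hθ : 0 < θ) (hb : 0 < κ / θ - κ') {f : ℝ → ℂ} (hf : Continuous f) (hc : HasCompactSupport f)
    {ε : ℝ} (hε : 0 < ε) :
    ∃ ε₁ > 0, ∀ᶠ n : ℕ in atTop, ∀ s, |s - n * κ'| ≤ ε₁ * n →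
      particleError ν f (n * (κ / θ) + 1 / θ * Real.log (L n))
        (Real.exp (θ * s - n * κ)) (((κ / θ - κ') ^ α : ℝ) * ∫ x, f x ∂exponentialIntensity 1 θ) s ≤
        ε * Real.exp (θ * s - n * κ) := by
  set b := κ / θ - κ'
  set I := ∫ x, f x ∂exponentialIntensity 1 θ
  have hl := hL.congr_isEquivalent (expTail_isEquivalent hν)
  have hratio : Tendsto (expTail ν θ / L) atTop (𝓝 1) :=
    (isEquivalent_iff_tendsto_one hL.eventually_ne_zero).mp (expTail_isEquivalent hν)
  let J (y : ℝ) : ℂ := (∫ z, f (z - y) ∂ν) / (ν.real (Set.Ici y) : ℂ)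
  let F (p : ℝ × ℝ) : ℂ := J (p.2 * p.1) * ((expTail ν θ (p.2 * p.1) / L p.1 : ℝ) : ℂ)
  have hmul : Tendsto (fun p : ℝ × ℝ => p.2 * p.1) (atTop ×ˢ 𝓝 b) atTop :=
    tendsto_snd.pos_mul_atTop hb tendsto_fst
  have hJ : Tendsto (fun p : ℝ × ℝ => J (p.2 * p.1)) (atTop ×ˢ 𝓝 b) (𝓝 I) :=
    (tendsto_integral_shift_div hl hθ hf hc).comp hmul
  have hF : Tendsto F (atTop ×ˢ 𝓝 b) (𝓝 ((b ^ α : ℝ) * I)) := by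
    have h1 := (hl.tendsto_div_prod (measurable_expTail ν θ) (expTail_pos hl) hb).mul
      (hratio.comp tendsto_fst)
    rw [mul_one] at h1
    have h2 : Tendsto (fun p : ℝ × ℝ => expTail ν θ (p.2 * p.1) / L p.1) (atTop ×ˢ 𝓝 b)
        (𝓝 (b ^ α)) := by
      refine h1.congr fun p => ?_
      have := (expTail_pos hl p.1).ne'
      simp only [Function.comp_apply, Pi.div_apply]
      field_simp
    have h3 := hJ.mul ((Complex.continuous_ofReal.tendsto _).comp h2)
    rw [mul_comm I] at h3
    exact h3
  have hG : Tendsto (fun p : ℝ × ℝ => J (p.2 * p.1) * (ν.real (Set.Ici (p.2 * p.1)) : ℂ))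
      (atTop ×ˢ 𝓝 b) (𝓝 0) := by
    have := hJ.mul ((Complex.continuous_ofReal.tendsto _).comp
      ((tendsto_real_Ici (ν := ν)).comp hmul))
    simpa using this
  have hH : Tendsto (fun p : ℝ × ℝ => 2 * (‖J (p.2 * p.1) * (ν.real (Set.Ici (p.2 * p.1)) : ℂ)‖ *
      ‖F p‖) + ‖F p - (b ^ α : ℝ) * I‖) (atTop ×ˢ 𝓝 b) (𝓝 0) := by
    have h1 := ((hG.norm.mul hF.norm).const_mul 2).add (hF.sub_const ((b ^ α : ℝ) * I)).norm
    simpa using h1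
  obtain ⟨⟨X, δ⟩, ⟨-, hδ⟩, hXδ⟩ :=
    ((atTop_basis.prod Metric.nhds_basis_closedBall).eventually_iff).mp
    (hH.eventually (gt_mem_nhds hε))
  have hδ : 0 < δ := hδ
  have hlogn : ∀ᶠ n : ℕ in atTop, |Real.log (L n) / n| < δ / 2 * θ := by
    have := ((tendsto_log_div_of_tail hL hν).comp tendsto_natCast_atTop_atTop).norm
    rw [norm_zero] at this
    exact this.eventually (gt_mem_nhds (by positivity))
  refine ⟨δ / 2, by positivity, ?_⟩
  filter_upwards [hlogn, tendsto_natCast_atTop_atTop.eventually_ge_atTop X, eventually_gt_atTop 0,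
    tendsto_natCast_atTop_atTop.eventually (eventually_pos_of_tail hL hν)]
    with n hn hnX hn0 hLn s hs
  have hn0' : (0 : ℝ) < n := by exact_mod_cast hn0
  set y := n * (κ / θ) + 1 / θ * Real.log (L n) - s with hy
  set e := Real.exp (θ * s - n * κ) with he
  have hlam : |y / n - b| ≤ δ := by
    have e1 : y / n - b = Real.log (L n) / n / θ - (s - n * κ') / n := by
      simp only [hy, b]
      field_simp
      ring
    rw [e1]
    refine (abs_sub _ _).trans ?_
    rw [abs_div _ θ, abs_of_pos hθ, abs_div (s - _), abs_of_pos hn0']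
    have h1 : |Real.log (L n) / n| / θ ≤ δ / 2 := (div_le_iff₀ hθ).mpr hn.le
    have h2 : |s - n * κ'| / n ≤ δ / 2 := (div_le_iff₀ hn0').mpr hs
    linarith
  have hp := hXδ (x := ((n : ℝ), y / n)) ⟨hnX, by simpa [Real.dist_eq] using hlam⟩
  simp only [div_mul_cancel₀ y hn0'.ne'] at hp
  have hg1 : particleMean ν f (n * (κ / θ) + 1 / θ * Real.log (L n)) s =
      J y * (ν.real (Set.Ici y) : ℂ) := by
    have : (ν.real (Set.Ici y) : ℂ) ≠ 0 := by exact_mod_cast (real_Ici_pos hl y).ne'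
    simp only [J]
    rw [div_mul_cancel₀ _ this, particleMean]
    congr with z
    congr 1
    simp only [hy]
    ring
  have hexp : Real.exp (-θ * y) = e / L n := by
    have : -θ * y = (θ * s - n * κ) - Real.log (L n) := by
      simp only [hy]
      field_simp
      ring
    rw [this, Real.exp_sub, Real.exp_log hLn]
  have hg2 : particleMean ν f (n * (κ / θ) + 1 / θ * Real.log (L n)) s = e * F (n, y / n) := by
    rw [hg1, real_Ici_eq ν θ, hexp]
    simp only [F, div_mul_cancel₀ y hn0'.ne']
    push_cast
    ring
  have he0 : 0 < e := Real.exp_pos _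
  calc particleError ν f (n * (κ / θ) + 1 / θ * Real.log (L n)) e ((b ^ α : ℝ) * I) s
      = (2 * (‖J y * (ν.real (Set.Ici y) : ℂ)‖ * ‖F (n, y / n)‖) +
          ‖F (n, y / n) - (b ^ α : ℝ) * I‖) * e := by
        rw [particleError, sq]
        nth_rewrite 1 [hg1]
        rw [hg2, ← mul_sub, norm_mul (e : ℂ), norm_mul (e : ℂ), Complex.norm_real,
          Real.norm_of_nonneg he0.le]
        ring
    _ ≤ ε * e := by gcongr

theorem norm_particleMean_le {f : ℝ → ℂ} {A : ℝ} (hA : ∀ x < -A, f x = 0) (hf2 : ∀ x, ‖f x‖ ≤ 2)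
    (m s : ℝ) : ‖particleMean ν f m s‖ ≤ 2 * ν.real (Set.Ici (m - s - A)) := by
  rw [mul_comm, ← smul_eq_mul, ← integral_indicator_const (2 : ℝ) measurableSet_Ici]
  refine norm_integral_le_of_norm_le
    ((integrable_indicator_iff measurableSet_Ici).mpr (integrableOn_const (measure_ne_top _ _)))
    (ae_of_all _ fun y => ?_)
  by_cases hy : y ∈ Set.Ici (m - s - A)
  · rw [Set.indicator_of_mem hy]
    exact hf2 _
  · rw [Set.indicator_of_notMem hy, hA, norm_zero]
    simp only [Set.mem_Ici, not_le] at hy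
    linarith

theorem eventually_particleError_le_of_far (hL : IsRegularlyVarying L α)
    (hν : (fun x : ℝ => (ν (Set.Ici x)).toReal) ~[atTop] fun x => L x * Real.exp (-θ * x))
    (hθ : 0 < θ) (hb : 0 < κ / θ - κ') {f : ℝ → ℂ} {A : ℝ} (hA : ∀ x < -A, f x = 0)
    (hf2 : ∀ x, ‖f x‖ ≤ 2) (I : ℂ) {ε₁ t : ℝ} (hε₁ : 0 < ε₁) (ht : 0 < t) :
    ∃ C, 0 ≤ C ∧ ∀ᶠ n : ℕ in atTop, ∀ s, ε₁ * n < |s - n * κ'| →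
      particleError ν f (n * (κ / θ) + 1 / θ * Real.log (L n))
        (Real.exp (θ * s - n * κ)) I s ≤
        C * (Real.exp (θ * s - n * κ) * Real.exp (t * |s - n * κ'| - t * ε₁ / 2 * n)) := by
  set b := κ / θ - κ'
  have hl := hL.congr_isEquivalent (expTail_isEquivalent hν)
  set ε := min (t / 4) (t * ε₁ / (8 * (b + 2)))
  have hε : 0 < ε := lt_min (by positivity) (by positivity)
  have hε4 : ε ≤ t / 4 := min_le_left _ _
  have hεb : ε * (b + 2) ≤ t * ε₁ / 8 := by
    calc _ ≤ t * ε₁ / (8 * (b + 2)) * (b + 2) := by gcongr; exact min_le_right _ _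
      _ = _ := by field_simp
  obtain ⟨C, hC, hbound⟩ := exists_real_Ici_le hl hθ hε
  have hlog := ((tendsto_log_div_of_tail hL hν).comp tendsto_natCast_atTop_atTop).norm
  rw [norm_zero] at hlog
  refine ⟨10 * C * Real.exp (θ * A) + ‖I‖, by positivity, ?_⟩
  filter_upwards [hlog.eventually (gt_mem_nhds (show 0 < min ε (θ / 2) by positivity)),
    tendsto_natCast_atTop_atTop.eventually_ge_atTop (2 * |A|), eventually_gt_atTop 0,
    tendsto_natCast_atTop_atTop.eventually (eventually_pos_of_tail hL hν)]
    with n hn hnA hn0 hLn s hs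
  have hn0' : (0 : ℝ) < n := by exact_mod_cast hn0
  simp only [Function.comp_apply] at hn
  rw [norm_div, Real.norm_eq_abs, Real.norm_of_nonneg hn0'.le, div_lt_iff₀ hn0'] at hn
  have hn1 : |Real.log (L n)| ≤ ε * n := hn.le.trans (by gcongr; exact min_le_left _ _)
  have hn2 : |Real.log (L n)| ≤ θ / 2 * n := hn.le.trans (by gcongr; exact min_le_right _ _)
  set m := n * (κ / θ) + 1 / θ * Real.log (L n) with hm
  set e := Real.exp (θ * s - n * κ) with he
  set x := |s - n * κ'| with hx
  set E := Real.exp (t * x - t * ε₁ / 2 * n) with hE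
  have h7 : t * (ε₁ * n) ≤ t * x := by gcongr
  have h8 : 0 < t * (ε₁ * n) := by positivity
  have hE1 : 1 ≤ E := Real.one_le_exp (by linarith)
  have hy : |m - s - A| ≤ n * (b + 1) + x := by
    have e1 : m - s - A = n * b + Real.log (L n) / θ - (s - n * κ') - A := by
      simp only [hm, b]
      ring
    have h1 : |Real.log (L n) / θ| ≤ n / 2 := by
      rw [abs_div, abs_of_pos hθ, div_le_iff₀ hθ]
      linarith
    rw [e1, abs_le]
    have h2 := abs_le.mp h1
    have h3 := abs_le.mp (le_refl |A|)
    have h4 := abs_le.mp (le_refl x)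
    have h5 : 0 < n * b := by positivity
    constructor <;> nlinarith [h2.1, h2.2, h3.1, h3.2, h4.1, h4.2]
  have hg : ‖particleMean ν f m s‖ ≤ 2 * C * Real.exp (θ * A) * (e * E) := by
    refine (norm_particleMean_le hA hf2 m s).trans ?_
    have h1 := hbound (m - s - A)
    have h2 : -θ * (m - s - A) + ε * |m - s - A| ≤
        θ * A + ((θ * s - n * κ) + (t * x - t * ε₁ / 2 * n)) := by
      have e2 : -θ * (m - s - A) = θ * A + (θ * s - n * κ) - Real.log (L n) := by
        simp only [hm]
        field_simp
        ring
      have h3 := (abs_le.mp hn1).1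
      have h4 : ε * |m - s - A| ≤ ε * (n * (b + 1) + x) := by gcongr
      have h5 : ε * x ≤ t / 4 * x := mul_le_mul_of_nonneg_right hε4 (abs_nonneg _)
      have h6 : ε * (b + 2) * n ≤ t * ε₁ / 8 * n := by gcongr
      rw [e2]
      linarith
    calc 2 * ν.real (Set.Ici (m - s - A))
        ≤ 2 * (C * Real.exp (θ * A + ((θ * s - n * κ) + (t * x - t * ε₁ / 2 * n)))) := by
          gcongr
          exact h1.trans (by gcongr)
      _ = _ := by rw [Real.exp_add, Real.exp_add]; ring
  have hg2 : ‖particleMean ν f m s‖ ≤ 2 := by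
    have h1 : ν.real (Set.Ici (m - s - A)) ≤ 1 := measureReal_le_one
    linarith [norm_particleMean_le (ν := ν) hA hf2 m s]
  have he0 : 0 < e := Real.exp_pos _
  calc particleError ν f m e I s
      ≤ 2 * (2 * ‖particleMean ν f m s‖) + (‖particleMean ν f m s‖ + e * ‖I‖) := by
        rw [particleError, sq]
        gcongr
        refine (norm_sub_le _ _).trans ?_
        rw [norm_mul, Complex.norm_real, Real.norm_of_nonneg he0.le]
    _ = 5 * ‖particleMean ν f m s‖ + ‖I‖ * (e * 1) := by ring
    _ ≤ 5 * (2 * C * Real.exp (θ * A) * (e * E)) + ‖I‖ * (e * E) := by gcongr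
    _ = _ := by ring

end RegularTail

/-! ### Sums over a generation of the branching random walk -/

/-- The words of length `n`: the labels of generation `n`. -/
abbrev Words (n : ℕ) : Type := {u : List ℕ // u.length = n}

/-- A word of length `n + 1` is a word of length `n` with a letter added. -/
def wordsSuccEquiv (n : ℕ) : Words n × ℕ ≃ Words (n + 1) where
  toFun p := ⟨p.2 :: p.1.1, by simp [p.1.2]⟩
  invFun
    | ⟨i :: u, h⟩ => (⟨u, by simpa using h⟩, i)
  left_inv _ := rfl
  right_inv
    | ⟨_ :: _, _⟩ => rfl

section Generation

variable {Ω : Type*}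

open Classical in
theorem tsum_gen {M : Type*} [AddCommMonoid M] [TopologicalSpace M] (N : List ℕ → Ω → ℕ∞) (n : ℕ)
    (ω : Ω) (f : List ℕ → M) :
    ∑' u : Gen N n ω, f u.1 = ∑' u : Words n, if IsAlive N u.1 ω then f u.1 else 0 := by
  let e : {u : Words n // IsAlive N u.1 ω} ≃ Gen N n ω :=
    { toFun := fun u => ⟨u.1.1, u.1.2, u.2⟩
      invFun := fun u => ⟨⟨u.1, u.2.1⟩, u.2.2⟩
      left_inv := fun _ => rfl
      right_inv := fun _ => rfl }
  rw [← e.tsum_eq fun u => f u.1]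
  exact (tsum_subtype {u : Words n | IsAlive N u.1 ω} fun u => f u.1).trans
    (tsum_congr fun u => by simp [Set.indicator])

open Classical in
/-- The sum of `f (S_u)` over the particles `u` of generation `n`. -/
noncomputable def genSum (N : List ℕ → Ω → ℕ∞) (X : List ℕ → Ω → ℕ → ℝ) (f : ℝ → ℝ≥0∞) (n : ℕ)
    (ω : Ω) : ℝ≥0∞ :=
  ∑' u : Words n, if IsAlive N u.1 ω then f (position X u.1 ω) else 0

open Classical in
theorem additiveMartingale_eq_toReal (η : Measure Offspring) (N : List ℕ → Ω → ℕ∞)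
    (X : List ℕ → Ω → ℕ → ℝ) (θ : ℝ) (n : ℕ) (ω : Ω) :
    additiveMartingale η N X θ n ω =
      (genSum N X (fun s => ENNReal.ofReal (Real.exp (θ * s - n * kappaReal η θ))) n ω).toReal := by
  rw [additiveMartingale, tsum_gen N n ω fun u =>
    Real.exp (θ * position X u ω - n * kappaReal η θ), genSum,
    ENNReal.tsum_toReal_eq fun u => by split_ifs <;> simp]
  refine tsum_congr fun u => ?_
  split_ifs
  · rw [ENNReal.toReal_ofReal (Real.exp_pos _).le]
  · rfl

theorem genSum_mono {N : List ℕ → Ω → ℕ∞} {X : List ℕ → Ω → ℕ → ℝ} {f g : ℝ → ℝ≥0∞}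
    (h : ∀ s, f s ≤ g s) (n : ℕ) (ω : Ω) : genSum N X f n ω ≤ genSum N X g n ω := by
  refine ENNReal.tsum_le_tsum fun u => ?_
  split_ifs
  · exact h _
  · exact le_rfl

theorem genSum_add {N : List ℕ → Ω → ℕ∞} {X : List ℕ → Ω → ℕ → ℝ} (f g : ℝ → ℝ≥0∞)
    (n : ℕ) (ω : Ω) :
    genSum N X (fun s => f s + g s) n ω = genSum N X f n ω + genSum N X g n ω := by
  rw [genSum, genSum, genSum, ← ENNReal.tsum_add]
  refine tsum_congr fun u => ?_
  split_ifs <;> simp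

theorem genSum_const_mul {N : List ℕ → Ω → ℕ∞} {X : List ℕ → Ω → ℕ → ℝ} (c : ℝ≥0∞) (f : ℝ → ℝ≥0∞)
    (n : ℕ) (ω : Ω) : genSum N X (fun s => c * f s) n ω = c * genSum N X f n ω := by
  rw [genSum, genSum, ← ENNReal.tsum_mul_left]
  refine tsum_congr fun u => ?_
  split_ifs <;> simp

/-- The offspring of the individual `u`. -/
abbrev offspring (N : List ℕ → Ω → ℕ∞) (X : List ℕ → Ω → ℕ → ℝ) (u : List ℕ) (ω : Ω) : Offspring :=
  (N u ω, X u ω)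

theorem measurableSet_isAlive [MeasurableSpace Ω] {N : List ℕ → Ω → ℕ∞}
    {X : List ℕ → Ω → ℕ → ℝ} : ∀ {u : List ℕ}, (∀ v : List ℕ, v.length < u.length →
      Measurable (offspring N X v)) → MeasurableSet {ω | IsAlive N u ω}
  | [], _ => by simp [IsAlive]
  | i :: u, h => by
    refine (measurableSet_isAlive (u := u) fun v hv => h v (hv.trans (by simp))).inter ?_
    exact (h u (by simp)).fst (MeasurableSet.of_discrete (s := Set.Ioi (i : ℕ∞)))

theorem measurable_position [MeasurableSpace Ω] {N : List ℕ → Ω → ℕ∞}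
    {X : List ℕ → Ω → ℕ → ℝ} : ∀ {u : List ℕ}, (∀ v : List ℕ, v.length < u.length →
      Measurable (offspring N X v)) → Measurable (position X u)
  | [], _ => (measurable_const : Measurable fun _ : Ω => (0 : ℝ))
  | i :: u, h => by
    change Measurable fun ω => position X u ω + X u ω i
    refine (measurable_position (u := u) fun v hv => h v (hv.trans (by simp))).add ?_
    exact (measurable_pi_apply i).comp (h u (by simp)).snd

theorem measurable_genSum [MeasurableSpace Ω] {N : List ℕ → Ω → ℕ∞}
    {X : List ℕ → Ω → ℕ → ℝ} {n : ℕ} (h : ∀ v : List ℕ, v.length < n →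
      Measurable (offspring N X v)) {f : ℝ → ℝ≥0∞} (hf : Measurable f) :
    Measurable (genSum N X f n) := by
  classical
  refine Measurable.tsum fun u => ?_
  have h' (v : List ℕ) (hv : v.length < u.1.length) : Measurable (offspring N X v) :=
    h v (by rwa [u.2] at hv)
  exact Measurable.ite (measurableSet_isAlive h') (hf.comp (measurable_position h'))
    measurable_const

open Classical in
/-- The sum of `exp (t S)` over the children in a realisation of the offspring. -/
noncomputable def childSum (t : ℝ) (p : Offspring) : ℝ≥0∞ :=
  ∑' i : ℕ, if (i : ℕ∞) < p.1 then ENNReal.ofReal (Real.exp (t * p.2 i)) else 0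

theorem measurable_childSum (t : ℝ) : Measurable (childSum t) := by
  classical
  refine Measurable.tsum fun i => Measurable.ite ?_ ?_ measurable_const
  · exact measurable_fst (MeasurableSet.of_discrete (s := Set.Ioi (i : ℕ∞)))
  · fun_prop

theorem genSum_exp_succ {N : List ℕ → Ω → ℕ∞} {X : List ℕ → Ω → ℕ → ℝ} (t : ℝ)
    (n : ℕ) (ω : Ω) :
    genSum N X (fun s => ENNReal.ofReal (Real.exp (t * s))) (n + 1) ω =
      ∑' u : Words n, (open Classical in
        if IsAlive N u.1 ω then ENNReal.ofReal (Real.exp (t * position X u.1 ω)) else 0) *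
        childSum t (offspring N X u.1 ω) := by
  classical
  rw [genSum, ← (wordsSuccEquiv n).tsum_eq, ENNReal.tsum_prod']
  refine tsum_congr fun u => ?_
  rw [childSum, ← ENNReal.tsum_mul_left]
  refine tsum_congr fun i => ?_
  simp only [wordsSuccEquiv, Equiv.coe_fn_mk, IsAlive, position, mul_add, Real.exp_add]
  by_cases h1 : IsAlive N u.1 ω <;> by_cases h2 : (i : ℕ∞) < N u.1 ω <;>
    simp [h1, h2, ENNReal.ofReal_mul, (Real.exp_pos _).le]

end Generation

section BranchingRandomWalk

variable {Ω : Type*} [mΩ : MeasurableSpace Ω] {P : Measure Ω} {η : Measure Offspring}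
  {N : List ℕ → Ω → ℕ∞} {X : List ℕ → Ω → ℕ → ℝ}

/-- The σ-algebra generated by the first `n` generations. -/
def generationFiltration (hm : ∀ u, Measurable (offspring N X u)) : Filtration ℕ mΩ where
  seq n := ⨆ u ∈ {u : List ℕ | u.length < n}, MeasurableSpace.comap (offspring N X u) inferInstance
  mono' _ _ h := biSup_mono fun _ hu => lt_of_lt_of_le hu h
  le' _ := iSup₂_le fun u _ => (hm u).comap_le

theorem measurable_offspring_generationFiltration (hm : ∀ u, Measurable (offspring N X u)) {n : ℕ}
    {u : List ℕ} (hu : u.length < n) : Measurable[generationFiltration hm n] (offspring N X u) :=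
  Measurable.of_comap_le
    (le_biSup (fun u => MeasurableSpace.comap (offspring N X u) inferInstance) hu)

theorem indep_generationFiltration (hB : IsBranchingRandomWalk P η N X)
    (hm : ∀ u, Measurable (offspring N X u)) (u : List ℕ) :
    Indep (generationFiltration hm u.length)
      (MeasurableSpace.comap (offspring N X u) inferInstance) P := by
  have h := indep_iSup_of_disjoint (S := {v : List ℕ | v.length < u.length}) (T := {u})
    (fun v => (hm v).comap_le) hB.indep (by simp)
  rwa [iSup_singleton] at h

theorem setLIntegral_genSum_exp_succ (hB : IsBranchingRandomWalk P η N X)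
    (hm : ∀ u, Measurable (offspring N X u)) (t : ℝ) (n : ℕ) {A : Set Ω}
    (hA : MeasurableSet[generationFiltration hm n] A) :
    ∫⁻ ω in A, genSum N X (fun s => ENNReal.ofReal (Real.exp (t * s))) (n + 1) ω ∂P =
      (∫⁻ ω in A, genSum N X (fun s => ENNReal.ofReal (Real.exp (t * s))) n ω ∂P) *
        laplaceTransform η t := by
  classical
  have hle := (generationFiltration hm).le n
  have hA' : MeasurableSet A := hle A hA
  have hmeas (u : Words n) : Measurable[generationFiltration hm n] fun ω =>
      if IsAlive N u.1 ω then ENNReal.ofReal (Real.exp (t * position X u.1 ω)) else 0 := by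
    have h (v : List ℕ) (hv : v.length < u.1.length) :
        Measurable[generationFiltration hm n] (offspring N X v) :=
      measurable_offspring_generationFiltration hm (by rwa [u.2] at hv)
    refine Measurable.ite (@measurableSet_isAlive _ (generationFiltration hm n) _ _ _ h) ?_
      measurable_const
    have := @measurable_position _ (generationFiltration hm n) _ _ _ h
    exact (this.const_mul t).exp.ennreal_ofReal
  have hchild (u : List ℕ) : Measurable fun ω => childSum t (offspring N X u ω) :=
    (measurable_childSum t).comp (hm u)
  simp only [genSum_exp_succ]
  rw [lintegral_tsum fun u =>
    (((hmeas u).mono hle le_rfl).fun_mul (hchild u)).aemeasurable]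
  simp only [genSum]
  rw [lintegral_tsum fun u => ((hmeas u).mono hle le_rfl).aemeasurable, ← ENNReal.tsum_mul_right]
  refine tsum_congr fun u => ?_
  have hind := indep_generationFiltration hB hm u.1
  rw [u.2] at hind
  have h1 := lintegral_mul_eq_lintegral_mul_lintegral_of_independent_measurableSpace hle
    (hm u.1).comap_le hind ((hmeas u).indicator hA)
    ((measurable_childSum t).comp (comap_measurable (offspring N X u.1)))
  rw [← lintegral_indicator hA', ← lintegral_indicator hA']
  have h2 : ∫⁻ ω, (childSum t ∘ offspring N X u.1) ω ∂P = laplaceTransform η t :=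
    (hB.hasLaw u.1).lintegral_comp (measurable_childSum t).aemeasurable
  rw [← h2, ← h1]
  refine lintegral_congr fun ω => ?_
  by_cases hω : ω ∈ A <;> simp [hω]

/-- The many-to-one formula for exponentials. -/
theorem lintegral_genSum_exp [IsProbabilityMeasure P] (hB : IsBranchingRandomWalk P η N X)
    (hm : ∀ u, Measurable (offspring N X u)) (t : ℝ) (n : ℕ) :
    ∫⁻ ω, genSum N X (fun s => ENNReal.ofReal (Real.exp (t * s))) n ω ∂P =
      laplaceTransform η t ^ n := by
  induction n with
  | zero =>
    have h (ω : Ω) : genSum N X (fun s => ENNReal.ofReal (Real.exp (t * s))) 0 ω = 1 := by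
      classical
      rw [genSum, tsum_eq_single ⟨[], rfl⟩]
      · simp [IsAlive, position]
      · rintro ⟨u, hu⟩ h
        exact absurd (Subtype.ext (List.length_eq_zero_iff.mp hu)) h
    simp [h]
  | succ n ih =>
    have := setLIntegral_genSum_exp_succ hB hm t n (A := Set.univ) MeasurableSet.univ
    simp only [Measure.restrict_univ] at this
    rw [this, ih, pow_succ]

theorem lintegral_genSum_exp_sub [IsProbabilityMeasure P] (hB : IsBranchingRandomWalk P η N X)
    (hm : ∀ u, Measurable (offspring N X u)) (t c : ℝ) (n : ℕ) :
    ∫⁻ ω, genSum N X (fun s => ENNReal.ofReal (Real.exp (t * s - c))) n ω ∂P =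
      ENNReal.ofReal (Real.exp (-c)) * laplaceTransform η t ^ n := by
  have h (s : ℝ) : ENNReal.ofReal (Real.exp (t * s - c)) =
      ENNReal.ofReal (Real.exp (-c)) * ENNReal.ofReal (Real.exp (t * s)) := by
    rw [← ENNReal.ofReal_mul (Real.exp_pos _).le, ← Real.exp_add]
    ring_nf
  simp only [h, genSum_const_mul]
  rw [lintegral_const_mul _ (measurable_genSum (fun v _ => hm v) (by fun_prop)),
    lintegral_genSum_exp hB hm]

/-! ### The log-Laplace transform -/

theorem exp_kappaReal {t : ℝ} (h0 : laplaceTransform η t ≠ 0) (h : laplaceTransform η t ≠ ∞) :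
    ENNReal.ofReal (Real.exp (kappaReal η t)) = laplaceTransform η t := by
  have hpos : 0 < (laplaceTransform η t).toReal := ENNReal.toReal_pos h0 h
  rw [kappaReal, kappa, ENNReal.log_pos_real' hpos, EReal.toReal_coe, Real.exp_log hpos,
    ENNReal.ofReal_toReal h]

theorem laplaceTransform_ne_zero (h : IsSupercritical η) (t : ℝ) : laplaceTransform η t ≠ 0 := by
  intro h0
  have h1 := (lintegral_eq_zero_iff (measurable_childSum t)).mp h0
  have h2 : ∫⁻ p : Offspring, (p.1 : ℝ≥0∞) ∂η = 0 := by
    refine (lintegral_congr_ae ?_).trans lintegral_zero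
    filter_upwards [h1] with p hp
    have h3 := ENNReal.tsum_eq_zero.mp hp 0
    by_contra hne
    have : (0 : ℕ∞) < p.1 := by
      rw [pos_iff_ne_zero]
      rintro h
      simp [h] at hne
    simp [this] at h3
    exact absurd (Real.exp_pos _) h3.not_gt
  rw [IsSupercritical, h2] at h
  exact absurd h (by simp)

theorem ofReal_exp_mul_laplaceTransform_pow {t : ℝ} (h0 : laplaceTransform η t ≠ 0)
    (h : laplaceTransform η t ≠ ∞) (n : ℕ) :
    ENNReal.ofReal (Real.exp (-(n * kappaReal η t))) * laplaceTransform η t ^ n = 1 := by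
  rw [← exp_kappaReal h0 h, ← ENNReal.ofReal_pow (Real.exp_pos _).le, ← Real.exp_nat_mul,
    ← ENNReal.ofReal_mul (Real.exp_pos _).le, ← Real.exp_add]
  simp

/-! ### The additive martingale -/

/-- The additive martingale with values in `[0, ∞]`. -/
noncomputable def additiveSum (η : Measure Offspring) (N : List ℕ → Ω → ℕ∞)
    (X : List ℕ → Ω → ℕ → ℝ) (θ : ℝ) (n : ℕ) (ω : Ω) : ℝ≥0∞ :=
  genSum N X (fun s => ENNReal.ofReal (Real.exp (θ * s - n * kappaReal η θ))) n ω

theorem setLIntegral_additiveSum_succ (hB : IsBranchingRandomWalk P η N X)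
    (hm : ∀ u, Measurable (offspring N X u)) {θ : ℝ} (h0 : laplaceTransform η θ ≠ 0)
    (h : laplaceTransform η θ ≠ ∞) (n : ℕ) {A : Set Ω}
    (hA : MeasurableSet[generationFiltration hm n] A) :
    ∫⁻ ω in A, additiveSum η N X θ (n + 1) ω ∂P = ∫⁻ ω in A, additiveSum η N X θ n ω ∂P := by
  have he (k : ℕ) (s : ℝ) : ENNReal.ofReal (Real.exp (θ * s - k * kappaReal η θ)) =
      ENNReal.ofReal (Real.exp (-(k * kappaReal η θ))) * ENNReal.ofReal (Real.exp (θ * s)) := by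
    rw [← ENNReal.ofReal_mul (Real.exp_pos _).le, ← Real.exp_add]
    ring_nf
  simp only [additiveSum, he, genSum_const_mul]
  rw [lintegral_const_mul _ (measurable_genSum (fun v _ => hm v) (by fun_prop)),
    lintegral_const_mul _ (measurable_genSum (fun v _ => hm v) (by fun_prop)),
    setLIntegral_genSum_exp_succ hB hm θ n hA, mul_comm _ (laplaceTransform η θ), ← mul_assoc]
  congr 1
  rw [← exp_kappaReal h0 h, ← ENNReal.ofReal_mul (Real.exp_pos _).le, ← Real.exp_add]
  congr 2
  push_cast
  ring

theorem lintegral_additiveSum [IsProbabilityMeasure P] (hB : IsBranchingRandomWalk P η N X)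
    (hm : ∀ u, Measurable (offspring N X u)) {θ : ℝ} (h0 : laplaceTransform η θ ≠ 0)
    (h : laplaceTransform η θ ≠ ∞) (n : ℕ) : ∫⁻ ω, additiveSum η N X θ n ω ∂P = 1 := by
  simp only [additiveSum]
  rw [lintegral_genSum_exp_sub hB hm, ofReal_exp_mul_laplaceTransform_pow h0 h]

/-- The additive martingale converges almost surely. -/
theorem ae_tendsto_additiveMartingale [IsProbabilityMeasure P] (hB : IsBranchingRandomWalk P η N X)
    (hm : ∀ u, Measurable (offspring N X u)) {θ : ℝ} (h0 : laplaceTransform η θ ≠ 0)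
    (h : laplaceTransform η θ ≠ ∞) :
    ∀ᵐ ω ∂P, Tendsto (fun n => additiveMartingale η N X θ n ω) atTop
      (𝓝 (additiveLimit η N X θ ω)) := by
  have hreal (n : ℕ) : additiveMartingale η N X θ n =
      fun ω => (additiveSum η N X θ n ω).toReal := by
    ext ω
    exact additiveMartingale_eq_toReal η N X θ n ω
  have hmeas (n : ℕ) : Measurable (additiveSum η N X θ n) :=
    measurable_genSum (fun v _ => hm v) (by fun_prop)
  have hfin (n : ℕ) : ∫⁻ ω, additiveSum η N X θ n ω ∂P ≠ ∞ := by
    rw [lintegral_additiveSum hB hm h0 h]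
    simp
  have hmart : Martingale (additiveMartingale η N X θ) (generationFiltration hm) P := by
    refine martingale_of_setIntegral_eq_succ (fun n => ?_) (fun n => ?_) fun n A hA => ?_
    · rw [hreal]
      refine Measurable.stronglyMeasurable (Measurable.ennreal_toReal ?_)
      exact @measurable_genSum _ (generationFiltration hm n) _ _ _
        (fun v hv => measurable_offspring_generationFiltration hm hv) _ (by fun_prop)
    · rw [hreal]
      exact integrable_toReal_of_lintegral_ne_top (hmeas n).aemeasurable (hfin n)
    · have hA' := (generationFiltration hm).le n A hA
      rw [hreal, hreal, integral_toReal (hmeas n).aemeasurable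
        (ae_restrict_of_ae (ae_lt_top (hmeas n) (hfin n))),
        integral_toReal (hmeas _).aemeasurable
        (ae_restrict_of_ae (ae_lt_top (hmeas _) (hfin _))),
        setLIntegral_additiveSum_succ hB hm h0 h n hA]
  have hconv := hmart.submartingale.exists_ae_tendsto_of_bdd (R := 1) fun n => by
    rw [eLpNorm_one_eq_lintegral_enorm, hreal, ENNReal.coe_one,
      ← lintegral_additiveSum hB hm h0 h n]
    refine lintegral_mono fun ω => ?_
    rw [Real.enorm_of_nonneg ENNReal.toReal_nonneg]
    exact ENNReal.ofReal_toReal_le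
  filter_upwards [hconv] with ω hω
  exact tendsto_nhds_limUnder hω

/-! ### The derivative of the log-Laplace transform -/

/-- The intensity measure of the point process of children, before forgetting the labels. -/
noncomputable def childIntensity (η : Measure Offspring) : Measure (Offspring × ℕ) :=
  (η.prod Measure.count).restrict {p | (p.2 : ℕ∞) < p.1.1}

/-- The displacement of a child. -/
def displacement (p : Offspring × ℕ) : ℝ := p.1.2 p.2

theorem measurable_displacement : Measurable displacement := by
  refine measurable_from_prod_countable_left fun i => ?_
  exact (measurable_pi_apply i).comp measurable_snd

theorem measurableSet_childIntensity :
    MeasurableSet {p : Offspring × ℕ | (p.2 : ℕ∞) < p.1.1} := by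
  have : Measurable fun p : Offspring × ℕ => (p.2, p.1.1) := by fun_prop
  exact this (MeasurableSet.of_discrete (s := {q : ℕ × ℕ∞ | (q.1 : ℕ∞) < q.2}))

theorem lintegral_childIntensity [SFinite η] {f : Offspring × ℕ → ℝ≥0∞} (hf : Measurable f) :
    ∫⁻ p, f p ∂childIntensity η = ∫⁻ p, ∑' i : ℕ, (open Classical in
      if (i : ℕ∞) < p.1 then f (p, i) else 0) ∂η := by
  classical
  rw [childIntensity, ← lintegral_indicator measurableSet_childIntensity,
    lintegral_prod _ (hf.indicator measurableSet_childIntensity).aemeasurable]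
  refine lintegral_congr fun p => ?_
  rw [lintegral_count]
  exact tsum_congr fun i => by simp [Set.indicator]

theorem integral_childIntensity [SFinite η] {f : Offspring × ℕ → ℝ}
    (hf : Integrable f (childIntensity η)) :
    ∫ p, f p ∂childIntensity η = ∫ p, ∑' i : ℕ, (open Classical in
      if (i : ℕ∞) < p.1 then f (p, i) else 0) ∂η := by
  classical
  have hf' := (integrable_indicator_iff measurableSet_childIntensity).mpr hf
  rw [childIntensity, ← integral_indicator measurableSet_childIntensity, integral_prod _ hf']
  refine integral_congr_ae ?_
  filter_upwards [hf'.prod_right_ae] with p hp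
  rw [integral_countable hp]
  exact tsum_congr fun i => by simp [Set.indicator, measureReal_def]

theorem lintegral_exp_displacement [SFinite η] (t : ℝ) :
    ∫⁻ p, ENNReal.ofReal (Real.exp (t * displacement p)) ∂childIntensity η =
      laplaceTransform η t :=
  lintegral_childIntensity ((measurable_displacement.const_mul t).exp.ennreal_ofReal)

theorem mem_integrableExpSet_iff [SFinite η] (t : ℝ) :
    t ∈ integrableExpSet displacement (childIntensity η) ↔ laplaceTransform η t < ∞ := by
  have hm : Measurable fun p => Real.exp (t * displacement p) :=
    (measurable_displacement.const_mul t).exp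
  rw [← lintegral_exp_displacement, integrableExpSet, Set.mem_ofPred_eq, Integrable,
    and_iff_right hm.aestronglyMeasurable, hasFiniteIntegral_iff_ofReal
      (ae_of_all _ fun p => (Real.exp_pos _).le)]

theorem mgf_displacement [SFinite η] (t : ℝ) :
    mgf displacement (childIntensity η) t = (laplaceTransform η t).toReal := by
  rw [mgf, integral_eq_lintegral_of_nonneg_ae (ae_of_all _ fun p => (Real.exp_pos _).le)
    (measurable_displacement.const_mul t).exp.aestronglyMeasurable, lintegral_exp_displacement]

theorem hasDerivAt_kappaReal [SFinite η] {θ δ : ℝ} (hδ : 0 < δ) (h0 : laplaceTransform η θ ≠ 0)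
    (h1 : laplaceTransform η (θ + δ) < ∞) (h2 : laplaceTransform η (θ - δ) < ∞) :
    HasDerivAt (fun t => Real.log (laplaceTransform η t).toReal) (kappaDeriv η θ) θ := by
  classical
  have hmem : θ ∈ interior (integrableExpSet displacement (childIntensity η)) := by
    refine mem_interior_iff_mem_nhds.mpr (mem_of_superset
      (Icc_mem_nhds (show θ - δ < θ by linarith) (show θ < θ + δ by linarith)) ?_)
    exact (convex_integrableExpSet).ordConnected.out ((mem_integrableExpSet_iff _).mpr h2)
      ((mem_integrableExpSet_iff _).mpr h1)
  have hfin : laplaceTransform η θ ≠ ∞ :=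
    ((mem_integrableExpSet_iff _).mp (interior_subset hmem)).ne
  have hpos : 0 < (laplaceTransform η θ).toReal := ENNReal.toReal_pos h0 hfin
  have hd := hasDerivAt_mgf hmem
  have heq : mgf displacement (childIntensity η) = fun t => (laplaceTransform η t).toReal :=
    funext mgf_displacement
  rw [heq] at hd
  have := hd.log hpos.ne'
  convert! this using 1
  have hint : Integrable (fun p => displacement p * Real.exp (θ * displacement p))
      (childIntensity η) := by
    simpa using integrable_pow_mul_exp_of_mem_interior_integrableExpSet hmem 1
  have hk : kappaReal η θ = Real.log (laplaceTransform η θ).toReal := by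
    rw [kappaReal, kappa, ENNReal.log_pos_real' hpos, EReal.toReal_coe]
  have hexp (x : ℝ) : x * Real.exp (θ * x - kappaReal η θ) =
      x * Real.exp (θ * x) / (laplaceTransform η θ).toReal := by
    rw [Real.exp_sub, hk, Real.exp_log hpos, mul_div_assoc]
  rw [kappaDeriv, integral_childIntensity hint, ← integral_div]
  refine integral_congr_ae (ae_of_all _ fun p => ?_)
  simp only
  rw [← tsum_div_const]
  refine tsum_congr fun i => ?_
  split_ifs
  · exact hexp _
  · simp

/-- Exponential moments of the tilted displacement, centred at `κ'(θ)`, close to `0`. -/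
theorem exists_laplaceTransform_le [SFinite η] {θ δ : ℝ} (hδ : 0 < δ)
    (h0 : ∀ t, laplaceTransform η t ≠ 0) (h1 : laplaceTransform η (θ + δ) < ∞)
    (h2 : laplaceTransform η (θ - δ) < ∞) {ε : ℝ} (hε : 0 < ε) :
    ∃ t > 0,
      laplaceTransform η (θ + t) ≤
        ENNReal.ofReal (Real.exp (kappaReal η θ + t * kappaDeriv η θ + ε * t)) ∧
      laplaceTransform η (θ - t) ≤
        ENNReal.ofReal (Real.exp (kappaReal η θ - t * kappaDeriv η θ + ε * t)) := by
  have hfin (t : ℝ) (ht : t ∈ Set.Icc (θ - δ) (θ + δ)) : laplaceTransform η t < ∞ :=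
    (mem_integrableExpSet_iff _).mp ((convex_integrableExpSet).ordConnected.out
      ((mem_integrableExpSet_iff _).mpr h2) ((mem_integrableExpSet_iff _).mpr h1) ht)
  have hd := (hasDerivAt_kappaReal hδ (h0 θ) h1 h2).isLittleO.bound hε
  obtain ⟨r, hr, hball⟩ := Metric.eventually_nhds_iff.mp hd
  set t := min (r / 2) δ
  have ht : 0 < t := lt_min (half_pos hr) hδ
  have htr : t < r := (min_le_left _ _).trans_lt (half_lt_self hr)
  have htδ : t ≤ δ := min_le_right _ _
  have hk : kappaReal η θ = Real.log (laplaceTransform η θ).toReal := by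
    rw [kappaReal, kappa, ENNReal.log_pos_real' (ENNReal.toReal_pos (h0 θ)
      (hfin θ ⟨by linarith, by linarith⟩).ne), EReal.toReal_coe]
  have key (x : ℝ) (hx : |x| = t) : laplaceTransform η (θ + x) ≤
      ENNReal.ofReal (Real.exp (kappaReal η θ + x * kappaDeriv η θ + ε * t)) := by
    have hx' := abs_le.mp hx.le
    have hf := hfin (θ + x) ⟨by linarith, by linarith⟩
    have := hball (y := θ + x) (by rwa [Real.dist_eq, add_sub_cancel_left, hx])
    simp only [add_sub_cancel_left, smul_eq_mul, Real.norm_eq_abs, hx] at this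
    rw [← ENNReal.ofReal_toReal hf.ne, ← Real.exp_log (ENNReal.toReal_pos (h0 _) hf.ne)]
    refine ENNReal.ofReal_le_ofReal (Real.exp_le_exp.mpr ?_)
    rw [hk]
    linarith [(abs_le.mp this).2]
  refine ⟨t, ht, key t (abs_of_pos ht), ?_⟩
  have := key (-t) (by rw [abs_neg, abs_of_pos ht])
  simpa [sub_eq_add_neg] using this

end BranchingRandomWalk

/-! ### The total error of a generation vanishes -/

section Error

variable {Ω : Type*} [MeasurableSpace Ω] {P : Measure Ω} [IsProbabilityMeasure P]
  {η : Measure Offspring} [SFinite η] {N : List ℕ → Ω → ℕ∞} {X : List ℕ → Ω → ℕ → ℝ}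
  {ν : Measure ℝ} [IsProbabilityMeasure ν] {θ δ α : ℝ} {L : ℝ → ℝ}

theorem exp_mul_abs_le (t x : ℝ) : Real.exp (t * |x|) ≤ Real.exp (t * x) + Real.exp (-(t * x)) := by
  rcases abs_choice x with h | h <;> rw [h]
  · linarith [Real.exp_pos (-(t * x))]
  · rw [mul_neg]
    linarith [Real.exp_pos (t * x)]

theorem tendsto_lintegral_genSum_particleError (hB : IsBranchingRandomWalk P η N X)
    (hm : ∀ u, Measurable (offspring N X u)) (hθ : 0 < θ) (hδ : 0 < δ)
    (h0 : ∀ t, laplaceTransform η t ≠ 0) (h1 : laplaceTransform η (θ + δ) < ∞)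
    (h2 : laplaceTransform η (θ - δ) < ∞) (h3 : laplaceTransform η θ ≠ ∞)
    (hb : θ * kappaDeriv η θ - kappaReal η θ < 0) (hL : IsRegularlyVarying L α)
    (hν : (fun x : ℝ => (ν (Set.Ici x)).toReal) ~[atTop] fun x => L x * Real.exp (-θ * x))
    {f : ℝ → ℂ} (hf : Continuous f) (hc : HasCompactSupport f) (hf2 : ∀ x, ‖f x‖ ≤ 2) :
    Tendsto (fun n : ℕ => ∫⁻ ω, genSum N X (fun s => ENNReal.ofReal
      (particleError ν f (centring η θ L n) (Real.exp (θ * s - n * kappaReal η θ))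
        (limitConstant η θ α * ∫ x, f x ∂exponentialIntensity 1 θ) s)) n ω ∂P) atTop (𝓝 0) := by
  set κ := kappaReal η θ with hκ
  set κ' := kappaDeriv η θ with hκ'
  have hb' : 0 < κ / θ - κ' := by
    rw [sub_pos, lt_div_iff₀ hθ]
    linarith
  obtain ⟨r, hr⟩ := hc.isCompact.isBounded.subset_closedBall 0
  have hA (x : ℝ) (hx : x < -r) : f x = 0 := by
    by_contra h
    have := hr (subset_tsupport _ h)
    rw [mem_closedBall_zero_iff, Real.norm_eq_abs] at this
    linarith [(abs_le.mp this).1]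
  refine ENNReal.tendsto_nhds_zero.mpr fun ε' hε' => ?_
  obtain ⟨ε, hε, hεε'⟩ : ∃ ε : ℝ, 0 < ε ∧ ENNReal.ofReal (2 * ε) ≤ ε' := by
    obtain ⟨q, hq0, hq⟩ := ENNReal.lt_iff_exists_nnreal_btwn.mp hε'
    refine ⟨q / 2, half_pos (by exact_mod_cast hq0), ?_⟩
    rw [mul_div_cancel₀ _ two_ne_zero, ENNReal.ofReal_coe_nnreal]
    exact hq.le
  obtain ⟨ε₁, hε₁, hnear⟩ := eventually_particleError_le_of_near hL hν hθ hb' hf hc hε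
  obtain ⟨t, ht, ht1, ht2⟩ := exists_laplaceTransform_le hδ h0 h1 h2 (show 0 < ε₁ / 4 by positivity)
  obtain ⟨C, hC, hfar⟩ := eventually_particleError_le_of_far hL hν hθ hb' hA hf2
    (limitConstant η θ α * ∫ x, f x ∂exponentialIntensity 1 θ) hε₁ ht
  have hdecay : Tendsto (fun n : ℕ => 2 * C * Real.exp (-(t * ε₁ / 4) * n)) atTop (𝓝 0) := by
    have : Tendsto (fun n : ℕ => -(t * ε₁ / 4) * (n : ℝ)) atTop atBot :=
      tendsto_natCast_atTop_atTop.const_mul_atTop_of_neg (by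
        have : 0 < t * ε₁ := by positivity
        linarith)
    simpa using (Real.tendsto_exp_atBot.comp this).const_mul (2 * C)
  filter_upwards [hnear, hfar, hdecay.eventually (gt_mem_nhds hε)] with n hn1 hn2 hn3
  refine le_trans ?_ hεε'
  set D := C * Real.exp (-(t * ε₁ / 2 * n)) with hD
  have hD0 : 0 ≤ D := by positivity
  have hpt (s : ℝ) : ENNReal.ofReal (particleError ν f (centring η θ L n)
      (Real.exp (θ * s - n * κ)) (limitConstant η θ α * ∫ x, f x ∂exponentialIntensity 1 θ) s) ≤
      ENNReal.ofReal ε * ENNReal.ofReal (Real.exp (θ * s - n * κ)) +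
      (ENNReal.ofReal D * ENNReal.ofReal (Real.exp ((θ + t) * s - n * (κ + t * κ'))) +
        ENNReal.ofReal D * ENNReal.ofReal (Real.exp ((θ - t) * s - n * (κ - t * κ')))) := by
    rw [← ENNReal.ofReal_mul hε.le, ← ENNReal.ofReal_mul hD0, ← ENNReal.ofReal_mul hD0,
      ← ENNReal.ofReal_add (by positivity) (by positivity),
      ← ENNReal.ofReal_add (by positivity) (by positivity)]
    refine ENNReal.ofReal_le_ofReal ?_
    rcases le_or_gt |s - n * κ'| (ε₁ * n) with hs | hs
    · refine (hn1 s hs).trans (le_add_of_nonneg_right (by positivity))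
    · refine (hn2 s hs).trans ?_
      have e1 := exp_mul_abs_le t (s - n * κ')
      have e2 : Real.exp ((θ + t) * s - n * (κ + t * κ')) =
          Real.exp (θ * s - n * κ) * Real.exp (t * (s - n * κ')) := by
        rw [← Real.exp_add]
        ring_nf
      have e3 : Real.exp ((θ - t) * s - n * (κ - t * κ')) =
          Real.exp (θ * s - n * κ) * Real.exp (-(t * (s - n * κ'))) := by
        rw [← Real.exp_add]
        ring_nf
      rw [e2, e3, sub_eq_add_neg (t * _), Real.exp_add]
      calc C * (Real.exp (θ * s - n * κ) * (Real.exp (t * |s - n * κ'|) *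
            Real.exp (-(t * ε₁ / 2 * n))))
          = D * Real.exp (θ * s - n * κ) * Real.exp (t * |s - n * κ'|) := by rw [hD]; ring
        _ ≤ D * Real.exp (θ * s - n * κ) *
            (Real.exp (t * (s - n * κ')) + Real.exp (-(t * (s - n * κ')))) := by gcongr
        _ = 0 + (D * (Real.exp (θ * s - n * κ) * Real.exp (t * (s - n * κ'))) +
            D * (Real.exp (θ * s - n * κ) * Real.exp (-(t * (s - n * κ'))))) := by ring
        _ ≤ _ := by gcongr; positivity
  have hmeas (a b : ℝ) : Measurable (genSum N X
      (fun s => ENNReal.ofReal (Real.exp (a * s - b))) n) :=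
    measurable_genSum (fun v _ => hm v) (by fun_prop)
  have hpow {a c : ℝ} (ha : laplaceTransform η a ≤ ENNReal.ofReal (Real.exp (c + ε₁ / 4 * t))) :
      ENNReal.ofReal D * (ENNReal.ofReal (Real.exp (-(n * c))) * laplaceTransform η a ^ n) ≤
        ENNReal.ofReal (C * Real.exp (-(t * ε₁ / 4) * n)) := by
    calc _ ≤ ENNReal.ofReal D * (ENNReal.ofReal (Real.exp (-(n * c))) *
          ENNReal.ofReal (Real.exp (c + ε₁ / 4 * t)) ^ n) := by gcongr
      _ = _ := by
        rw [← ENNReal.ofReal_pow (Real.exp_pos _).le, ← ENNReal.ofReal_mul (Real.exp_pos _).le,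
          ← ENNReal.ofReal_mul hD0, ← Real.exp_nat_mul, ← Real.exp_add, hD, mul_assoc,
          ← Real.exp_add]
        congr 3
        ring
  refine (lintegral_mono fun ω => genSum_mono hpt n ω).trans ?_
  simp only [genSum_add, genSum_const_mul]
  rw [lintegral_add_left ((hmeas _ _).const_mul _), lintegral_add_left ((hmeas _ _).const_mul _),
    lintegral_const_mul _ (hmeas _ _), lintegral_const_mul _ (hmeas _ _),
    lintegral_const_mul _ (hmeas _ _), lintegral_genSum_exp_sub hB hm,
    lintegral_genSum_exp_sub hB hm, lintegral_genSum_exp_sub hB hm,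
    ofReal_exp_mul_laplaceTransform_pow (h0 θ) h3, mul_one]
  refine (add_le_add_right (add_le_add (hpow ht1) (hpow ht2)) _).trans ?_
  rw [← ENNReal.ofReal_add (by positivity) (by positivity),
    ← ENNReal.ofReal_add (by positivity) (by positivity)]
  refine ENNReal.ofReal_le_ofReal ?_
  linarith

end Error

/-! ### Estimates for complex products -/

theorem norm_prod_sub_prod_le_sum {ι : Type*} (s : Finset ι) {a b : ι → ℂ}
    (ha : ∀ i, ‖a i‖ ≤ 1) (hb : ∀ i, ‖b i‖ ≤ 1) :
    ‖∏ i ∈ s, a i - ∏ i ∈ s, b i‖ ≤ ∑ i ∈ s, ‖a i - b i‖ := by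
  classical
  induction s using Finset.induction_on with
  | empty => simp
  | insert i s hi ih =>
    rw [Finset.prod_insert hi, Finset.prod_insert hi, Finset.sum_insert hi,
      show a i * ∏ i ∈ s, a i - b i * ∏ i ∈ s, b i =
        (a i - b i) * ∏ i ∈ s, a i + b i * (∏ i ∈ s, a i - ∏ i ∈ s, b i) by ring]
    refine (norm_add_le _ _).trans (add_le_add ?_ ?_)
    · rw [norm_mul, norm_prod]
      exact mul_le_of_le_one_right (norm_nonneg _)
        (Finset.prod_le_one (fun _ _ => norm_nonneg _) fun i _ => ha i)
    · rw [norm_mul]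
      exact (mul_le_of_le_one_left (norm_nonneg _) (hb i)).trans ih

theorem norm_exp_le_one {z : ℂ} (hz : z.re ≤ 0) : ‖Complex.exp z‖ ≤ 1 := by
  rw [Complex.norm_exp]
  exact Real.exp_le_one_iff.mpr hz

theorem norm_one_add_sub_exp_le {g : ℂ} (h1 : ‖1 + g‖ ≤ 1) :
    ‖1 + g - Complex.exp g‖ ≤ 2 * ‖g‖ ^ 2 := by
  have hre : g.re ≤ 0 := by
    have := (Complex.abs_re_le_norm (1 + g)).trans h1
    rw [Complex.add_re, Complex.one_re] at this
    linarith [(abs_le.mp this).2]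
  rcases le_or_gt ‖g‖ 1 with h | h
  · have := Complex.norm_exp_sub_one_sub_id_le h
    rw [← norm_neg, show -(1 + g - Complex.exp g) = Complex.exp g - 1 - g by ring]
    nlinarith [sq_nonneg ‖g‖]
  · refine (norm_sub_le _ _).trans ?_
    nlinarith [norm_exp_le_one hre]

theorem norm_exp_sub_exp_le {z w : ℂ} (hz : z.re ≤ 0) (hw : w.re ≤ 0) :
    ‖Complex.exp z - Complex.exp w‖ ≤ ‖z - w‖ := by
  have := (convex_halfSpace_re_le 0).norm_image_sub_le_of_norm_hasDerivWithin_le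
    (f := Complex.exp) (f' := Complex.exp) (C := 1)
    (fun x _ => (Complex.hasDerivAt_exp x).hasDerivWithinAt) (fun x hx => norm_exp_le_one hx)
    (show w ∈ {c : ℂ | c.re ≤ 0} from hw) (show z ∈ {c : ℂ | c.re ≤ 0} from hz)
  simpa using this

theorem norm_one_add_sub_exp_le_particleError {ν : Measure ℝ} {f : ℝ → ℂ} {m s w : ℝ} {I : ℂ}
    (h1 : ‖1 + particleMean ν f m s‖ ≤ 1) (hw : 0 ≤ w) (hI : I.re ≤ 0) :
    ‖1 + particleMean ν f m s - Complex.exp (w * I)‖ ≤ particleError ν f m w I s := by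
  have hre : (particleMean ν f m s).re ≤ 0 := by
    have := (Complex.abs_re_le_norm (1 + particleMean ν f m s)).trans h1
    rw [Complex.add_re, Complex.one_re] at this
    linarith [(abs_le.mp this).2]
  have hre' : (w * I).re ≤ 0 := by
    rw [Complex.re_ofReal_mul]
    exact mul_nonpos_of_nonneg_of_nonpos hw hI
  calc _ = ‖(1 + particleMean ν f m s - Complex.exp (particleMean ν f m s)) +
        (Complex.exp (particleMean ν f m s) - Complex.exp (w * I))‖ := by congr 1; ring
    _ ≤ _ := (norm_add_le _ _).trans (add_le_add (norm_one_add_sub_exp_le h1)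
        (norm_exp_sub_exp_le hre hre'))

/-! ### Conditioning on the branching random walk -/

theorem lintegral_comp_of_indepFun {Ω α β : Type*} [MeasurableSpace Ω] [MeasurableSpace α]
    [MeasurableSpace β] {P : Measure Ω} [IsFiniteMeasure P] {A : Ω → α} {B : Ω → β}
    (hA : Measurable A) (hB : Measurable B) (h : IndepFun A B P) {F : α × β → ℝ≥0∞}
    (hF : Measurable F) :
    ∫⁻ ω, F (A ω, B ω) ∂P = ∫⁻ ω, ∫⁻ ω', F (A ω, B ω') ∂P ∂P := by
  have h1 := h.map_prod_eq_prod_map_map hA.aemeasurable hB.aemeasurable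
  rw [← lintegral_map hF (hA.prodMk hB), h1, lintegral_prod _ hF.aemeasurable,
    lintegral_map hF.lintegral_prod_right' hA]
  refine lintegral_congr fun ω => ?_
  rw [lintegral_map (by fun_prop) hB]

theorem integral_comp_of_indepFun {Ω α β : Type*} [MeasurableSpace Ω] [MeasurableSpace α]
    [MeasurableSpace β] {P : Measure Ω} [IsFiniteMeasure P] {A : Ω → α} {B : Ω → β}
    (hA : Measurable A) (hB : Measurable B) (h : IndepFun A B P) {F : α × β → ℂ}
    (hF : Measurable F) (hF1 : ∀ p, ‖F p‖ ≤ 1) :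
    ∫ ω, F (A ω, B ω) ∂P = ∫ ω, ∫ ω', F (A ω, B ω') ∂P ∂P := by
  have h1 := h.map_prod_eq_prod_map_map hA.aemeasurable hB.aemeasurable
  rw [← integral_map (hA.prodMk hB).aemeasurable hF.aestronglyMeasurable, h1,
    integral_prod _ (Integrable.of_bound hF.aestronglyMeasurable 1 (ae_of_all _ hF1)),
    integral_map hA.aemeasurable
      hF.stronglyMeasurable.integral_prod_right'.aestronglyMeasurable]
  congr with ω
  rw [integral_map hB.aemeasurable (Measurable.aestronglyMeasurable (by fun_prop))]

/-- The particles alive at generation `n` and their positions. -/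
def genState {Ω : Type*} (N : List ℕ → Ω → ℕ∞) (X : List ℕ → Ω → ℕ → ℝ) (n : ℕ) (ω : Ω) :
    Words n → Prop × ℝ :=
  fun u => (IsAlive N u.1 ω, position X u.1 ω)

theorem measurable_genState {Ω : Type*} [MeasurableSpace Ω] {N : List ℕ → Ω → ℕ∞}
    {X : List ℕ → Ω → ℕ → ℝ} (h : ∀ v, Measurable (offspring N X v)) (n : ℕ) :
    Measurable (genState N X n) :=
  measurable_pi_lambda _ fun _ => Measurable.prodMk
    (measurableSet_setOfPred.mp (measurableSet_isAlive fun v _ => h v))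
    (measurable_position fun v _ => h v)

section Conditioning

variable {Ω : Type*} [MeasurableSpace Ω] {P : Measure Ω} {N : List ℕ → Ω → ℕ∞}
  {X : List ℕ → Ω → ℕ → ℝ} {Y : List ℕ → Ω → ℝ} {ν : Measure ℝ}

theorem indepFun_genState (hP : IsPerturbation P ν N X Y) (n : ℕ) :
    IndepFun (genState N X n) (fun ω u => Y u ω) P := by
  refine indep_of_indep_of_le_left hP.indep_walk (Measurable.comap_le ?_)
  refine @measurable_genState _ (MeasurableSpace.comap (fun ω u => offspring N X u ω) inferInstance)
    _ _ (fun v => ?_) n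
  exact (measurable_pi_apply v).comp (comap_measurable fun ω u => offspring N X u ω)

open Classical in
theorem integral_exp_sum_words [IsProbabilityMeasure P] (hm : ∀ u, Measurable (offspring N X u))
    (hYm : ∀ u, Measurable (Y u)) (hP : IsPerturbation P ν N X Y) {ψ : ℝ → ℝ}
    (hψ : Measurable ψ) (m : ℝ) {n : ℕ} (F : Finset (Words n)) :
    ∫ ω, Complex.exp ((∑ u ∈ F, if IsAlive N u.1 ω then ψ (position X u.1 ω + Y u.1 ω - m) else 0 :
      ℝ) * Complex.I) ∂P = ∫ ω, ∏ u ∈ F, (if IsAlive N u.1 ω then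
        1 + particleMean ν (fun x => Complex.exp (ψ x * Complex.I) - 1) m (position X u.1 ω)
        else 1) ∂P := by
  have hνP : IsProbabilityMeasure ν := (hP.hasLaw []).isProbabilityMeasure_iff.mp inferInstance
  let G (u : Words n) (a : Prop × ℝ) (y : ℝ) : ℂ :=
    if a.1 then Complex.exp (ψ (a.2 + y - m) * Complex.I) else 1
  have hG (u : Words n) : Measurable fun p : (Prop × ℝ) × ℝ => G u p.1 p.2 :=
    Measurable.ite (measurableSet_setOfPred.mpr (measurable_fst.comp measurable_fst))
      (by fun_prop) measurable_const
  have hG1 (u : Words n) (a : Prop × ℝ) (y : ℝ) : ‖G u a y‖ ≤ 1 := by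
    simp only [G]
    split_ifs
    · rw [Complex.norm_exp_ofReal_mul_I]
    · simp
  have hYm' : Measurable fun ω u => Y u ω := measurable_pi_lambda _ hYm
  have h1 := integral_comp_of_indepFun (measurable_genState hm n) hYm' (indepFun_genState hP n)
    (F := fun p : (Words n → Prop × ℝ) × (List ℕ → ℝ) => ∏ u ∈ F, G u (p.1 u) (p.2 u.1))
    (Finset.measurable_prod _ fun u _ => (hG u).comp
      (show Measurable fun p : (Words n → Prop × ℝ) × (List ℕ → ℝ) => (p.1 u, p.2 u.1) by fun_prop))
    fun p => by
      rw [norm_prod]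
      exact Finset.prod_le_one (fun _ _ => norm_nonneg _) fun u _ => hG1 u _ _
  refine Eq.trans ?_ (h1.trans ?_)
  · congr with ω
    rw [Complex.ofReal_sum, Finset.sum_mul, Complex.exp_sum]
    refine Finset.prod_congr rfl fun u _ => ?_
    simp only [G, genState]
    split_ifs <;> simp
  · congr with ω
    have hind := hP.indep.precomp (g := fun u : Words n => u.1) Subtype.val_injective
    have h2 := integral_finset_prod_of_iIndepFun (f := fun u y => G u (genState N X n ω u) y)
      hind (fun u => hYm u.1) (fun u => (hG u).comp measurable_prodMk_left) F
    refine h2.trans (Finset.prod_congr rfl fun u _ => ?_)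
    simp only [G, genState]
    split_ifs with hu
    · have hint : Integrable (fun y => Complex.exp (ψ (position X u.1 ω + y - m) * Complex.I)) ν :=
        Integrable.of_bound (Measurable.aestronglyMeasurable (by fun_prop)) 1
          (ae_of_all _ fun y => by rw [Complex.norm_exp_ofReal_mul_I])
      rw [particleMean, integral_sub hint (integrable_const _)]
      have h3 := (hP.hasLaw u.1).integral_comp hint.aestronglyMeasurable
      simp only [Function.comp_def] at h3
      simp [h3]
    · simp

theorem measurable_particleMean [SFinite ν] {f : ℝ → ℂ} (hf : Measurable f) (m : ℝ) :
    Measurable (particleMean ν f m) :=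
  (StronglyMeasurable.integral_prod_right (f := fun s y => f (s + y - m))
    (Measurable.stronglyMeasurable (by simp only [Function.uncurry_def]; fun_prop))).measurable

theorem norm_one_add_particleMean_le [IsProbabilityMeasure ν] {ψ : ℝ → ℝ} (hψ : Measurable ψ)
    (m s : ℝ) :
    ‖1 + particleMean ν (fun x => Complex.exp (ψ x * Complex.I) - 1) m s‖ ≤ 1 := by
  have hint : Integrable (fun y => Complex.exp (ψ (s + y - m) * Complex.I)) ν :=
    Integrable.of_bound (Measurable.aestronglyMeasurable (by fun_prop)) 1 (ae_of_all _ fun y => by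
      rw [Complex.norm_exp_ofReal_mul_I])
  rw [particleMean, integral_sub hint (integrable_const _)]
  simp only [integral_const, probReal_univ, one_smul, add_sub_cancel]
  refine (norm_integral_le_of_norm_le_const (C := 1) (ae_of_all _ fun y => ?_)).trans ?_
  · rw [Complex.norm_exp_ofReal_mul_I]
  · simp

/-- Comparison of the characteristic functional of generation `n`, restricted to finitely many
words, with its limit. -/
theorem enorm_integral_prod_sub_le [IsProbabilityMeasure P] [IsProbabilityMeasure ν]
    (hm : ∀ u, Measurable (offspring N X u)) {ψ : ℝ → ℝ} (hψ : Measurable ψ) (m : ℝ) {n : ℕ}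
    {w : ℝ → ℝ} (hw : Measurable w) (hw0 : ∀ s, 0 ≤ w s) {J : ℂ} (hJ : J.re ≤ 0)
    (F : Finset (Words n)) : (open Classical in
    ‖∫ ω, ∏ u ∈ F, (if IsAlive N u.1 ω then
        1 + particleMean ν (fun x => Complex.exp (ψ x * Complex.I) - 1) m (position X u.1 ω)
        else 1) ∂P - ∫ ω, Complex.exp ((∑ u ∈ F, if IsAlive N u.1 ω then
          w (position X u.1 ω) else 0 : ℝ) * J) ∂P‖ₑ) ≤
      ∫⁻ ω, genSum N X (fun s => ENNReal.ofReal (particleError ν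
        (fun x => Complex.exp (ψ x * Complex.I) - 1) m (w s) J s)) n ω ∂P := by
  classical
  have hal (u : Words n) : MeasurableSet {ω | IsAlive N u.1 ω} :=
    measurableSet_isAlive fun v _ => hm v
  have hpos (u : Words n) : Measurable (position X u.1) := measurable_position fun v _ => hm v
  have hnorm := norm_one_add_particleMean_le (ν := ν) hψ m
  set f : ℝ → ℂ := fun x => Complex.exp (ψ x * Complex.I) - 1 with hf
  have hfm : Measurable f := by fun_prop
  have hM := measurable_particleMean (ν := ν) hfm m
  set a : Words n → Ω → ℂ := fun u ω =>
    if IsAlive N u.1 ω then 1 + particleMean ν f m (position X u.1 ω) else 1 with ha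
  set b : Words n → Ω → ℂ := fun u ω =>
    if IsAlive N u.1 ω then Complex.exp (w (position X u.1 ω) * J) else 1 with hb
  have ham (u) : Measurable (a u) :=
    Measurable.ite (hal u) ((hM.comp (hpos u)).const_add 1) measurable_const
  have hbm (u) : Measurable (b u) :=
    Measurable.ite (hal u) (by have := hw.comp (hpos u); fun_prop) measurable_const
  have ha1 (u ω) : ‖a u ω‖ ≤ 1 := by
    simp only [ha]
    split_ifs
    · exact hnorm _
    · simp
  have hb1 (u ω) : ‖b u ω‖ ≤ 1 := by
    simp only [hb]
    split_ifs
    · refine norm_exp_le_one ?_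
      rw [Complex.re_ofReal_mul]
      exact mul_nonpos_of_nonneg_of_nonpos (hw0 _) hJ
    · simp
  have hprod (c : Words n → Ω → ℂ) (hc : ∀ u, Measurable (c u)) (hc1 : ∀ u ω, ‖c u ω‖ ≤ 1) :
      Integrable (fun ω => ∏ u ∈ F, c u ω) P := by
    refine Integrable.of_bound (Finset.measurable_prod _ fun u _ => hc u).aestronglyMeasurable 1
      (ae_of_all _ fun ω => ?_)
    rw [norm_prod]
    exact Finset.prod_le_one (fun _ _ => norm_nonneg _) fun u _ => hc1 u ω
  have hexp (ω : Ω) : Complex.exp ((∑ u ∈ F, if IsAlive N u.1 ω then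
      w (position X u.1 ω) else 0 : ℝ) * J) = ∏ u ∈ F, b u ω := by
    rw [Complex.ofReal_sum, Finset.sum_mul, Complex.exp_sum]
    refine Finset.prod_congr rfl fun u _ => ?_
    simp only [hb]
    split_ifs <;> simp
  simp only [hexp]
  rw [← integral_sub (hprod a ham ha1) (hprod b hbm hb1)]
  refine (enorm_integral_le_lintegral_enorm _).trans (lintegral_mono fun ω => ?_)
  have h1 := norm_prod_sub_prod_le_sum F (fun u => ha1 u ω) (fun u => hb1 u ω)
  rw [← ofReal_norm]
  refine (ENNReal.ofReal_le_ofReal h1).trans ?_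
  rw [ENNReal.ofReal_sum_of_nonneg fun _ _ => norm_nonneg _, genSum]
  refine (Finset.sum_le_sum fun u _ => ?_).trans (ENNReal.sum_le_tsum F)
  simp only [ha, hb]
  split_ifs
  · exact ENNReal.ofReal_le_ofReal
      (norm_one_add_sub_exp_le_particleError (hnorm _) (hw0 _) hJ)
  · simp

end Conditioning

/-! ### The modified process as a sum of atoms -/

section ModifiedProcess

variable {Ω : Type*}

theorem shiftMeasure_modifiedProcess (N : List ℕ → Ω → ℕ∞) (X : List ℕ → Ω → ℕ → ℝ)
    (Y : List ℕ → Ω → ℝ) (m : ℝ) (n : ℕ) (ω : Ω) :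
    shiftMeasure (-m) (modifiedProcess N X Y n ω) =
      atomSum {u : Words n | IsAlive N u.1 ω} fun u => position X u.1 ω + Y u.1 ω - m := by
  classical
  have hsh : Measurable fun y : ℝ => y + -m := by fun_prop
  ext B hB
  rw [shiftMeasure, Measure.map_apply hsh hB, modifiedProcess, Measure.sum_apply _ (hsh hB),
    atomSum_apply hB, tsum_gen N n ω fun u =>
      Measure.dirac (position X u ω + Y u ω) ((fun y : ℝ => y + -m) ⁻¹' B)]
  refine tsum_congr fun u => ?_
  rw [Measure.dirac_apply' _ (hsh hB)]
  by_cases h : IsAlive N u.1 ω <;> simp [h, Set.indicator, sub_eq_add_neg]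

variable [MeasurableSpace Ω] {P : Measure Ω} [IsProbabilityMeasure P] {η : Measure Offspring}
  {N : List ℕ → Ω → ℕ∞} {X : List ℕ → Ω → ℕ → ℝ} {Y : List ℕ → Ω → ℝ} {ν : Measure ℝ}
  {θ δ α : ℝ}

theorem lintegral_atomSum_Icc_le (hm : ∀ u, Measurable (offspring N X u))
    (hYm : ∀ u, Measurable (Y u)) (hP : IsPerturbation P ν N X Y) (m a b : ℝ) (n : ℕ) :
    ∫⁻ ω, atomSum {u : Words n | IsAlive N u.1 ω} (fun u => position X u.1 ω + Y u.1 ω - m)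
      (Set.Icc a b) ∂P ≤ ∫⁻ ω, genSum N X (fun s => ν (Set.Ici (m + a - s))) n ω ∂P := by
  classical
  have hal (u : Words n) : MeasurableSet {ω | IsAlive N u.1 ω} :=
    measurableSet_isAlive fun v _ => hm v
  have hpos (u : Words n) : Measurable (position X u.1) := measurable_position fun v _ => hm v
  have hGm : Measurable fun s => ν (Set.Ici (m + a - s)) :=
    (show Monotone fun s => ν (Set.Ici (m + a - s)) from fun s t h =>
      measure_mono (Set.Ici_subset_Ici.mpr (by linarith))).measurable
  have hYm' : Measurable fun ω u => Y u ω := measurable_pi_lambda _ hYm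
  have hmeas (u : Words n) : Measurable fun ω => if IsAlive N u.1 ω ∧
      position X u.1 ω + Y u.1 ω - m ∈ Set.Icc a b then (1 : ℝ≥0∞) else 0 :=
    Measurable.ite ((hal u).inter ((((hpos u).add (hYm u.1)).sub_const m) measurableSet_Icc))
      measurable_const measurable_const
  have hmeas' (u : Words n) : Measurable fun ω => if IsAlive N u.1 ω then
      ν (Set.Ici (m + a - position X u.1 ω)) else 0 :=
    Measurable.ite (hal u) (hGm.comp (hpos u)) measurable_const
  have hsum (ω : Ω) : atomSum {u : Words n | IsAlive N u.1 ω}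
      (fun u => position X u.1 ω + Y u.1 ω - m) (Set.Icc a b) = ∑' u : Words n,
        if IsAlive N u.1 ω ∧ position X u.1 ω + Y u.1 ω - m ∈ Set.Icc a b then 1 else 0 := by
    rw [atomSum_apply measurableSet_Icc]
    refine tsum_congr fun u => ?_
    simp only [Set.mem_ofPred_eq]
    congr
  simp only [hsum, genSum]
  rw [lintegral_tsum fun u => (hmeas u).aemeasurable,
    lintegral_tsum fun u => (hmeas' u).aemeasurable]
  refine ENNReal.tsum_le_tsum fun u => ?_
  have hset : MeasurableSet {p : (Words n → Prop × ℝ) × (List ℕ → ℝ) |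
      (p.1 u).1 ∧ (p.1 u).2 + p.2 u.1 - m ∈ Set.Icc a b} := by
    refine MeasurableSet.inter (measurableSet_setOfPred.mpr (by fun_prop)) ?_
    exact (by fun_prop : Measurable fun p : (Words n → Prop × ℝ) × (List ℕ → ℝ) =>
      (p.1 u).2 + p.2 u.1 - m) measurableSet_Icc
  have h1 := lintegral_comp_of_indepFun (measurable_genState hm n) hYm' (indepFun_genState hP n)
    (F := fun p : (Words n → Prop × ℝ) × (List ℕ → ℝ) =>
      if (p.1 u).1 ∧ (p.1 u).2 + p.2 u.1 - m ∈ Set.Icc a b then 1 else 0)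
    (Measurable.ite hset measurable_const measurable_const)
  refine h1.le.trans (lintegral_mono fun ω => ?_)
  simp only [genState]
  split_ifs with hu
  · simp only [hu, true_and]
    have h2 := (hP.hasLaw u.1).lintegral_comp
      (f := (Set.Ici (m + a - position X u.1 ω)).indicator 1)
      (measurable_one.indicator measurableSet_Ici).aemeasurable
    rw [lintegral_indicator_one measurableSet_Ici] at h2
    rw [← h2]
    refine lintegral_mono fun ω' => ?_
    simp only [Set.indicator, Set.mem_Ici, Set.mem_Icc, Pi.one_apply]
    split_ifs with h3 h4
    · exact le_rfl
    · exact absurd h3.1 (by linarith)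
    · exact zero_le_one
    · exact le_rfl
  · simp [hu]

/-- The modified process is almost surely locally finite. -/
theorem ae_isPointMeasure_atomSum [IsProbabilityMeasure ν] (hB : IsBranchingRandomWalk P η N X)
    (hm : ∀ u, Measurable (offspring N X u)) (hYm : ∀ u, Measurable (Y u))
    (hP : IsPerturbation P ν N X Y) (hθ : 0 < θ) (hδ : 0 < δ)
    (h1 : laplaceTransform η (θ + δ) < ∞) (h2 : laplaceTransform η (θ - δ) < ∞)
    (hl : IsRegularlyVarying (expTail ν θ) α) (m : ℝ) (n : ℕ) :
    ∀ᵐ ω ∂P, IsPointMeasure (atomSum {u : Words n | IsAlive N u.1 ω}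
      fun u => position X u.1 ω + Y u.1 ω - m) := by
  have hal (u : Words n) : MeasurableSet {ω | IsAlive N u.1 ω} :=
    measurableSet_isAlive fun v _ => hm v
  have hpos (u : Words n) : Measurable (position X u.1) := measurable_position fun v _ => hm v
  obtain ⟨C, hC, hbound⟩ := exists_real_Ici_le hl hθ hδ
  simp only [isPointMeasure_atomSum_iff]
  refine ae_all_iff.mpr fun k => ?_
  set c : ℝ := m + -k with hc
  have hpt (s : ℝ) : ν (Set.Ici (c - s)) ≤
      ENNReal.ofReal C * ENNReal.ofReal (Real.exp ((θ - δ) * s - (θ - δ) * c)) +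
        ENNReal.ofReal C * ENNReal.ofReal (Real.exp ((θ + δ) * s - (θ + δ) * c)) := by
    rw [← ENNReal.ofReal_mul hC.le, ← ENNReal.ofReal_mul hC.le,
      ← ENNReal.ofReal_add (by positivity) (by positivity), ← ofReal_measureReal]
    refine ENNReal.ofReal_le_ofReal ((hbound _).trans ?_)
    rw [Real.exp_add, ← mul_add]
    refine mul_le_mul_of_nonneg_left ?_ hC.le
    refine (mul_le_mul_of_nonneg_left (exp_mul_abs_le _ _) (Real.exp_pos _).le).trans_eq ?_
    rw [mul_add, ← Real.exp_add, ← Real.exp_add]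
    ring_nf
  have hmeas (a b : ℝ) : Measurable (genSum N X
      (fun s => ENNReal.ofReal (Real.exp (a * s - b))) n) :=
    measurable_genSum (fun v _ => hm v) (by fun_prop)
  refine ae_lt_top ?_ (ne_of_lt ?_)
  · exact (Measure.measurable_coe measurableSet_Icc).comp
      (measurable_atomSum hal fun u => ((hpos u).add (hYm u.1)).sub_const m)
  · refine (lintegral_atomSum_Icc_le hm hYm hP m _ _ n).trans_lt ?_
    refine (lintegral_mono fun ω => genSum_mono hpt n ω).trans_lt ?_
    simp only [genSum_add, genSum_const_mul]
    rw [lintegral_add_left ((hmeas _ _).const_mul _), lintegral_const_mul _ (hmeas _ _),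
      lintegral_const_mul _ (hmeas _ _), lintegral_genSum_exp_sub hB hm,
      lintegral_genSum_exp_sub hB hm]
    exact ENNReal.add_lt_top.mpr
      ⟨ENNReal.mul_lt_top ENNReal.ofReal_lt_top (ENNReal.mul_lt_top ENNReal.ofReal_lt_top
        (ENNReal.pow_lt_top h2)), ENNReal.mul_lt_top ENNReal.ofReal_lt_top
        (ENNReal.mul_lt_top ENNReal.ofReal_lt_top (ENNReal.pow_lt_top h1))⟩

end ModifiedProcess

/-! ### Convergence in law -/

section Convergence

variable {Ω : Type*} [MeasurableSpace Ω] {P : Measure Ω} [IsProbabilityMeasure P]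
  {η : Measure Offspring} {N : List ℕ → Ω → ℕ∞} {X : List ℕ → Ω → ℕ → ℝ} {Y : List ℕ → Ω → ℝ}
  {ν : Measure ℝ} {L : ℝ → ℝ} {θ δ α : ℝ}

theorem enorm_integral_exp_sub_le [IsProbabilityMeasure ν] (hm : ∀ u, Measurable (offspring N X u))
    (hYm : ∀ u, Measurable (Y u)) (hP : IsPerturbation P ν N X Y) (φ : C_c(ℝ, ℝ)) (m : ℝ) (n : ℕ)
    (hpt : ∀ᵐ ω ∂P, IsPointMeasure (atomSum {u : Words n | IsAlive N u.1 ω}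
      fun u => position X u.1 ω + Y u.1 ω - m))
    {w : ℝ → ℝ} (hw : Measurable w) (hw0 : ∀ s, 0 ≤ w s)
    (hfin : ∀ᵐ ω ∂P, genSum N X (fun s => ENNReal.ofReal (w s)) n ω ≠ ∞) {J : ℂ} (hJ : J.re ≤ 0) :
    ‖∫ ω, Complex.exp ((∫ x, φ x ∂atomSum {u : Words n | IsAlive N u.1 ω}
        (fun u => position X u.1 ω + Y u.1 ω - m) : ℝ) * Complex.I) ∂P -
      ∫ ω, Complex.exp ((genSum N X (fun s => ENNReal.ofReal (w s)) n ω).toReal * J) ∂P‖ₑ ≤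
      ∫⁻ ω, genSum N X (fun s => ENNReal.ofReal (particleError ν
        (fun x => Complex.exp (φ x * Complex.I) - 1) m (w s) J s)) n ω ∂P := by
  classical
  have hal (u : Words n) : MeasurableSet {ω | IsAlive N u.1 ω} :=
    measurableSet_isAlive fun v _ => hm v
  have hpos (u : Words n) : Measurable (position X u.1) := measurable_position fun v _ => hm v
  have hφ : Measurable φ := φ.continuous.measurable
  have hmA (u : Words n) : Measurable fun ω =>
      if IsAlive N u.1 ω then φ (position X u.1 ω + Y u.1 ω - m) else 0 :=
    Measurable.ite (hal u) (hφ.comp (((hpos u).add (hYm u.1)).sub_const m)) measurable_const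
  have hmB (u : Words n) : Measurable fun ω =>
      if IsAlive N u.1 ω then w (position X u.1 ω) else 0 :=
    Measurable.ite (hal u) (hw.comp (hpos u)) measurable_const
  have hA : Tendsto (fun F : Finset (Words n) => ∫ ω, Complex.exp ((∑ u ∈ F,
      if IsAlive N u.1 ω then φ (position X u.1 ω + Y u.1 ω - m) else 0 : ℝ) * Complex.I) ∂P) atTop
      (𝓝 (∫ ω, Complex.exp ((∫ x, φ x ∂atomSum {u : Words n | IsAlive N u.1 ω}
        (fun u => position X u.1 ω + Y u.1 ω - m) : ℝ) * Complex.I) ∂P)) := by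
    refine tendsto_integral_filter_of_dominated_convergence 1 (Eventually.of_forall fun F => ?_)
      (Eventually.of_forall fun F => ae_of_all _ fun ω => ?_) (integrable_const _) ?_
    · have := Finset.measurable_sum F fun u _ => hmA u
      exact Measurable.aestronglyMeasurable (by fun_prop)
    · rw [Complex.norm_exp_ofReal_mul_I, Pi.one_apply]
    · filter_upwards [hpt] with ω hω
      have : IsFiniteMeasureOnCompacts (atomSum {u : Words n | IsAlive N u.1 ω}
        fun u => position X u.1 ω + Y u.1 ω - m) := ⟨fun _ hK => hω.1 _ hK⟩
      have h1 := hasSum_integral_atomSum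
        (show Integrable (fun x => φ x) (atomSum {u : Words n | IsAlive N u.1 ω}
            fun u => position X u.1 ω + Y u.1 ω - m) from
          φ.continuous.integrable_of_hasCompactSupport φ.hasCompactSupport)
      have h2 : HasSum (fun u : Words n => if IsAlive N u.1 ω then
          φ (position X u.1 ω + Y u.1 ω - m) else 0) (∫ x, φ x ∂atomSum
            {u : Words n | IsAlive N u.1 ω} (fun u => position X u.1 ω + Y u.1 ω - m)) := by
        convert h1 using 2
        rfl
      have h3 : Continuous fun x : ℝ => Complex.exp (x * Complex.I) := by fun_prop
      exact (h3.tendsto _).comp h2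
  have hB : Tendsto (fun F : Finset (Words n) => ∫ ω, Complex.exp ((∑ u ∈ F,
      if IsAlive N u.1 ω then w (position X u.1 ω) else 0 : ℝ) * J) ∂P) atTop
      (𝓝 (∫ ω, Complex.exp
        ((genSum N X (fun s => ENNReal.ofReal (w s)) n ω).toReal * J) ∂P)) := by
    refine tendsto_integral_filter_of_dominated_convergence 1 (Eventually.of_forall fun F => ?_)
      (Eventually.of_forall fun F => ae_of_all _ fun ω => ?_) (integrable_const _) ?_
    · have := Finset.measurable_sum F fun u _ => hmB u
      exact Measurable.aestronglyMeasurable (by fun_prop)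
    · refine norm_exp_le_one ?_
      rw [Complex.re_ofReal_mul]
      refine mul_nonpos_of_nonneg_of_nonpos (Finset.sum_nonneg fun u _ => ?_) hJ
      split_ifs
      exacts [hw0 _, le_rfl]
    · filter_upwards [hfin] with ω hω
      have h1 := ENNReal.hasSum_toReal hω
      have h2 : HasSum (fun u : Words n => if IsAlive N u.1 ω then w (position X u.1 ω) else 0)
          (genSum N X (fun s => ENNReal.ofReal (w s)) n ω).toReal := by
        rw [genSum, ENNReal.tsum_toReal_eq (ENNReal.ne_top_of_tsum_ne_top hω)]
        convert h1 using 2 with u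
        split_ifs <;> simp [hw0]
      have h3 : Continuous fun x : ℝ => Complex.exp (x * J) := by fun_prop
      exact (h3.tendsto _).comp h2
  refine le_of_tendsto (hA.sub hB).enorm (Eventually.of_forall fun F => ?_)
  rw [integral_exp_sum_words hm hYm hP hφ m F]
  exact enorm_integral_prod_sub_le hm hφ m hw hw0 hJ F

theorem integral_exponentialIntensity {c : ℝ} (hc : 0 ≤ c) (θ : ℝ) (f : ℝ → ℂ) :
    ∫ x, f x ∂exponentialIntensity c θ = c * ∫ x, f x ∂exponentialIntensity 1 θ := by
  rw [exponentialIntensity_eq_smul hc, integral_smul_measure, ENNReal.toReal_ofReal hc,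
    Complex.real_smul]

theorem re_integral_exp_sub_one_nonpos (μ : Measure ℝ) [IsFiniteMeasureOnCompacts μ]
    (φ : C_c(ℝ, ℝ)) : (∫ x, (Complex.exp (φ x * Complex.I) - 1) ∂μ).re ≤ 0 := by
  by_cases h : Integrable (fun x => Complex.exp (φ x * Complex.I) - 1) μ
  · rw [← RCLike.re_eq_complex_re, ← integral_re h]
    refine integral_nonpos fun x => ?_
    simp [Complex.exp_ofReal_mul_I_re, Real.cos_le_one]
  · simp [integral_undef h]

/-- The characteristic functionals of the shifted processes converge. -/
theorem tendsto_integral_exp_atomSum [IsProbabilityMeasure η] [IsProbabilityMeasure ν]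
    (hB : IsBranchingRandomWalk P η N X)
    (hm : ∀ u, Measurable (offspring N X u)) (hYm : ∀ u, Measurable (Y u))
    (hP : IsPerturbation P ν N X Y) (hθ : 0 < θ) (hδ : 0 < δ)
    (h0 : ∀ t, laplaceTransform η t ≠ 0) (h1 : laplaceTransform η (θ + δ) < ∞)
    (h2 : laplaceTransform η (θ - δ) < ∞) (h3 : laplaceTransform η θ ≠ ∞)
    (hb : θ * kappaDeriv η θ - kappaReal η θ < 0) (hL : IsRegularlyVarying L α)
    (hν : (fun x : ℝ => (ν (Set.Ici x)).toReal) ~[atTop] fun x => L x * Real.exp (-θ * x))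
    (hpt : ∀ n : ℕ, ∀ᵐ ω ∂P, IsPointMeasure (atomSum {u : Words n | IsAlive N u.1 ω}
      fun u => position X u.1 ω + Y u.1 ω - centring η θ L n))
    (φ : C_c(ℝ, ℝ)) :
    Tendsto (fun n : ℕ => ∫ ω, Complex.exp ((∫ x, φ x ∂atomSum {u : Words n | IsAlive N u.1 ω}
        (fun u => position X u.1 ω + Y u.1 ω - centring η θ L n) : ℝ) * Complex.I) ∂P) atTop
      (𝓝 (∫ ω, Complex.exp (additiveLimit η N X θ ω *
        ∫ x, (Complex.exp (φ x * Complex.I) - 1)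
          ∂exponentialIntensity (limitConstant η θ α) θ) ∂P)) := by
  have hc1 : 0 ≤ limitConstant η θ α := by
    refine Real.rpow_nonneg ?_ _
    rw [sub_nonneg, le_div_iff₀ hθ]
    linarith
  set J := ∫ x, (Complex.exp (φ x * Complex.I) - 1)
    ∂exponentialIntensity (limitConstant η θ α) θ with hJdef
  have hJ : J.re ≤ 0 := re_integral_exp_sub_one_nonpos _ φ
  have hfc : Continuous fun x => Complex.exp (φ x * Complex.I) - 1 := by
    have := φ.continuous
    fun_prop
  have herr := tendsto_lintegral_genSum_particleError hB hm hθ hδ h0 h1 h2 h3 hb hL hν hfc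
    (φ.hasCompactSupport.comp_left (g := fun y : ℝ => Complex.exp (y * Complex.I) - 1)
      (by simp)) fun x => (norm_sub_le _ _).trans (by
        rw [Complex.norm_exp_ofReal_mul_I, norm_one]; norm_num)
  rw [← integral_exponentialIntensity hc1, ← hJdef] at herr
  have hW (n : ℕ) : Measurable (additiveSum η N X θ n) :=
    measurable_genSum (fun v _ => hm v) (by fun_prop)
  have hfin (n : ℕ) : ∀ᵐ ω ∂P, additiveSum η N X θ n ω ≠ ∞ := by
    refine (ae_lt_top (hW n) ?_).mono fun _ => LT.lt.ne
    rw [lintegral_additiveSum hB hm (h0 θ) h3]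
    exact ENNReal.one_ne_top
  have hdiff : Tendsto (fun n : ℕ =>
      (∫ ω, Complex.exp ((∫ x, φ x ∂atomSum {u : Words n | IsAlive N u.1 ω}
        (fun u => position X u.1 ω + Y u.1 ω - centring η θ L n) : ℝ) * Complex.I) ∂P) -
      ∫ ω, Complex.exp (additiveMartingale η N X θ n ω * J) ∂P) atTop (𝓝 0) := by
    rw [tendsto_zero_iff_enorm_tendsto_zero]
    refine tendsto_of_tendsto_of_tendsto_of_le_of_le tendsto_const_nhds herr
      (fun _ => zero_le) fun n => ?_
    simp only [additiveMartingale_eq_toReal]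
    exact enorm_integral_exp_sub_le hm hYm hP φ _ n (hpt n) (by fun_prop)
      (fun s => (Real.exp_pos _).le) (hfin n) hJ
  have hlim : Tendsto (fun n : ℕ => ∫ ω, Complex.exp (additiveMartingale η N X θ n ω * J) ∂P)
      atTop (𝓝 (∫ ω, Complex.exp (additiveLimit η N X θ ω * J) ∂P)) := by
    refine tendsto_integral_of_dominated_convergence 1 (fun n => ?_) (integrable_const _)
      (fun n => ae_of_all _ fun ω => ?_) ?_
    · simp only [additiveMartingale_eq_toReal]
      have := (hW n).ennreal_toReal
      simp only [additiveSum] at this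
      exact Measurable.aestronglyMeasurable (by fun_prop)
    · refine norm_exp_le_one ?_
      rw [Complex.re_ofReal_mul, additiveMartingale_eq_toReal]
      exact mul_nonpos_of_nonneg_of_nonpos ENNReal.toReal_nonneg hJ
    · filter_upwards [ae_tendsto_additiveMartingale hB hm (h0 θ) h3] with ω hω
      have : Continuous fun x : ℝ => Complex.exp (x * J) := by fun_prop
      exact (this.tendsto _).comp hω
  simpa using hdiff.add hlim

theorem tendstoInDistribution_of_measurable [IsProbabilityMeasure η] [IsProbabilityMeasure ν]
    (hB : IsBranchingRandomWalk P η N X)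
    (hm : ∀ u, Measurable (offspring N X u)) (hYm : ∀ u, Measurable (Y u))
    (hP : IsPerturbation P ν N X Y) (hθ : 0 < θ) (hδ : 0 < δ)
    (h0 : ∀ t, laplaceTransform η t ≠ 0) (h1 : laplaceTransform η (θ + δ) < ∞)
    (h2 : laplaceTransform η (θ - δ) < ∞) (h3 : laplaceTransform η θ ≠ ∞)
    (hb : θ * kappaDeriv η θ - kappaReal η θ < 0) (hL : IsRegularlyVarying L α)
    (hν : (fun x : ℝ => (ν (Set.Ici x)).toReal) ~[atTop] fun x => L x * Real.exp (-θ * x)) :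
    (∀ᵐ ω ∂P, Tendsto (fun n => additiveMartingale η N X θ n ω) atTop
      (𝓝 (additiveLimit η N X θ ω))) ∧
    (∀ n : ℕ, ∀ᵐ ω ∂P,
      IsPointMeasure (shiftMeasure (-centring η θ L n) (modifiedProcess N X Y n ω))) ∧
    ∃ (Ω' : Type) (_ : MeasurableSpace Ω') (P' : Measure Ω') (_ : IsProbabilityMeasure P')
      (Q : Ω' → ℝ≥0) (Z : Ω' → PointMeasure),
      IdentDistrib (fun ω => (Q ω : ℝ)) (additiveLimit η N X θ) P' P ∧
      IsCoxProcess P' Q (exponentialIntensity (limitConstant η θ α) θ) Z ∧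
      TendstoInDistribution
        (fun n ω => PointMeasure.ofMeasure
          (shiftMeasure (-centring η θ L n) (modifiedProcess N X Y n ω)))
        atTop Z (fun _ => P) P' := by
  have hal (u : List ℕ) : MeasurableSet {ω | IsAlive N u ω} :=
    measurableSet_isAlive fun v _ => hm v
  have hpos (u : List ℕ) : Measurable (position X u) := measurable_position fun v _ => hm v
  have hlim := ae_tendsto_additiveMartingale hB hm (h0 θ) h3
  have hpt (n : ℕ) := ae_isPointMeasure_atomSum hB hm hYm hP hθ hδ h1 h2
    (hL.congr_isEquivalent (expTail_isEquivalent hν)) (centring η θ L n) n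
  have hMm (n : ℕ) : Measurable (additiveMartingale η N X θ n) := by
    have : additiveMartingale η N X θ n = fun ω => (additiveSum η N X θ n ω).toReal :=
      funext fun ω => additiveMartingale_eq_toReal η N X θ n ω
    rw [this]
    exact (measurable_genSum (fun v _ => hm v) (by fun_prop)).ennreal_toReal
  have hWm : AEMeasurable (additiveLimit η N X θ) P :=
    aemeasurable_of_tendsto_metrizable_ae atTop (fun n => (hMm n).aemeasurable) hlim
  have hW0 : ∀ᵐ ω ∂P, 0 ≤ additiveLimit η N X θ ω := by
    filter_upwards [hlim] with ω hω
    exact ge_of_tendsto' hω fun n => by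
      rw [additiveMartingale_eq_toReal]
      exact ENNReal.toReal_nonneg
  have hQm : AEMeasurable (fun ω => (additiveLimit η N X θ ω).toNNReal) P := hWm.real_toNNReal
  have hρ : IsProbabilityMeasure (P.map fun ω => (additiveLimit η N X θ ω).toNNReal) :=
    Measure.isProbabilityMeasure_map hQm
  obtain ⟨P', hP', Z, hfst, hcox, hchar⟩ := exists_coxProcess
    (P.map fun ω => (additiveLimit η N X θ ω).toNNReal) (limitConstant η θ α) hθ.ne'
  simp only [shiftMeasure_modifiedProcess]
  have hmeas (n : ℕ) : Measurable fun ω => PointMeasure.ofMeasure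
      (atomSum {u : Words n | IsAlive N u.1 ω}
        fun u => position X u.1 ω + Y u.1 ω - centring η θ L n) :=
    PointMeasure.measurable_ofMeasure_atomSum (fun u => hal u.1)
      fun u => ((hpos u.1).add (hYm u.1)).sub_const _
  refine ⟨hlim, hpt, _, _, P', hP', Prod.fst, Z, ⟨by fun_prop, hWm, ?_⟩, hcox,
    fun n => (hmeas n).aemeasurable, hcox.measurable_process.aemeasurable,
    PointMeasure.tendsto_of_charFunctional fun φ => ?_⟩
  · rw [show (fun ω : ℝ≥0 × CellConfig => (ω.1 : ℝ)) = NNReal.toReal ∘ Prod.fst from rfl,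
      ← Measure.map_map (by fun_prop) measurable_fst, hfst,
      AEMeasurable.map_map_of_aemeasurable (by fun_prop) hQm]
    refine Measure.map_congr ?_
    filter_upwards [hW0] with ω hω using Real.coe_toNNReal _ hω
  · have hcont : Measurable fun μ : PointMeasure =>
        Complex.exp ((∫ x, φ x ∂μ.1 : ℝ) * Complex.I) := by
      have := (PointMeasure.continuous_integral φ).measurable
      fun_prop
    simp only [ProbabilityMeasure.coe_mk]
    rw [integral_map hcox.measurable_process.aemeasurable hcont.aestronglyMeasurable, hchar,
      integral_map hQm (Measurable.aestronglyMeasurable (by fun_prop))]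
    have h4 := tendsto_integral_exp_atomSum hB hm hYm hP hθ hδ h0 h1 h2 h3 hb hL hν hpt φ
    have h5 (n : ℕ) := integral_map (hmeas n).aemeasurable (μ := P) hcont.aestronglyMeasurable
    simp only [h5]
    convert h4 using 2
    · rename_i n
      refine integral_congr_ae ?_
      filter_upwards [hpt n] with ω hω
      rw [PointMeasure.coe_ofMeasure hω]
    · refine integral_congr_ae ?_
      filter_upwards [hW0] with ω hω
      rw [Real.coe_toNNReal _ hω]

end Convergence

/-! ### Passing to measurable modifications -/

section Modification

variable {Ω : Type*} {N N' : List ℕ → Ω → ℕ∞} {X X' : List ℕ → Ω → ℕ → ℝ}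
  {Y Y' : List ℕ → Ω → ℝ} {ω : Ω}

theorem isAlive_congr (hN : ∀ u, N u ω = N' u ω) : ∀ u, IsAlive N u ω ↔ IsAlive N' u ω
  | [] => Iff.rfl
  | i :: u => by rw [IsAlive, IsAlive, isAlive_congr hN u, hN]

theorem position_congr (hX : ∀ u, X u ω = X' u ω) : ∀ u, position X u ω = position X' u ω
  | [] => rfl
  | i :: u => by rw [position, position, position_congr hX u, hX]

theorem additiveMartingale_congr (η : Measure Offspring) (θ : ℝ) (hN : ∀ u, N u ω = N' u ω)
    (hX : ∀ u, X u ω = X' u ω) (n : ℕ) :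
    additiveMartingale η N X θ n ω = additiveMartingale η N' X' θ n ω := by
  rw [additiveMartingale_eq_toReal, additiveMartingale_eq_toReal, genSum, genSum]
  congr 1
  refine tsum_congr fun u => ?_
  by_cases h : IsAlive N' u.1 ω <;> simp [isAlive_congr hN, position_congr hX, h]

theorem additiveLimit_congr (η : Measure Offspring) (θ : ℝ) (hN : ∀ u, N u ω = N' u ω)
    (hX : ∀ u, X u ω = X' u ω) : additiveLimit η N X θ ω = additiveLimit η N' X' θ ω := by
  simp only [additiveLimit, additiveMartingale_congr η θ hN hX]

theorem shiftMeasure_modifiedProcess_congr (hN : ∀ u, N u ω = N' u ω) (hX : ∀ u, X u ω = X' u ω)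
    (hY : ∀ u, Y u ω = Y' u ω) (m : ℝ) (n : ℕ) :
    shiftMeasure (-m) (modifiedProcess N X Y n ω) =
      shiftMeasure (-m) (modifiedProcess N' X' Y' n ω) := by
  simp only [shiftMeasure_modifiedProcess, isAlive_congr hN, position_congr hX, hY]

variable [MeasurableSpace Ω] {P : Measure Ω} {η : Measure Offspring} {ν : Measure ℝ}

theorem IsBranchingRandomWalk.congr (hB : IsBranchingRandomWalk P η N X)
    (h : ∀ u, offspring N X u =ᵐ[P] offspring N' X' u) : IsBranchingRandomWalk P η N' X' :=
  ⟨fun u => (hB.hasLaw u).congr (h u).symm, hB.indep.congr h⟩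

theorem IsPerturbation.congr (hP : IsPerturbation P ν N X Y)
    (h : ∀ u, offspring N X u =ᵐ[P] offspring N' X' u) (hY : ∀ u, Y u =ᵐ[P] Y' u) :
    IsPerturbation P ν N' X' Y' := by
  refine ⟨fun u => (hP.hasLaw u).congr (hY u).symm, hP.indep.congr hY, hP.indep_walk.congr ?_ ?_⟩
  · filter_upwards [ae_all_iff.mpr h] with ω hω using funext hω
  · filter_upwards [ae_all_iff.mpr hY] with ω hω using funext hω

end Modification

theorem theorem1p2 {Ω : Type*} [MeasurableSpace Ω] (P : Measure Ω) [IsProbabilityMeasure P]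
    (η : Measure Offspring) [IsProbabilityMeasure η]
    (hsuper : IsSupercritical η) (hnondeg : IsNondegenerate η)
    (ν : Measure ℝ) [IsProbabilityMeasure ν]
    (N : List ℕ → Ω → ℕ∞) (X : List ℕ → Ω → ℕ → ℝ) (Y : List ℕ → Ω → ℝ)
    (hBRW : IsBranchingRandomWalk P η N X) (hY : IsPerturbation P ν N X Y)
    (θ : ℝ) (hθ : 0 < θ) (hκ : kappa η θ < ⊤)
    (hδ : ∃ δ : ℝ, 0 < δ ∧ kappa η (θ + δ) < ⊤ ∧ kappa η (θ - δ) < ⊤)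
    (hbiggins : θ * kappaDeriv η θ - kappaReal η θ < 0)
    (hlog : ∫⁻ ω, ENNReal.ofReal (additiveMartingale η N X θ 1 ω *
      Real.posLog (additiveMartingale η N X θ 1 ω)) ∂P < ∞)
    (L : ℝ → ℝ) (α : ℝ) (hL : IsRegularlyVarying L α)
    (hν : (fun x : ℝ => (ν (Set.Ici x)).toReal) ~[atTop] fun x => L x * Real.exp (-θ * x)) :
    -- the martingale converges, and the shifted processes are almost surely point measures
    (∀ᵐ ω ∂P, Tendsto (fun n => additiveMartingale η N X θ n ω) atTop
      (𝓝 (additiveLimit η N X θ ω))) ∧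
    (∀ n : ℕ, ∀ᵐ ω ∂P,
      IsPointMeasure (shiftMeasure (-centring η θ L n) (modifiedProcess N X Y n ω))) ∧
    -- there is a Cox process driven by a copy of the limit, to which they converge in law
    ∃ (Ω' : Type) (_ : MeasurableSpace Ω') (P' : Measure Ω') (_ : IsProbabilityMeasure P')
      (Q : Ω' → ℝ≥0) (Z : Ω' → PointMeasure),
      IdentDistrib (fun ω => (Q ω : ℝ)) (additiveLimit η N X θ) P' P ∧
      IsCoxProcess P' Q (exponentialIntensity (limitConstant η θ α) θ) Z ∧
      TendstoInDistribution
        (fun n ω => PointMeasure.ofMeasure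
          (shiftMeasure (-centring η θ L n) (modifiedProcess N X Y n ω)))
        atTop Z (fun _ => P) P' := by
  obtain ⟨δ, hδ, h1, h2⟩ := hδ
  rw [kappa, ENNReal.log_lt_top_iff] at hκ h1 h2
  let G (u : List ℕ) : Ω → Offspring := (hBRW.hasLaw u).aemeasurable.mk _
  let N' (u : List ℕ) (ω : Ω) : ℕ∞ := (G u ω).1
  let X' (u : List ℕ) (ω : Ω) : ℕ → ℝ := (G u ω).2
  let Y' (u : List ℕ) : Ω → ℝ := (hY.hasLaw u).aemeasurable.mk _
  have hG (u : List ℕ) : offspring N X u =ᵐ[P] offspring N' X' u :=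
    (hBRW.hasLaw u).aemeasurable.ae_eq_mk
  have hY' (u : List ℕ) : Y u =ᵐ[P] Y' u := (hY.hasLaw u).aemeasurable.ae_eq_mk
  have hae : ∀ᵐ ω ∂P, (∀ u, N' u ω = N u ω) ∧ (∀ u, X' u ω = X u ω) ∧ ∀ u, Y' u ω = Y u ω := by
    filter_upwards [ae_all_iff.mpr hG, ae_all_iff.mpr hY'] with ω hω hω'
    exact ⟨fun u => congrArg Prod.fst (hω u).symm, fun u => congrArg Prod.snd (hω u).symm,
      fun u => (hω' u).symm⟩
  obtain ⟨hlim, hpt, Ω', mΩ', P', hP', Q, Z, hQ, hZ, hconv⟩ :=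
    tendstoInDistribution_of_measurable (hBRW.congr hG)
      (fun u => (hBRW.hasLaw u).aemeasurable.measurable_mk)
      (fun u => (hY.hasLaw u).aemeasurable.measurable_mk) (hY.congr hG hY') hθ hδ
      (laplaceTransform_ne_zero hsuper) h1 h2 hκ.ne hbiggins hL hν
  refine ⟨?_, fun n => ?_, Ω', mΩ', P', hP', Q, Z, hQ.trans (IdentDistrib.of_ae_eq
    hQ.aemeasurable_snd ?_), hZ, hconv.congr (fun n => ?_) EventuallyEq.rfl⟩
  · filter_upwards [hlim, hae] with ω hω h
    simpa only [additiveMartingale_congr η θ h.1 h.2.1, additiveLimit_congr η θ h.1 h.2.1] using hω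
  · filter_upwards [hpt n, hae] with ω hω h
    rwa [← shiftMeasure_modifiedProcess_congr h.1 h.2.1 h.2.2]
  · filter_upwards [hae] with ω h using additiveLimit_congr η θ h.1 h.2.1
  · filter_upwards [hae] with ω h
    rw [shiftMeasure_modifiedProcess_congr h.1 h.2.1 h.2.2]
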